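/- Let $M$ be a von Neumann algebra acting on a Hilbert space, with predual $M_*$ (the normal functionals), and let $A\subseteq M$ be a weak$^*$-dense C$^*$-subalgebra (not necessarily containing the unit of $M$). Let $(\alpha_t)_{t\in\mathbb R}$ be a weak$^*$-continuous one-parameter group of $*$-automorphisms of $M$ (each $\alpha_t$ and each orbit map $t\mapsto\alpha_t(x)$ is weak$^*$-continuous) which restricts to a norm-continuous one-parameter automorphism group of $A$. Write $(\alpha^M_t)$, $(\alpha^A_t)$ for the group on $M$ and its restriction to $A$, put $\alpha^{M_*}_t(\omega)=\omega\circ\alpha^M_t$ on $M_*$ and $\alpha^{A^*}_t(\mu)=\mu\circ\alpha^A_t$ on $A^*$, and let $\iota:M_*\to A^*$ be the restriction of functionals. For $z\in\mathbb C\setminus\mathbb R$ let $S(z)=\{w\in\mathbb C: 0\le \operatorname{Im} w/\operatorname{Im} z\le 1\}$, and let $S(z)=\mathbb R$ for $z\in\mathbb R$. For a one-parameter group $(\beta_t)$ of isometries of a Banach space $E$, say that $x\in D(\beta_z)$ with $\beta_z(x)=f(z)$ if there is $f:S(z)\to E$, continuous on $S(z)$ and analytic in its interior, with $f(t)=\beta_t(x)$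 for all $t\in\mathbb R$. Here continuity and analyticity are with respect to the norm for $E=A$ and $E=M_*$, and with respect to the weak$^*$-topology for $E=M$ and $E=A^*$. (1) Let $z\in\mathbb C$ and let $\omega\in M_*$ be such that $\iota(\omega)\in D(\alpha^{A^*}_z)$. Then $\omega\in D(\alpha^{M_*}_z)$, and $\alpha^{A^*}_z(\iota(\omega))=\iota(\alpha^{M_*}_z(\omega))$; in particular $\alpha^{A^*}_z(\iota(\omega))\in\iota(M_*)$ is again normal. (2) The analogous statement for the inclusion $A\to M$ fails: there exist $M$, $A$ and $(\alpha_t)$ as above and an element $a\in A$ such that $a\in D(\alpha^M_{-i})$ but $a\notin D(\alpha^A_{-i})$. -/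

import Mathlib

universe u

noncomputable section

namespace AnalyticExtension

/-! ### One-parameter groups of isometries and their analytic extensions -/

/-- A one-parameter group `(α_t)` of isometries of a normed space: `α_0 = id`,
`α_{s+t} = α_s ∘ α_t`, and every `α_t` is a linear contraction (hence an isometric isomorphism).
No continuity in `t` is part of this structure. -/
structure IsometryGroup (E : Type*) [NormedAddCommGroup E] [NormedSpace ℂ E] where
  toFun : ℝ → E →L[ℂ] E
  map_zero : toFun 0 = ContinuousLinearMap.id ℂ E
  map_add : ∀ s t : ℝ, toFun (s + t) = (toFun s).comp (toFun t)
  norm_le : ∀ (t : ℝ) (x : E), ‖toFun t x‖ ≤ ‖x‖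

/-- The closed horizontal strip `S(z)` bounded by `ℝ` and `ℝ + z`; it is `ℝ` when `z` is real. -/
def strip (z : ℂ) : Set ℂ :=
  {w | if z.im = 0 then w.im = 0 else 0 ≤ w.im / z.im ∧ w.im / z.im ≤ 1}

/-- `f` is norm-regular on `S(z)`: norm-continuous there, and analytic in the interior. Only the
values of `f` on `S(z)` matter. -/
def NormRegular {E : Type*} [NormedAddCommGroup E] [NormedSpace ℂ E] (z : ℂ) (f : ℂ → E) : Prop :=
  ContinuousOn f (strip z) ∧ DifferentiableOn ℂ f (interior (strip z))

/-- `f` is weak-star-regular on `S(z)`, for the weak-star topology which the pairing `B` with the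
predual `F` induces on `E`: continuous on `S(z)` and analytic in the interior, both tested against
every element of the predual. -/
def WeakStarRegular {E F : Type*} [AddCommMonoid E] [Module ℂ E] [AddCommMonoid F] [Module ℂ F]
    (B : E →ₗ[ℂ] F →ₗ[ℂ] ℂ) (z : ℂ) (f : ℂ → E) : Prop :=
  ∀ y : F, ContinuousOn (fun w => B (f w) y) (strip z) ∧
    DifferentiableOn ℂ (fun w => B (f w) y) (interior (strip z))

namespace IsometryGroup

section Graphs

variable {E : Type*} [NormedAddCommGroup E] [NormedSpace ℂ E]

/-- The graph `{(x, α_z(x))}` of the analytic extension `α_z` of a norm-continuous group: there is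
a norm-regular extension `f` of the orbit map `t ↦ α_t(x)` to `S(z)`, with `f(z) = y`. -/
def normGraph (α : IsometryGroup E) (z : ℂ) : Set (E × E) :=
  {p | ∃ f : ℂ → E, NormRegular z f ∧ (∀ t : ℝ, f (t : ℂ) = α.toFun t p.1) ∧ f z = p.2}

/-- The domain `D(α_z)` for a norm-continuous group. -/
def normDomain (α : IsometryGroup E) (z : ℂ) : Set E :=
  {x | ∃ y, (x, y) ∈ α.normGraph z}

/-- The graph `{(x, α_z(x))}` of the analytic extension `α_z` of a weak-star-continuous group:
there is a weak-star-regular extension `f` of the orbit map of `x` to `S(z)`, with `f(z) = y`. -/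
def weakStarGraph {F : Type*} [AddCommMonoid F] [Module ℂ F] (α : IsometryGroup E)
    (B : E →ₗ[ℂ] F →ₗ[ℂ] ℂ) (z : ℂ) : Set (E × E) :=
  {p | ∃ f : ℂ → E, WeakStarRegular B z f ∧ (∀ t : ℝ, f (t : ℂ) = α.toFun t p.1) ∧ f z = p.2}

/-- The domain `D(α_z)` for a weak-star-continuous group. -/
def weakStarDomain {F : Type*} [AddCommMonoid F] [Module ℂ F] (α : IsometryGroup E)
    (B : E →ₗ[ℂ] F →ₗ[ℂ] ℂ) (z : ℂ) : Set E :=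
  {x | ∃ y, (x, y) ∈ α.weakStarGraph B z}

/-- The adjoint group `(α_t^*)` on the dual space: `α_t^*(μ) = μ ∘ α_t`. -/
def dual (α : IsometryGroup E) : IsometryGroup (StrongDual ℂ E) where
  toFun t := ContinuousLinearMap.precomp ℂ (α.toFun t)
  map_zero := by
    ext μ x
    simp [α.map_zero]
  map_add s t := by
    ext μ x
    simp [add_comm s t, α.map_add]
  norm_le t μ := by
    refine ContinuousLinearMap.opNorm_le_bound _ (norm_nonneg _) fun x => ?_
    exact (μ.le_opNorm _).trans
      (mul_le_mul_of_nonneg_left (α.norm_le t x) (norm_nonneg _))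

/-- The restriction of a one-parameter group to an invariant subspace. -/
def restrict (α : IsometryGroup E) (p : Submodule ℂ E) (hp : ∀ t, ∀ x ∈ p, α.toFun t x ∈ p) :
    IsometryGroup p where
  toFun t := (α.toFun t).restrict (hp t)
  map_zero := by
    ext x
    simp [α.map_zero]
  map_add s t := by
    ext x
    simp [α.map_add]
  norm_le t x := α.norm_le t x

end Graphs

end IsometryGroup

/-! ### Von Neumann algebras: the predual and the weak-star topology -/

section VonNeumann

variable {H : Type u} [NormedAddCommGroup H] [InnerProductSpace ℂ H] [CompleteSpace H]

/-- The vector functional `x ↦ ⟨ξ, x η⟩` on `M`. -/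
def vectorFunctional (M : VonNeumannAlgebra H) (ξ η : H) : StrongDual ℂ M.toStarSubalgebra :=
  (innerSL ℂ ξ).comp ((ContinuousLinearMap.apply ℂ H η).comp
    (M.toStarSubalgebra.toSubalgebra.toSubmodule.subtypeL))

/-- The predual `M_*`: the Banach space of normal functionals on `M`, that is, the norm-closed
linear span of the vector functionals in the dual space of `M`. -/
def predual (M : VonNeumannAlgebra H) : Submodule ℂ (StrongDual ℂ M.toStarSubalgebra) :=
  (Submodule.span ℂ (Set.range fun p : H × H => vectorFunctional M p.1 p.2)).topologicalClosure

/-- The pairing `⟨x, ω⟩ = ω(x)` between `M` and `M_*`. -/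
def predualPairing (M : VonNeumannAlgebra H) :
    M.toStarSubalgebra →ₗ[ℂ] predual M →ₗ[ℂ] ℂ :=
  LinearMap.flip ((ContinuousLinearMap.coeLM ℂ).comp (predual M).subtype)

/-- The pairing `⟨μ, x⟩ = μ(x)` between the dual space of `E` and `E`. -/
def dualPairing (E : Type*) [NormedAddCommGroup E] [NormedSpace ℂ E] :
    StrongDual ℂ E →ₗ[ℂ] E →ₗ[ℂ] ℂ :=
  ContinuousLinearMap.coeLM ℂ

/-- The weak-star topology `σ(M, M_*)`. -/
@[reducible] def weakStar (M : VonNeumannAlgebra H) : TopologicalSpace M.toStarSubalgebra :=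
  TopologicalSpace.induced (fun x => fun ω : predual M => predualPairing M x ω) inferInstance

/-- A weak-star-continuous one-parameter automorphism group of `M`: a one-parameter isometry group
of `*`-homomorphisms, each weak-star-continuous, with weak-star-continuous orbit maps. -/
structure AutGroup (M : VonNeumannAlgebra H) extends IsometryGroup M.toStarSubalgebra where
  map_mul : ∀ (t : ℝ) (x y : M.toStarSubalgebra), toFun t (x * y) = toFun t x * toFun t y
  map_star : ∀ (t : ℝ) (x : M.toStarSubalgebra), toFun t (star x) = star (toFun t x)
  continuous_weakStar : ∀ t : ℝ, @Continuous _ _ (weakStar M) (weakStar M) (toFun t)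
  continuous_orbit : ∀ x : M.toStarSubalgebra,
    @Continuous _ _ _ (weakStar M) (fun t : ℝ => toFun t x)

/-- The underlying normed space of a `*`-subalgebra `A` of `M`. -/
abbrev space {M : VonNeumannAlgebra H} (A : NonUnitalStarSubalgebra ℂ M.toStarSubalgebra) :
    Submodule ℂ M.toStarSubalgebra :=
  A.toNonUnitalSubalgebra.toSubmodule

namespace AutGroup

variable {M : VonNeumannAlgebra H}

/-- `A ⊆ M` is a C*-subalgebra (not assumed to contain the unit of `M`), weak-star-dense in `M`,
to which `(α_t)` restricts as a norm-continuous one-parameter automorphism group. -/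
structure RestrictsTo (α : AutGroup M) (A : NonUnitalStarSubalgebra ℂ M.toStarSubalgebra) :
    Prop where
  isClosed : IsClosed (A : Set M.toStarSubalgebra)
  dense : @Dense M.toStarSubalgebra (weakStar M) (A : Set M.toStarSubalgebra)
  invariant : ∀ t : ℝ, ∀ a ∈ space A, α.toFun t a ∈ space A
  continuous_orbit : ∀ a ∈ A, Continuous fun t : ℝ => α.toFun t a

/-- The restriction `(α_t^A)` of `(α_t)` to `A`. -/
def onSub (α : AutGroup M) {A : NonUnitalStarSubalgebra ℂ M.toStarSubalgebra}
    (hA : α.RestrictsTo A) : IsometryGroup (space A) :=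
  α.toIsometryGroup.restrict (space A) hA.invariant

/-- The adjoint of a weak-star-continuous operator maps `M_*` to `M_*`. -/
theorem dual_mem_predual (α : AutGroup M) (t : ℝ) (ω : StrongDual ℂ M.toStarSubalgebra)
    (hω : ω ∈ predual M) : α.toIsometryGroup.dual.toFun t ω ∈ predual M := by
  have hspan : Submodule.span ℂ (Set.range fun ω : predual M =>
      ((ω : StrongDual ℂ M.toStarSubalgebra) : M.toStarSubalgebra →ₗ[ℂ] ℂ)) =
      (predual M).map (ContinuousLinearMap.coeLM ℂ) := by
    rw [← Submodule.span_eq ((predual M).map (ContinuousLinearMap.coeLM ℂ))]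
    congr 1
    ext φ
    simp
  have hc : (((ω.comp (α.toFun t) : StrongDual ℂ M.toStarSubalgebra)) :
      M.toStarSubalgebra →ₗ[ℂ] ℂ) ∈ Submodule.span ℂ (Set.range fun ω : predual M =>
      ((ω : StrongDual ℂ M.toStarSubalgebra) : M.toStarSubalgebra →ₗ[ℂ] ℂ)) := by
    rw [LinearMap.mem_span_iff_continuous]
    have h1 : @Continuous _ _ (weakStar M) _ (fun x : M.toStarSubalgebra => ω x) := by
      have h2 : @Continuous _ _ (weakStar M) _
          (fun x : M.toStarSubalgebra => fun ω : predual M => predualPairing M x ω) :=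
        continuous_induced_dom
      let _ := weakStar M
      exact (continuous_apply (⟨ω, hω⟩ : predual M)).comp h2
    have h3 : @Continuous _ _ (weakStar M) _
        (fun x : M.toStarSubalgebra => ω (α.toFun t x)) := by
      let _ := weakStar M
      exact Continuous.comp h1 (α.continuous_weakStar t)
    convert h3 using 1
    · exact (induced_to_pi _).symm
    · rfl
  rw [hspan] at hc
  obtain ⟨ψ, hψ, he⟩ := hc
  have : ψ = ω.comp (α.toFun t) := ContinuousLinearMap.coe_injective he
  rw [this] at hψ
  exact hψ

/-- The preadjoint group `(α_t^{M_*})` on `M_*`: `α_t^{M_*}(ω) = ω ∘ α_t`. -/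
def onPredual (α : AutGroup M) : IsometryGroup (predual M) :=
  α.toIsometryGroup.dual.restrict (predual M) α.dual_mem_predual

/-- The domain `D(α_z^M)`, for the weak-star topology of `M`. -/
def domain (α : AutGroup M) (z : ℂ) : Set M.toStarSubalgebra :=
  α.toIsometryGroup.weakStarDomain (predualPairing M) z

/-- The domain `D(α_z^A)`, for the norm topology of `A`. -/
def subDomain (α : AutGroup M) {A : NonUnitalStarSubalgebra ℂ M.toStarSubalgebra}
    (hA : α.RestrictsTo A) (z : ℂ) : Set (space A) :=
  (α.onSub hA).normDomain z

/-- The graph of `α_z^{A^*}`, for the weak-star topology `σ(A^*, A)`. -/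
def dualGraph (α : AutGroup M) {A : NonUnitalStarSubalgebra ℂ M.toStarSubalgebra}
    (hA : α.RestrictsTo A) (z : ℂ) : Set (StrongDual ℂ (space A) × StrongDual ℂ (space A)) :=
  (α.onSub hA).dual.weakStarGraph (dualPairing (space A)) z

/-- The domain `D(α_z^{A^*})`, for the weak-star topology `σ(A^*, A)`. -/
def dualDomain (α : AutGroup M) {A : NonUnitalStarSubalgebra ℂ M.toStarSubalgebra}
    (hA : α.RestrictsTo A) (z : ℂ) : Set (StrongDual ℂ (space A)) :=
  (α.onSub hA).dual.weakStarDomain (dualPairing (space A)) z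

/-- The graph of `α_z^{M_*}`, for the norm topology of `M_*`. -/
def predualGraph (α : AutGroup M) (z : ℂ) : Set (predual M × predual M) :=
  α.onPredual.normGraph z

/-- The domain `D(α_z^{M_*})`, for the norm topology of `M_*`. -/
def predualDomain (α : AutGroup M) (z : ℂ) : Set (predual M) :=
  α.onPredual.normDomain z

end AutGroup

/-- The map `ι : M_* → A^*` restricting normal functionals to `A`. -/
def iota {M : VonNeumannAlgebra H} (A : NonUnitalStarSubalgebra ℂ M.toStarSubalgebra)
    (ω : predual M) : StrongDual ℂ (space A) :=
  (ω : StrongDual ℂ M.toStarSubalgebra).comp (space A).subtypeL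

end VonNeumann

end AnalyticExtension

end

open AnalyticExtension

/-!
Part (1) is a theorem of F. and M. Riesz type. An analytic extension `f` of the orbit of `ι(ω)`
takes values in `ι(M_*)` on the real line, and `ι(M_*)` is a norm-closed subspace of `A^*`, since
`‖ω‖ ≤ 2 ‖ι(ω)‖` by Kaplansky density (`norm_le_two_mul_norm_iota`). If `f` were norm-regular,
Hahn-Banach and the uniqueness of analytic functions on a strip with given values on `ℝ` would
keep all of `f` in `ι(M_*)` (`exists_lift_of_real`). But `f` is only weak-star regular, so the whole
difficulty is that on the dual of a C⋆-algebra weak-star regularity of an orbit implies norm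
regularity (`normRegular_of_weakStarRegular`).

At interior points Cauchy's estimates give norm analyticity. For the boundary the strip is mapped
to the disc. A bounded weak-star holomorphic function `F` on the disc with values in `A^*` has
weak-star boundary values that form a bounded functional on `C(𝕋, A)`. By the Jordan decomposition
and the GNS construction this functional is a matrix coefficient of a Hilbert space
representation, on which the coordinate function of the circle acts as a unitary commuting with
`A` (`exists_representation`). The vanishing of its negative Fourier coefficients and a wandering
subspace decomposition for that unitary (`exists_wandering_decomposition`) factor `F` as a product
of two Hilbert-space-valued functions in the Hardy space `H²` (`exists_factorization`). Such
functions have radial limits in norm almost everywhere, hence so does `F`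
(`ae_exists_radial_limit`). It is enough to have one point `q` of the boundary line and an
interior point `p` with `f(q)` close to `f(p)`: real translations act by isometries and commute
with `f`, so `f(w) - f(w - (q - p))` is small on the whole boundary line, and by a three-lines
estimate also near it (`continuousWithinAt_top`).

For real `z` the strip has no interior and the claim is the norm continuity of the preadjoint group
(`continuous_onPredual`): every functional on `M_*` comes from `M`, so orbits are norm-separable,
and Baire's theorem applies.

For part (2), `M` is the algebra of all bounded operators on `ℓ²(ℤ)`, `A` the compact operators,
`α_t` is implemented by `diag(exp(itk/2))`, and `a` is the operator `x ↦ (k ↦ exp(-|k|) x(-k))`.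
The extension `x ↦ (k ↦ exp(iζk - |k|) x(-k))` of its orbit is bounded by `1` for `|Im ζ| ≤ 1`,
but at `ζ = -i` it has entries `1` at `(k, -k)` for all `k ≥ 0`, so it leaves `A`.
-/

namespace AnalyticExtension

section

open scoped ComplexOrder InnerProductSpace ComplexStarModule
open Complex Filter Topology Metric

/-! ### Functionals on C⋆-algebras as matrix coefficients -/

section Representation

variable {B : Type*} [CStarAlgebra B]

theorem norm_le_of_neg_le_of_le_algebraMap [PartialOrder B] [StarOrderedRing B] [Nontrivial B]
    {h : B} {t : ℝ}
    (hh : IsSelfAdjoint h) (h1 : -(algebraMap ℝ B t) ≤ h) (h2 : h ≤ algebraMap ℝ B t) : ‖h‖ ≤ t := by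
  obtain h' | h' := CStarAlgebra.norm_or_neg_norm_mem_spectrum hh
  · exact (le_algebraMap_iff_spectrum_le (a := h)).1 h2 _ h'
  · rw [← map_neg] at h1
    have := (algebraMap_le_iff_le_spectrum (a := h)).1 h1 _ h'
    linarith

theorem realPart_le_algebraMap_norm [PartialOrder B] [StarOrderedRing B] (b : B) :
    -(algebraMap ℝ B ‖b‖) ≤ (ℜ b : B) ∧ (ℜ b : B) ≤ algebraMap ℝ B ‖b‖ := by
  have h1 := (ℜ b).2.neg_algebraMap_norm_le_self
  have h2 := (ℜ b).2.le_algebraMap_norm_self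
  have h3 : ‖(ℜ b : B)‖ ≤ ‖b‖ := realPart.norm_le b
  have h4 : algebraMap ℝ B ‖(ℜ b : B)‖ ≤ algebraMap ℝ B ‖b‖ := algebraMap_mono _ h3
  exact ⟨(neg_le_neg h4).trans h1, h2.trans h4⟩

theorem realPart_algebraMap_add [PartialOrder B] [StarOrderedRing B] (t : ℝ) (b : B) :
    (ℜ (algebraMap ℝ B t + b) : B) = algebraMap ℝ B t + (ℜ b : B) := by
  have : IsSelfAdjoint (algebraMap ℝ B t) := IsSelfAdjoint.algebraMap B (.all t)
  rw [map_add, AddSubgroup.coe_add, this.coe_realPart]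

/-- The Jordan decomposition of a bounded functional on a unital C⋆-algebra: its real part is a
combination of four positive functionals. -/
theorem exists_jordan_decomposition [PartialOrder B] [StarOrderedRing B] (Λ : StrongDual ℂ B) :
    ∃ ψ : Fin 4 → B →ₗ[ℝ] ℝ, (∀ i b, 0 ≤ (ℜ b : B) → 0 ≤ ψ i b) ∧
      ∀ b, (Λ b).re = ψ 0 b - ψ 1 b + (ψ 2 (I • b) - ψ 3 (I • b)) := by
  cases subsingleton_or_nontrivial B
  · refine ⟨0, by simp, fun b => ?_⟩
    simp [Subsingleton.elim b 0]
  -- On the real subspace of the tuples `(t + b, t - b, t + ib, t - ib)` of `B⁴` the functional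
  -- `4 ‖Λ‖ t + Re Λ b` is positive, since positivity of the tuple forces `‖Re b‖, ‖Im b‖ ≤ t`. A
  -- positive extension to `B⁴` has the four required components.
  let s : PointedCone ℝ (Fin 4 → B) :=
    { carrier := {x | ∀ i, 0 ≤ (ℜ (x i) : B)}
      add_mem' := fun {x y} hx hy i => by
        simpa using add_nonneg (hx i) (hy i)
      zero_mem' := by simp
      smul_mem' := fun c x hx i => by
        have := smul_nonneg c.2 (hx i)
        simpa [NNReal.smul_def] using! this }
  let u : ℝ →ₗ[ℝ] B := Algebra.linearMap ℝ B
  let k : B →ₗ[ℝ] B := (LinearMap.lsmul ℂ B I).restrictScalars ℝ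
  let j : ℝ × B →ₗ[ℝ] (Fin 4 → B) := LinearMap.pi
    ![u.coprod LinearMap.id, u.coprod (-LinearMap.id), u.coprod k, u.coprod (-k)]
  have hj0 : ∀ t b, j (t, b) 0 = algebraMap ℝ B t + b := fun t b => by simp [j, u]
  have hj1 : ∀ t b, j (t, b) 1 = algebraMap ℝ B t + -b := fun t b => by simp [j, u]
  have hj2 : ∀ t b, j (t, b) 2 = algebraMap ℝ B t + I • b := fun t b => by simp [j, u, k]
  have hj3 : ∀ t b, j (t, b) 3 = algebraMap ℝ B t + -(I • b) := fun t b => by simp [j, u, k]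
  have hinj : Function.Injective j := by
    rw [← LinearMap.ker_eq_bot, LinearMap.ker_eq_bot']
    rintro ⟨t, b⟩ h
    have h0 := (hj0 t b).symm.trans (congrFun h 0)
    have h1 := (hj1 t b).symm.trans (congrFun h 1)
    simp only [Pi.zero_apply] at h0 h1
    have h2 : algebraMap ℝ B (t + t) = 0 := by
      rw [map_add, ← add_zero (0 : B)]
      nth_rewrite 1 [← h0]; rw [← h1]; abel
    have ht : t = 0 := by
      have := (map_eq_zero_iff _ (algebraMap ℝ B).injective).1 h2
      linarith
    subst ht
    simpa using h0
  let f0 : ℝ × B →ₗ[ℝ] ℝ := LinearMap.coprod ((4 * ‖Λ‖) • LinearMap.id)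
    (Complex.reLm.comp (Λ.toLinearMap.restrictScalars ℝ))
  let e := LinearEquiv.ofInjective j hinj
  let f : (Fin 4 → B) →ₗ.[ℝ] ℝ := ⟨LinearMap.range j, f0.comp e.symm.toLinearMap⟩
  have hf : ∀ t b (h : j (t, b) ∈ f.domain), f ⟨j (t, b), h⟩ = 4 * ‖Λ‖ * t + (Λ b).re := by
    intro t b h
    have : e.symm ⟨j (t, b), h⟩ = (t, b) := by
      rw [LinearEquiv.symm_apply_eq]; rfl
    change f0 (e.symm ⟨j (t, b), h⟩) = _
    rw [this]
    simp [f0]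
  obtain ⟨g, hg1, hg2⟩ := riesz_extension s f (by
    rintro ⟨x, ⟨⟨t, b⟩, rfl⟩⟩ hx
    refine le_of_le_of_eq ?_ (hf t b _).symm
    have h0 := hx 0
    have h1 := hx 1
    have h2 := hx 2
    have h3 := hx 3
    simp only [hj0, hj1, hj2, hj3, realPart_algebraMap_add] at h0 h1 h2 h3
    have e1 : ‖(ℜ b : B)‖ ≤ t := by
      refine norm_le_of_neg_le_of_le_algebraMap (ℜ b).2 ?_ ?_
      · rwa [neg_le_iff_add_nonneg']
      · simpa [← sub_eq_add_neg] using h1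
    have e2 : ‖(ℑ b : B)‖ ≤ t := by
      refine norm_le_of_neg_le_of_le_algebraMap (ℑ b).2 ?_ ?_
      · rw [neg_le_iff_add_nonneg']; simpa using h3
      · simpa [← sub_eq_add_neg] using h2
    have e3 : ‖b‖ ≤ t + t := by
      conv_lhs => rw [← realPart_add_I_smul_imaginaryPart b]
      refine (norm_add_le _ _).trans (add_le_add e1 ?_)
      rw [norm_smul]; simpa using e2
    have e4 : |(Λ b).re| ≤ ‖Λ‖ * (t + t) := (Complex.abs_re_le_norm _).trans
      ((Λ.le_opNorm b).trans (by gcongr))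
    have e5 := neg_abs_le (Λ b).re
    have e6 : 0 ≤ ‖Λ‖ * t := mul_nonneg (norm_nonneg _) ((norm_nonneg _).trans e1)
    nlinarith) (by
    intro y
    refine ⟨⟨j (‖y‖, 0), ⟨_, rfl⟩⟩, fun i => ?_⟩
    have : j (‖y‖, 0) i = algebraMap ℝ B ‖y‖ := by
      fin_cases i <;> simp [j, u, k]
    change 0 ≤ (ℜ (j (‖y‖, 0) i + y i) : B)
    rw [this, realPart_algebraMap_add, ← neg_le_iff_add_nonneg']
    exact le_trans (neg_le_neg (algebraMap_mono _ (norm_le_pi_norm y i)))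
      (realPart_le_algebraMap_norm (y i)).1)
  refine ⟨fun i => g.comp (LinearMap.single ℝ (fun _ => B) i), fun i b hb => hg2 _ fun l => ?_, ?_⟩
  · by_cases h : l = i
    · subst h; simpa using hb
    · simp [Pi.single_eq_of_ne h]
  · intro b
    have h := (hg1 ⟨j (0, b), ⟨_, rfl⟩⟩).trans (hf 0 b _)
    simp only [mul_zero, zero_add] at h
    rw [← h]
    have : j (0, b) = Pi.single 0 b + Pi.single 1 (-b) + Pi.single 2 (I • b) +
        Pi.single 3 (-(I • b)) := by
      ext i; fin_cases i <;> simp [j, u, k]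
    change g (j (0, b)) = _
    rw [this]
    simp only [map_add, LinearMap.comp_apply, LinearMap.coe_single, Pi.single_neg, map_neg]
    ring

/-- The Cauchy-Schwarz inequality for the pair `1`, `b` and a real positive functional. -/
theorem sq_le_mul_of_nonneg_realPart [PartialOrder B] [StarOrderedRing B] (φ : B →ₗ[ℝ] ℝ)
    (hφ : ∀ b, 0 ≤ (ℜ b : B) → 0 ≤ φ b) (b : B) : φ b ^ 2 ≤ φ 1 * φ (star b * b) := by
  have hstar : φ (star b) = φ b := by
    have h0 : ℜ (star b) = ℜ b := by ext; simp [realPart_apply_coe, add_comm]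
    have h1 := hφ (star b - b) (by simp [h0])
    have h2 := hφ (b - star b) (by simp [h0])
    rw [map_sub] at h1 h2
    linarith
  have key : ∀ s : ℝ, 0 ≤ φ (star b * b) * (s * s) + 2 * φ b * s + φ 1 := by
    intro s
    have h1 := hφ (star (s • b + 1) * (s • b + 1)) (by
      rw [(IsSelfAdjoint.star_mul_self _).coe_realPart]
      exact star_mul_self_nonneg _)
    have h2 : star (s • b + 1) * (s • b + 1) =
        (s * s) • (star b * b) + s • star b + s • b + 1 := by
      simp [add_mul, mul_add, smul_smul]; abel
    rw [h2] at h1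
    simp only [map_add, map_smul, smul_eq_mul, hstar] at h1
    linarith
  have := discrim_le_zero key
  rw [discrim] at this
  nlinarith

/-- A bounded functional on a unital C⋆-algebra is dominated by the seminorm of a positive one. -/
theorem exists_positive_dominating [PartialOrder B] [StarOrderedRing B] (Λ : StrongDual ℂ B) :
    ∃ (ψ : B →ₚ[ℂ] ℂ) (C : ℝ), 0 ≤ C ∧ ∀ b, ‖Λ b‖ ≤ C * √(ψ (star b * b)).re := by
  obtain ⟨φ, hφ, hΛ⟩ := exists_jordan_decomposition Λ
  let ψ : B →ₗ[ℝ] ℝ := ∑ i, φ i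
  have hψ : ∀ b, 0 ≤ (ℜ b : B) → 0 ≤ ψ b := fun b hb => by
    simpa [ψ] using Finset.sum_nonneg fun i _ => hφ i b hb
  have hle : ∀ i b, 0 ≤ (ℜ b : B) → φ i b ≤ ψ b := fun i b hb => by
    simpa [ψ] using Finset.single_le_sum (f := fun i => φ i b) (fun i _ => hφ i b hb)
      (Finset.mem_univ i)
  have hsq : ∀ b : B, 0 ≤ (ℜ (star b * b) : B) := fun b => by
    rw [(IsSelfAdjoint.star_mul_self _).coe_realPart]
    exact star_mul_self_nonneg _
  have hone : 0 ≤ (ℜ (1 : B) : B) := by simp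
  have hbound : ∀ i b, |φ i b| ≤ √(ψ 1) * √(ψ (star b * b)) := fun i b => by
    rw [← Real.sqrt_mul (hψ _ hone)]
    refine Real.abs_le_sqrt ((sq_le_mul_of_nonneg_realPart (φ i) (hφ i) b).trans ?_)
    exact mul_le_mul (hle i _ hone) (hle i _ (hsq b)) (hφ i _ (hsq b)) (hψ _ hone)
  have hI : ∀ b : B, star (I • b) * (I • b) = star b * b := fun b => by
    simp [smul_smul]
  have hre : ∀ b, |(Λ b).re| ≤ 4 * √(ψ 1) * √(ψ (star b * b)) := fun b => by
    have h0 := abs_le.1 (hbound 0 b)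
    have h1 := abs_le.1 (hbound 1 b)
    have h2 := abs_le.1 (hbound 2 (I • b))
    have h3 := abs_le.1 (hbound 3 (I • b))
    rw [hI] at h2 h3
    rw [hΛ, abs_le]
    constructor <;> linarith
  have him : ∀ b, |(Λ b).im| ≤ 4 * √(ψ 1) * √(ψ (star b * b)) := fun b => by
    have := hre (I • b)
    rw [hI] at this
    simpa using this
  let ψc : B →ₗ[ℂ] ℂ := Module.Dual.extendRCLike ψ
  have hψc : ∀ b, IsSelfAdjoint b → ψc b = ψ b := fun b hb => by
    have h0 : ψ (I • b) = 0 := by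
      have h1 := hψ (I • b) (by simp [hb.imaginaryPart])
      have h2 := hψ (-(I • b)) (by simp [hb.imaginaryPart])
      rw [map_neg] at h2
      linarith
    simp [ψc, Module.Dual.extendRCLike_apply, h0]
  refine ⟨PositiveLinearMap.mk₀ ψc fun b hb => ?_, 8 * √(ψ 1), by positivity, fun b => ?_⟩
  · rw [hψc b hb.isSelfAdjoint]
    exact_mod_cast hψ b (by rwa [hb.isSelfAdjoint.coe_realPart])
  · have : (PositiveLinearMap.mk₀ ψc (fun b hb => by
      rw [hψc b hb.isSelfAdjoint]
      exact_mod_cast hψ b (by rwa [hb.isSelfAdjoint.coe_realPart])) (star b * b)).re =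
        ψ (star b * b) := by
      change (ψc (star b * b)).re = _
      rw [hψc _ (IsSelfAdjoint.star_mul_self b), ofReal_re]
    rw [this]
    refine (Complex.norm_le_abs_re_add_abs_im _).trans ?_
    linarith [hre b, him b]

/-- Every bounded functional on a unital C⋆-algebra is a matrix coefficient of a
representation. -/
theorem exists_representation.{v} {B : Type v} [CStarAlgebra B] (Λ : StrongDual ℂ B) :
    ∃ (K : Type v) (_ : NormedAddCommGroup K) (_ : InnerProductSpace ℂ K) (_ : CompleteSpace K)
      (π : B →⋆ₐ[ℂ] (K →L[ℂ] K)) (ξ η : K), ∀ b, Λ b = ⟪η, π b ξ⟫_ℂ := by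
  let _ : PartialOrder B := CStarAlgebra.spectralOrder B
  let _ : StarOrderedRing B := CStarAlgebra.spectralOrderedRing B
  obtain ⟨ψ, C, hC, hΛ⟩ := exists_positive_dominating Λ
  let L0 : ψ.PreGNS →L[ℂ] ℂ := LinearMap.mkContinuous (Λ.toLinearMap.comp ψ.ofPreGNS.toLinearMap) C
    fun x => by
      rw [ψ.preGNS_norm_def]
      exact hΛ _
  let L : StrongDual ℂ ψ.GNS :=
    L0.extend (UniformSpace.Completion.toComplL (𝕜 := ℂ) (E := ψ.PreGNS))
  refine ⟨ψ.GNS, inferInstance, inferInstance, inferInstance, ψ.gnsStarAlgHom,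
    ((ψ.toPreGNS 1 : ψ.PreGNS) : ψ.GNS), (InnerProductSpace.toDual ℂ ψ.GNS).symm L, fun b => ?_⟩
  rw [InnerProductSpace.toDual_symm_apply]
  have : L ((ψ.leftMulMapPreGNS b (ψ.toPreGNS 1) : ψ.PreGNS) : ψ.GNS) =
      L0 (ψ.leftMulMapPreGNS b (ψ.toPreGNS 1)) :=
    ContinuousLinearMap.extend_eq _
      (UniformSpace.Completion.denseRange_coe) (UniformSpace.Completion.isUniformInducing_coe _) _
  change Λ b = L (ψ.gnsNonUnitalStarAlgHom b ((ψ.toPreGNS 1 : ψ.PreGNS) : ψ.GNS))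
  rw [PositiveLinearMap.gnsNonUnitalStarAlgHom_apply_coe, this]
  simp [L0]

end Representation

/-! ### Wandering subspaces -/

section Wandering

variable {K : Type*} [NormedAddCommGroup K] [InnerProductSpace ℂ K] [CompleteSpace K]
  {A : Type*} [Ring A] [Algebra ℂ A] [StarRing A]

/-- The wandering subspace decomposition. Let a unitary `Z` commute with a representation `π`, and
let `η` be orthogonal to `Z ^ k (π a ξ)` for all `k ≥ 1`. Then the coefficients
`⟪Z ^ n η, π a ξ⟫` are the Cauchy products of two square-summable sequences of vectors. -/
theorem exists_wandering_decomposition (Z : K ≃ₗᵢ[ℂ] K) (π : A →⋆ₐ[ℂ] (K →L[ℂ] K)) (ξ η : K)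
    (hZ : ∀ a x, Z (π a x) = π a (Z x))
    (h : ∀ a (k : ℕ), ⟪η, Z^[k + 1] (π a ξ)⟫_ℂ = 0) :
    ∃ x y : ℕ → K, (Summable fun i => ‖x i‖ ^ 2) ∧ (Summable fun i => ‖y i‖ ^ 2) ∧
      ∀ n a, ⟪Z^[n] η, π a ξ⟫_ℂ =
        ∑ p ∈ Finset.HasAntidiagonal.antidiagonal n, ⟪y p.2, π a (x p.1)⟫_ℂ := by
  -- `S` is the invariant subspace generated by `ξ`, and `S' = Z S`; the vectors of the two
  -- sequences are components orthogonal to `S'`.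
  let S : Submodule ℂ K := (Submodule.span ℂ {v | ∃ a, ∃ k : ℕ, v = Z^[k] (π a ξ)}).topologicalClosure
  have hSc : IsClosed (S : Set K) := Submodule.isClosed_topologicalClosure _
  have hsub : ∀ (T : K →L[ℂ] K), (∀ a (k : ℕ), T (Z^[k] (π a ξ)) ∈ S) → ∀ v ∈ S, T v ∈ S := by
    intro T hT v hv
    have : S ≤ S.comap T.toLinearMap := by
      refine Submodule.topologicalClosure_minimal _ ?_ (hSc.preimage T.continuous)
      rw [Submodule.span_le]
      rintro _ ⟨a, k, rfl⟩
      exact hT a k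
    exact this hv
  have hgen : ∀ a (k : ℕ), Z^[k] (π a ξ) ∈ S := fun a k =>
    Submodule.le_topologicalClosure _ (Submodule.subset_span ⟨a, k, rfl⟩)
  have hZk : ∀ (k : ℕ) a x, Z^[k] (π a x) = π a (Z^[k] x) := by
    intro k a
    induction k with
    | zero => simp
    | succ k ih => intro x; rw [Function.iterate_succ_apply', ih, hZ, Function.iterate_succ_apply']
  have hZS : ∀ v ∈ S, Z v ∈ S := hsub (Z : K →L[ℂ] K) fun a k => by
    have := hgen a (k + 1)
    rwa [Function.iterate_succ_apply'] at this
  have hπS : ∀ a, ∀ v ∈ S, π a v ∈ S := fun a => hsub (π a) fun b k => by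
    have := hgen (a * b) k
    rw [hZk, map_mul, mul_apply_eq_comp] at this
    rwa [hZk]
  have hξS : ξ ∈ S := by
    simpa using hgen 1 0
  let S' : Submodule ℂ K := S.map (Z : K →L[ℂ] K).toLinearMap
  have hS'c : IsClosed (S' : Set K) := by
    have : (S' : Set K) = Z.toHomeomorph '' S := rfl
    rw [this]
    exact Z.toHomeomorph.isClosed_image.2 hSc
  have : CompleteSpace S := hSc.completeSpace_coe
  have : CompleteSpace S' := hS'c.completeSpace_coe
  have hηS' : ∀ v ∈ S, ⟪η, Z v⟫_ℂ = 0 := by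
    intro v hv
    have : S ≤ LinearMap.ker ((innerSL ℂ η).comp (Z : K →L[ℂ] K)).toLinearMap := by
      refine Submodule.topologicalClosure_minimal _ ?_ (ContinuousLinearMap.isClosed_ker _)
      rw [Submodule.span_le]
      rintro _ ⟨a, k, rfl⟩
      have := h a k
      rw [Function.iterate_succ_apply'] at this
      simpa using this
    exact this hv
  let P := S.starProjection
  let P' := S'.starProjection
  have hP'S : ∀ v, P' v ∈ S' := fun v => Submodule.starProjection_apply_mem _ _
  have hPS : ∀ v, P v ∈ S := fun v => Submodule.starProjection_apply_mem _ _
  have hS'S : S' ≤ S := by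
    rintro _ ⟨v, hv, rfl⟩
    exact hZS v hv
  have hZP : ∀ v, P' (Z v) = Z (P v) := by
    intro v
    refine Submodule.eq_starProjection_of_mem_of_inner_eq_zero ⟨P v, hPS v, rfl⟩ ?_
    rintro _ ⟨w, hw, rfl⟩
    rw [← map_sub]
    change ⟪Z _, Z _⟫_ℂ = 0
    rw [Z.inner_map_map]
    exact Submodule.starProjection_inner_eq_zero v w hw
  -- the remainders `k i` of the expansion of `ξ`
  let k : ℕ → K := fun n => (fun v => Z.symm (P' v))^[n] ξ
  have hk_succ : ∀ n, Z (k (n + 1)) = P' (k n) := fun n => by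
    simp only [k, Function.iterate_succ_apply', LinearIsometryEquiv.apply_symm_apply]
  have hkS : ∀ n, k n ∈ S := by
    intro n
    cases n with
    | zero => exact hξS
    | succ n =>
      obtain ⟨v, hv, hv'⟩ := hP'S (k n)
      rw [← hk_succ] at hv'
      rwa [← Z.injective hv']
  let x : ℕ → K := fun i => k i - P' (k i)
  let y : ℕ → K := fun j => P (Z^[j] η) - P' (Z^[j] η)
  have hxperp : ∀ i, ∀ v ∈ S', ⟪x i, v⟫_ℂ = 0 := fun i v hv =>
    Submodule.starProjection_inner_eq_zero (k i) v hv
  have hx : ∀ i, ‖x i‖ ^ 2 = ‖k i‖ ^ 2 - ‖k (i + 1)‖ ^ 2 := by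
    intro i
    have h1 : ‖k (i + 1)‖ = ‖P' (k i)‖ := by rw [← hk_succ, Z.norm_map]
    have h2 := norm_add_sq_eq_norm_sq_add_norm_sq_of_inner_eq_zero (x i) (P' (k i))
      (hxperp i _ (hP'S _))
    have h3 : x i + P' (k i) = k i := sub_add_cancel _ _
    rw [h3, ← h1] at h2
    nlinarith
  have hP'P : ∀ v, P' (P v) = P' v := fun v => by
    refine (Submodule.eq_starProjection_of_mem_of_inner_eq_zero (hP'S _) fun w hw => ?_).symm
    have h1 := Submodule.starProjection_inner_eq_zero (K := S') (P v) w hw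
    have h2 := Submodule.starProjection_inner_eq_zero (K := S) v w (hS'S hw)
    have : v - P' (P v) = (v - P v) + (P v - P' (P v)) := by abel
    rw [this, inner_add_left]
    change ⟪v - P v, w⟫_ℂ = 0 at h2
    change ⟪P v - P' (P v), w⟫_ℂ = 0 at h1
    rw [h1, h2, add_zero]
  have hη0 : P' η = 0 := by
    refine (Submodule.eq_starProjection_of_mem_of_inner_eq_zero S'.zero_mem ?_)
    rintro _ ⟨w, hw, rfl⟩
    simpa using hηS' w hw
  have hyperp : ∀ j, ∀ v ∈ S', ⟪y j, v⟫_ℂ = 0 := fun j v hv => by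
    have := Submodule.starProjection_inner_eq_zero (K := S') (P (Z^[j] η)) v hv
    change ⟪P (Z^[j] η) - P' (P (Z^[j] η)), v⟫_ℂ = 0 at this
    rwa [hP'P] at this
  have hy' : ∀ j, ‖y j‖ ^ 2 = ‖P (Z^[j] η)‖ ^ 2 - ‖P' (Z^[j] η)‖ ^ 2 := by
    intro j
    have h2 := norm_add_sq_eq_norm_sq_add_norm_sq_of_inner_eq_zero (y j) (P' (Z^[j] η))
      (hyperp j _ (hP'S _))
    have h3 : y j + P' (Z^[j] η) = P (Z^[j] η) := sub_add_cancel _ _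
    rw [h3] at h2
    nlinarith
  -- both square sums telescope
  have hsumx : ∀ n, ∑ i ∈ Finset.range n, ‖x i‖ ^ 2 = ‖k 0‖ ^ 2 - ‖k n‖ ^ 2 := fun n => by
    simp_rw [hx]
    exact Finset.sum_range_sub' _ n
  have hsumy : ∀ n, ∑ j ∈ Finset.range (n + 1), ‖y j‖ ^ 2 = ‖P (Z^[n] η)‖ ^ 2 := fun n => by
    induction n with
    | zero => simp [hy', hη0]
    | succ n ih =>
      rw [Finset.sum_range_succ, ih, hy', Function.iterate_succ_apply', hZP, Z.norm_map]
      ring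
  have hnorm : ∀ n, ‖Z^[n] η‖ = ‖η‖ := fun n => by
    induction n with
    | zero => rfl
    | succ n ih => rw [Function.iterate_succ_apply', Z.norm_map, ih]
  refine ⟨x, y, ?_, ?_, ?_⟩
  · refine summable_of_sum_range_le (c := ‖k 0‖ ^ 2) (fun _ => by positivity) fun n => ?_
    rw [hsumx]
    nlinarith [sq_nonneg ‖k n‖]
  · refine summable_of_sum_range_le (c := ‖η‖ ^ 2) (fun _ => by positivity) fun n => ?_
    calc _ ≤ ∑ j ∈ Finset.range (n + 1), ‖y j‖ ^ 2 :=
          Finset.sum_le_sum_of_subset_of_nonneg (by simp) fun _ _ _ => by positivity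
      _ = ‖P (Z^[n] η)‖ ^ 2 := hsumy n
      _ ≤ _ := by
        rw [← hnorm n]
        gcongr
        exact Submodule.norm_starProjection_apply_le _ _
  · -- one step of the expansion splits off the term `⟪y n, π a (x m)⟫`
    have hadj : ∀ a u v, ⟪π a u, v⟫_ℂ = ⟪u, π (star a) v⟫_ℂ := fun a u v => by
      rw [map_star, ContinuousLinearMap.star_eq_adjoint, ContinuousLinearMap.adjoint_inner_right]
    have hπS' : ∀ a, ∀ v ∈ S', π a v ∈ S' := by
      rintro a _ ⟨v, hv, rfl⟩
      exact ⟨π a v, hπS a v hv, hZ a v⟩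
    have hxS : ∀ m, x m ∈ S := fun m => S.sub_mem (hkS m) (hS'S (hP'S _))
    have hwand : ∀ n m a, ⟪Z^[n] η, π a (x m)⟫_ℂ = ⟪y n, π a (x m)⟫_ℂ := by
      intro n m a
      have h1 : ⟪P' (Z^[n] η), π a (x m)⟫_ℂ = 0 := by
        have : ∀ v ∈ S', ⟪v, π a (x m)⟫_ℂ = 0 := fun v hv => by
          have := hxperp m _ (hπS' (star a) v hv)
          rw [← hadj] at this
          rw [← inner_conj_symm, this, map_zero]
        exact this _ (hP'S _)
      have h2 : ⟪Z^[n] η - P (Z^[n] η), π a (x m)⟫_ℂ = 0 :=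
        Submodule.starProjection_inner_eq_zero (K := S) _ _ (hπS a _ (hxS m))
      have h3 : y n = Z^[n] η - (Z^[n] η - P (Z^[n] η)) - P' (Z^[n] η) := by simp [y]
      rw [h3, inner_sub_left, inner_sub_left, h1, h2]
      simp
    have hstep : ∀ n m a, ⟪Z^[n + 1] η, π a (k m)⟫_ℂ =
        ⟪y (n + 1), π a (x m)⟫_ℂ + ⟪Z^[n] η, π a (k (m + 1))⟫_ℂ := by
      intro n m a
      have h1 : k m = x m + Z (k (m + 1)) := by rw [hk_succ]; simp [x]
      rw [h1, map_add, inner_add_right, hwand, ← hZ, Function.iterate_succ_apply', Z.inner_map_map]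
    have hgenl : ∀ n m a, ⟪Z^[n] η, π a (k m)⟫_ℂ =
        ∑ p ∈ Finset.HasAntidiagonal.antidiagonal n, ⟪y p.2, π a (x (m + p.1))⟫_ℂ := by
      intro n
      induction n with
      | zero =>
        intro m a
        have h1 : k m = x m + Z (k (m + 1)) := by rw [hk_succ]; simp [x]
        rw [h1, map_add, inner_add_right, hwand, ← hZ]
        simp [hηS' _ (hπS a _ (hkS (m + 1)))]
      | succ n ih =>
        intro m a
        rw [hstep, ih, Finset.Nat.sum_antidiagonal_succ]
        simp [add_assoc, add_comm 1]
    intro n a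
    have := hgenl n 0 a
    simp only [zero_add] at this
    exact this

end Wandering

/-! ### Weak-star holomorphic functions on the disc -/

section PowerSeries

variable {X : Type*} [NormedAddCommGroup X] [NormedSpace ℂ X]

theorem norm_iteratedDeriv_le_of_bounded {f : ℂ → ℂ} {C : ℝ}
    (hf : DifferentiableOn ℂ f (ball 0 1)) (hC : ∀ w ∈ ball (0 : ℂ) 1, ‖f w‖ ≤ C) (n : ℕ) :
    ‖iteratedDeriv n f 0‖ ≤ n.factorial * C := by
  have h : ∀ᶠ R : ℝ in 𝓝[<] 1, ‖iteratedDeriv n f 0‖ ≤ n.factorial * C / R ^ n := by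
    filter_upwards [Ioo_mem_nhdsLT (zero_lt_one' ℝ)] with R hR
    refine norm_iteratedDeriv_le_of_forall_mem_sphere_norm_le n hR.1 ?_ fun z hz => hC z ?_
    · refine (hf.mono ?_).diffContOnCl
      exact (closure_ball_subset_closedBall).trans (closedBall_subset_ball hR.2)
    · exact closedBall_subset_ball hR.2 (sphere_subset_closedBall hz)
  have h2 : Tendsto (fun R : ℝ => n.factorial * C / R ^ n) (𝓝[<] 1) (𝓝 (n.factorial * C / 1 ^ n)) :=
    ((ContinuousAt.div continuousAt_const (by fun_prop) (by simp)).tendsto).mono_left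
      nhdsWithin_le_nhds
  simpa using ge_of_tendsto h2 h

/-- A bounded weak-star holomorphic function on the unit disc with values in a dual space has a
norm-convergent power series with bounded coefficients. -/
theorem exists_hasSum_of_weakStar_differentiableOn {F : ℂ → StrongDual ℂ X} {C : ℝ}
    (hF : ∀ a, DifferentiableOn ℂ (fun w => F w a) (ball 0 1))
    (hC : ∀ w ∈ ball (0 : ℂ) 1, ‖F w‖ ≤ C) :
    ∃ c : ℕ → StrongDual ℂ X, (∀ n, ‖c n‖ ≤ C) ∧
      ∀ w ∈ ball (0 : ℂ) 1, HasSum (fun n => w ^ n • c n) (F w) := by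
  have hC0 : 0 ≤ C := (norm_nonneg _).trans (hC 0 (by simp))
  have hcd : ∀ (n : ℕ) a, ContDiffAt ℂ n (fun w => F w a) 0 := fun n a =>
    ((hF a).analyticAt (isOpen_ball.mem_nhds (by simp))).contDiffAt
  let c : ℕ → StrongDual ℂ X := fun n => LinearMap.mkContinuous
    { toFun := fun a => (n.factorial : ℂ)⁻¹ * iteratedDeriv n (fun w => F w a) 0
      map_add' := fun a b => by
        simp only [map_add]
        rw [iteratedDeriv_fun_add (hcd n a) (hcd n b), mul_add]
      map_smul' := fun r a => by
        simp only [map_smul]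
        rw [iteratedDeriv_fun_const_smul (hcd n a)]
        simp only [smul_eq_mul, RingHom.id_apply]
        ring } C fun a => by
      have h := norm_iteratedDeriv_le_of_bounded (hF a) (C := C * ‖a‖)
        (fun w hw => ((F w).le_opNorm a).trans (by gcongr; exact hC w hw)) n
      have hn : (0 : ℝ) < n.factorial := by positivity
      simp only [LinearMap.coe_mk, AddHom.coe_mk, norm_mul, norm_inv, norm_natCast]
      rw [inv_mul_le_iff₀ hn]
      exact h
  have hcn : ∀ n, ‖c n‖ ≤ C := fun n => LinearMap.mkContinuous_norm_le _ hC0 _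
  refine ⟨c, hcn, fun w hw => ?_⟩
  have hw1 : ‖w‖ < 1 := by simpa using hw
  have hs : Summable fun n => w ^ n • c n := by
    refine Summable.of_norm_bounded ((summable_geometric_of_lt_one (norm_nonneg w) hw1).mul_right C)
      fun n => ?_
    rw [norm_smul, norm_pow]
    gcongr
    exact hcn n
  have : ∑' n, w ^ n • c n = F w := by
    ext a
    have h1 : HasSum (fun n => (w ^ n • c n) a) ((∑' n, w ^ n • c n) a) :=
      hs.hasSum.mapL (ContinuousLinearMap.apply ℂ ℂ a)
    have h2 := hasSum_taylorSeries_on_ball (hF a) hw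
    refine h1.unique (h2.congr_fun ?_)
    intro n
    simp [c]
    ring
  rw [← this]
  exact hs.hasSum

end PowerSeries

section Factorization

variable {K : Type*} [NormedAddCommGroup K] [InnerProductSpace ℂ K]

/-- Cauchy product of two power series of vectors, paired through an operator. -/
theorem hasSum_inner_power_series [CompleteSpace K] {x y : ℕ → K} (hx : Summable fun i => ‖x i‖ ^ 2)
    (hy : Summable fun i => ‖y i‖ ^ 2) (T : K →L[ℂ] K) {w : ℂ} (hw : ‖w‖ < 1) :
    HasSum (fun n => w ^ n * ∑ p ∈ Finset.HasAntidiagonal.antidiagonal n, ⟪y p.2, T (x p.1)⟫_ℂ)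
      ⟪∑' j, (starRingEnd ℂ w) ^ j • y j, T (∑' i, w ^ i • x i)⟫_ℂ := by
  have hs : ∀ {v : ℕ → K} {z : ℂ}, ‖z‖ < 1 → (Summable fun i => ‖v i‖ ^ 2) →
      Summable fun i => ‖z ^ i • v i‖ := by
    intro v z hz hv
    have h1 : Summable fun i => (‖z‖ ^ 2) ^ i := by
      refine summable_geometric_of_lt_one (by positivity) ?_
      exact pow_lt_one₀ (norm_nonneg _) hz two_ne_zero
    refine Summable.of_nonneg_of_le (fun _ => norm_nonneg _) (fun i => ?_) (h1.add hv)
    rw [norm_smul, norm_pow]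
    have : (‖z‖ ^ 2) ^ i = (‖z‖ ^ i) ^ 2 := by ring
    rw [this]
    nlinarith [sq_nonneg (‖z‖ ^ i - ‖v i‖), sq_nonneg (‖z‖ ^ i), sq_nonneg ‖v i‖]
  have hsx := hs hw hx
  have hsy := hs (z := starRingEnd ℂ w) (by simpa using hw) hy
  let g : ℕ × ℕ → ℂ := fun p => ⟪(starRingEnd ℂ w) ^ p.2 • y p.2, T (w ^ p.1 • x p.1)⟫_ℂ
  have hg : Summable g := by
    refine Summable.of_norm_bounded ((hsx.mul_of_nonneg hsy (fun _ => norm_nonneg _)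
      (fun _ => norm_nonneg _)).mul_left ‖T‖) fun p => ?_
    refine (norm_inner_le_norm _ _).trans ?_
    have := T.le_opNorm (w ^ p.1 • x p.1)
    calc _ ≤ ‖(starRingEnd ℂ w) ^ p.2 • y p.2‖ * (‖T‖ * ‖w ^ p.1 • x p.1‖) := by gcongr
      _ = _ := by ring
  have h1 : HasSum g ⟪∑' j, (starRingEnd ℂ w) ^ j • y j, T (∑' i, w ^ i • x i)⟫_ℂ := by
    have hi : ∀ i, HasSum (fun j => g (i, j))
        ⟪∑' j, (starRingEnd ℂ w) ^ j • y j, T (w ^ i • x i)⟫_ℂ := fun i => by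
      have := (hsy.of_norm.hasSum.mapL (innerSL ℂ (T (w ^ i • x i)))).star
      simp only [g, inner_smul_left, inner_smul_right, map_smul, map_pow, star_def, conj_conj,
        innerSL_apply_apply, smul_eq_mul, map_mul, inner_conj_symm] at this ⊢
      refine this.congr_fun fun j => ?_
      ring
    have h2 : HasSum (fun i => ⟪∑' j, (starRingEnd ℂ w) ^ j • y j, T (w ^ i • x i)⟫_ℂ)
        ⟪∑' j, (starRingEnd ℂ w) ^ j • y j, T (∑' i, w ^ i • x i)⟫_ℂ :=
      hsx.of_norm.hasSum.mapL ((innerSL ℂ (∑' j, (starRingEnd ℂ w) ^ j • y j)).comp T)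
    have h3 := hg.hasSum.prod_fiberwise hi
    rw [← h3.unique h2]
    exact hg.hasSum
  have h4 := (Finset.HasAntidiagonal.sigmaAntidiagonalEquivProd.hasSum_iff.2 h1).sigma
    (fun n => hasSum_fintype _)
  refine h4.congr_fun fun n => ?_
  rw [Finset.mul_sum, ← Finset.sum_coe_sort]
  refine Finset.sum_congr rfl fun p _ => ?_
  have hp : p.1.1 + p.1.2 = n := Finset.HasAntidiagonal.mem_antidiagonal.1 p.2
  have hwp : w ^ n = w ^ p.1.1 * w ^ p.1.2 := by rw [← pow_add, hp]
  change w ^ n * _ = ⟪(starRingEnd ℂ w) ^ p.1.2 • y p.1.2, T (w ^ p.1.1 • x p.1.1)⟫_ℂ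
  simp only [inner_smul_left, inner_smul_right, map_smul, map_pow, conj_conj]
  rw [hwp]
  ring

end Factorization

/-! ### Functionals on continuous functions on the circle -/

section Boundary

variable {A : Type*} [NormedAddCommGroup A] [NormedSpace ℂ A]

theorem circle_continuous_coe : Continuous fun z : Circle => (z : ℂ) := by fun_prop

/-- The trigonometric monomial `z ↦ z ^ m • a` on the unit circle. -/
noncomputable def trigMonomial (m : ℤ) (a : A) : C(Circle, A) :=
  ⟨fun z => ((z ^ m : Circle) : ℂ) • a,
    (circle_continuous_coe.comp (continuous_zpow m)).smul continuous_const⟩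

/-- Orthogonality of the characters of the circle. -/
theorem integral_circle_exp_zpow (m : ℤ) :
    ∫ θ in (0 : ℝ)..2 * Real.pi, (((Circle.exp θ) ^ m : Circle) : ℂ) =
      if m = 0 then 2 * Real.pi else 0 := by
  split_ifs with h
  · simp [h]
  · have h1 : ∀ θ : ℝ, (((Circle.exp θ) ^ m : Circle) : ℂ) = cexp (m * I * θ) := fun θ => by
      rw [Circle.coe_zpow, Circle.coe_exp, ← Complex.exp_int_mul]
      ring_nf
    simp_rw [h1]
    rw [integral_exp_mul_complex (by simp [h])]
    have : cexp (m * I * (2 * Real.pi : ℝ)) = 1 := by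
      rw [Complex.exp_eq_one_iff]
      exact ⟨m, by push_cast; ring⟩
    rw [this]
    simp

/-- Integrating a dual-valued power series over the circle of radius `r` gives a bounded functional
on `C(Circle, A)`. -/
theorem exists_circle_functional {c : ℕ → StrongDual ℂ A} {F : ℂ → StrongDual ℂ A} {C : ℝ}
    (hc : ∀ n, ‖c n‖ ≤ C) (hF : ∀ w ∈ ball (0 : ℂ) 1, HasSum (fun n => w ^ n • c n) (F w))
    (hC : ∀ w ∈ ball (0 : ℂ) 1, ‖F w‖ ≤ C) {r : ℝ} (hr0 : 0 ≤ r) (hr1 : r < 1) :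
    ∃ Λ : StrongDual ℂ C(Circle, A), ‖Λ‖ ≤ C ∧
      (∀ (n : ℕ) a, Λ (trigMonomial (-n) a) = r ^ n * c n a) ∧
      ∀ (n : ℕ) a, Λ (trigMonomial (n + 1) a) = 0 := by
  have hC0 : 0 ≤ C := (norm_nonneg _).trans (hc 0)
  have hmem : ∀ z : Circle, (r * z : ℂ) ∈ ball (0 : ℂ) 1 := fun z => by
    rw [mem_ball_zero_iff, norm_mul, Circle.norm_coe, norm_real, Real.norm_eq_abs,
      abs_of_nonneg hr0, mul_one]
    exact hr1
  have hbd : ∀ (n : ℕ) (z : Circle), ‖(r * z : ℂ) ^ n • c n‖ ≤ r ^ n * C := fun n z => by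
    rw [norm_smul]
    simp only [norm_pow, norm_mul, norm_real, Real.norm_eq_abs, abs_of_nonneg hr0, Circle.norm_coe,
      mul_one]
    gcongr
    exact hc n
  have hgeo : Summable fun n : ℕ => r ^ n * C := (summable_geometric_of_lt_one hr0 hr1).mul_right C
  have hcont : Continuous fun z : Circle => F (r * z) := by
    have : (fun z : Circle => F (r * z)) = fun z : Circle => ∑' n, (r * z : ℂ) ^ n • c n :=
      funext fun z => (hF _ (hmem z)).tsum_eq.symm
    rw [this]
    refine continuous_tsum (fun n => ?_) hgeo hbd
    exact (by fun_prop : Continuous fun z : Circle => (r * z : ℂ) ^ n).smul continuous_const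
  have hci : ∀ g : C(Circle, A), Continuous fun θ : ℝ => F (r * Circle.exp θ) (g (Circle.exp θ)) :=
    fun g => (hcont.comp Circle.exp.continuous).clm_apply (g.continuous.comp Circle.exp.continuous)
  let Λ : StrongDual ℂ C(Circle, A) := LinearMap.mkContinuous
    { toFun := fun g => (2 * Real.pi : ℂ)⁻¹ *
        ∫ θ in (0 : ℝ)..2 * Real.pi, F (r * Circle.exp θ) (g (Circle.exp θ))
      map_add' := fun g h => by
        simp only [ContinuousMap.add_apply, map_add]
        rw [intervalIntegral.integral_add ((hci g).intervalIntegrable _ _)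
          ((hci h).intervalIntegrable _ _), mul_add]
      map_smul' := fun s g => by
        simp only [ContinuousMap.smul_apply, map_smul, smul_eq_mul]
        rw [intervalIntegral.integral_const_mul, RingHom.id_apply]
        ring } C fun g => by
      have h1 : ‖∫ θ in (0 : ℝ)..2 * Real.pi, F (r * Circle.exp θ) (g (Circle.exp θ))‖ ≤
          (C * ‖g‖) * |2 * Real.pi - 0| := by
        refine intervalIntegral.norm_integral_le_of_norm_le_const fun θ _ => ?_
        refine ((F _).le_opNorm _).trans ?_
        gcongr
        · exact hC _ (hmem _)
        · exact g.norm_coe_le_norm _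
      rw [sub_zero, abs_of_pos Real.two_pi_pos] at h1
      have h2 : ‖(2 * Real.pi : ℂ)⁻¹‖ = (2 * Real.pi)⁻¹ := by
        rw [norm_inv]
        simp [abs_of_pos Real.pi_pos]
      change ‖(2 * Real.pi : ℂ)⁻¹ * _‖ ≤ _
      rw [norm_mul, h2, inv_mul_le_iff₀ Real.two_pi_pos]
      linarith
  -- integrate the power series term by term against a monomial
  have key : ∀ (m : ℤ) a, HasSum
      (fun n : ℕ => (r ^ n * c n a) * (if (n + m : ℤ) = 0 then (2 * Real.pi : ℂ) else 0))
      (∫ θ in (0 : ℝ)..2 * Real.pi, F (r * Circle.exp θ) (trigMonomial m a (Circle.exp θ))) := by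
    intro m a
    have h := intervalIntegral.hasSum_integral_of_dominated_convergence
      (μ := MeasureTheory.volume) (a := 0) (b := 2 * Real.pi)
      (F := fun (n : ℕ) (θ : ℝ) =>
        (r ^ n * c n a) * (((Circle.exp θ) ^ (n + m : ℤ) : Circle) : ℂ))
      (f := fun θ : ℝ => F (r * Circle.exp θ) (trigMonomial m a (Circle.exp θ)))
      (fun n _ => r ^ n * C * ‖a‖) (fun n => (continuous_const.mul (circle_continuous_coe.comp
        ((continuous_zpow _).comp Circle.exp.continuous))).aestronglyMeasurable)
      (fun n => .of_forall fun θ _ => by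
        rw [norm_mul, Circle.norm_coe, mul_one, norm_mul, norm_pow, norm_real, Real.norm_eq_abs,
          abs_of_nonneg hr0, mul_assoc]
        gcongr
        exact ((c n).le_opNorm a).trans (by gcongr; exact hc n))
      (.of_forall fun θ _ => hgeo.mul_right _) (by simp)
      (.of_forall fun θ _ => by
        have h1 := (hF _ (hmem (Circle.exp θ))).mapL
          (ContinuousLinearMap.apply ℂ ℂ (trigMonomial m a (Circle.exp θ)))
        refine h1.congr_fun fun n => ?_
        simp [trigMonomial, zpow_add, mul_pow]
        ring)
    refine h.congr_fun fun n => ?_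
    rw [intervalIntegral.integral_const_mul, integral_circle_exp_zpow]
    split_ifs <;> simp
  have hΛ : ∀ g, Λ g = (2 * Real.pi : ℂ)⁻¹ *
      ∫ θ in (0 : ℝ)..2 * Real.pi, F (r * Circle.exp θ) (g (Circle.exp θ)) := fun g => rfl
  refine ⟨Λ, LinearMap.mkContinuous_norm_le _ hC0 _, fun n a => ?_, fun n a => ?_⟩
  · rw [hΛ]
    have h := (key (-n) a).unique (hasSum_single n fun k hk => ?_)
    · rw [h]
      have : (Real.pi : ℂ) ≠ 0 := by exact_mod_cast Real.pi_ne_zero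
      simp
      field_simp
    · rw [if_neg (by omega), mul_zero]
  · rw [hΛ]
    have h := (key (n + 1) a).unique (hasSum_zero.congr_fun fun k => ?_)
    · rw [h, mul_zero]
    · rw [if_neg (by omega), mul_zero]

/-- The boundary functional of a bounded analytic function on the disc with values in a dual
space: a bounded functional on `C(Circle, A)` whose Fourier coefficients are the power series
coefficients. It is a weak-star limit point of the integrals over smaller circles. -/
theorem exists_boundary_functional {c : ℕ → StrongDual ℂ A} {F : ℂ → StrongDual ℂ A} {C : ℝ}
    (hc : ∀ n, ‖c n‖ ≤ C) (hF : ∀ w ∈ ball (0 : ℂ) 1, HasSum (fun n => w ^ n • c n) (F w))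
    (hC : ∀ w ∈ ball (0 : ℂ) 1, ‖F w‖ ≤ C) :
    ∃ Λ : StrongDual ℂ C(Circle, A),
      (∀ (n : ℕ) a, Λ (trigMonomial (-n) a) = c n a) ∧
      ∀ (n : ℕ) a, Λ (trigMonomial (n + 1) a) = 0 := by
  let r : ℕ → ℝ := fun j => 1 - 1 / ((j : ℝ) + 1)
  have hr0 : ∀ j, 0 ≤ r j := fun j => by
    simp only [r, sub_nonneg]
    rw [div_le_one (by positivity)]
    linarith [(Nat.cast_nonneg j : (0 : ℝ) ≤ j)]
  have hr1 : ∀ j, r j < 1 := fun j => by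
    simp only [r, sub_lt_self_iff]
    positivity
  have hr : Tendsto r atTop (𝓝 1) := by
    simpa [r] using tendsto_one_div_add_atTop_nhds_zero_nat.const_sub (1 : ℝ)
  choose Λ hΛC hΛ1 hΛ2 using fun j => exists_circle_functional hc hF hC (hr0 j) (hr1 j)
  let Λ' : ℕ → WeakDual ℂ C(Circle, A) := fun j => StrongDual.toWeakDual (Λ j)
  obtain ⟨Λ₀, -, hΛ₀⟩ := (WeakDual.isCompact_closedBall (𝕜 := ℂ) (0 : StrongDual ℂ C(Circle, A))
    C).ultrafilter_le_nhds ((hyperfilter ℕ).map Λ') (by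
      simp only [Ultrafilter.coe_map, le_principal_iff, mem_map]
      exact univ_mem' fun j => by simpa [Λ'] using hΛC j)
  have hev : ∀ g, Tendsto (fun j => Λ j g) (hyperfilter ℕ : Filter ℕ) (𝓝 (Λ₀ g)) := fun g =>
    ((WeakDual.eval_continuous g).tendsto Λ₀).comp hΛ₀
  have hr' : Tendsto r (hyperfilter ℕ : Filter ℕ) (𝓝 1) := hr.mono_left Nat.hyperfilter_le_atTop
  refine ⟨WeakDual.toStrongDual Λ₀, fun n a => ?_, fun n a => ?_⟩
  · refine tendsto_nhds_unique (hev (trigMonomial (-n) a)) ?_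
    simp_rw [hΛ1]
    have : Tendsto (fun j => ((r j : ℂ)) ^ n * c n a) (hyperfilter ℕ : Filter ℕ)
        (𝓝 (((1 : ℝ) : ℂ) ^ n * c n a)) :=
      (((continuous_ofReal.tendsto _).comp hr').pow n).mul_const _
    simpa using this
  · refine tendsto_nhds_unique (hev (trigMonomial (n + 1) a)) ?_
    simp_rw [hΛ2]
    exact tendsto_const_nhds

end Boundary

/-! ### Factorization of bounded holomorphic functions -/

section CStarFactorization

universe v

/-- The embedding of a C⋆-algebra into `C(Circle, A)` as the constant functions. -/
noncomputable def circleConst (A : Type v) [CStarAlgebra A] : A →⋆ₐ[ℂ] C(Circle, A) where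
  toFun a := ContinuousMap.const _ a
  map_one' := rfl
  map_mul' _ _ := rfl
  map_zero' := rfl
  map_add' _ _ := rfl
  commutes' _ := rfl
  map_star' _ := rfl

/-- The coefficients of a bounded power series with values in the dual of a unital C⋆-algebra
are Cauchy products of square-summable sequences of vectors, paired through a representation. -/
theorem exists_coeff_factorization_unital {A : Type v} [CStarAlgebra A]
    {c : ℕ → StrongDual ℂ A} {F : ℂ → StrongDual ℂ A} {C : ℝ}
    (hc : ∀ n, ‖c n‖ ≤ C) (hF : ∀ w ∈ ball (0 : ℂ) 1, HasSum (fun n => w ^ n • c n) (F w))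
    (hC : ∀ w ∈ ball (0 : ℂ) 1, ‖F w‖ ≤ C) :
    ∃ (K : Type v) (_ : NormedAddCommGroup K) (_ : InnerProductSpace ℂ K) (_ : CompleteSpace K)
      (π : A →⋆ₐ[ℂ] (K →L[ℂ] K)) (x y : ℕ → K),
      (Summable fun i => ‖x i‖ ^ 2) ∧ (Summable fun i => ‖y i‖ ^ 2) ∧
      ∀ n a, c n a = ∑ p ∈ Finset.HasAntidiagonal.antidiagonal n, ⟪y p.2, π a (x p.1)⟫_ℂ := by
  obtain ⟨Λ, hΛ1, hΛ2⟩ := exists_boundary_functional hc hF hC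
  obtain ⟨K, _, _, _, ρ, ξ, η, hρ⟩ := exists_representation Λ
  have hmul : ∀ (m n : ℤ) (a b : A),
      trigMonomial m a * trigMonomial n b = trigMonomial (m + n) (a * b) := fun m n a b => by
    ext z
    simp [trigMonomial, zpow_add, mul_smul_mul_comm]
  have hstar : ∀ (m : ℤ) (a : A), star (trigMonomial m a) = trigMonomial (-m) (star a) :=
    fun m a => by
      ext z
      simp [trigMonomial, ← Circle.coe_inv_eq_conj]
  have hone : trigMonomial 0 (1 : A) = 1 := by
    ext z
    simp [trigMonomial]
  have hconst : ∀ a, circleConst A a = trigMonomial 0 a := fun a => by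
    ext z
    change a = _
    simp [trigMonomial]
  -- The coordinate function of the circle acts as a unitary that commutes with the constants.
  let u : unitary (K →L[ℂ] K) := ⟨ρ (trigMonomial 1 1), by
    rw [Unitary.mem_iff, ← map_star, ← map_mul, ← map_mul, hstar, hmul, hmul]
    simp [hone]⟩
  let Z : K ≃ₗᵢ[ℂ] K := Unitary.linearIsometryEquiv u
  have hZ : ∀ v, Z v = ρ (trigMonomial 1 1) v := fun v => rfl
  let π : A →⋆ₐ[ℂ] (K →L[ℂ] K) := ρ.comp (circleConst A)
  have hπ : ∀ a, π a = ρ (trigMonomial 0 a) := fun a => by simp [π, hconst]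
  have hZρ : ∀ m a v, Z (ρ (trigMonomial m a) v) = ρ (trigMonomial (m + 1) a) v := fun m a v => by
    rw [hZ, ← mul_apply_eq_comp, ← map_mul, hmul, one_mul, add_comm]
  have hZk : ∀ (k : ℕ) m a v, Z^[k] (ρ (trigMonomial m a) v) = ρ (trigMonomial (m + k) a) v := by
    intro k m a v
    induction k with
    | zero => simp
    | succ k ih =>
      rw [Function.iterate_succ_apply', ih, hZρ]
      push_cast
      rw [add_assoc]
  have hinner : ∀ (k : ℕ) u v, ⟪Z^[k] u, Z^[k] v⟫_ℂ = ⟪u, v⟫_ℂ := by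
    intro k u v
    induction k with
    | zero => rfl
    | succ k ih => rw [Function.iterate_succ_apply', Function.iterate_succ_apply',
        Z.inner_map_map, ih]
  obtain ⟨x, y, hx, hy, hxy⟩ := exists_wandering_decomposition Z π ξ η (fun a v => by
      rw [hπ, hZρ, hZ, ← mul_apply_eq_comp, ← map_mul, hmul, mul_one]) (fun a k => by
      rw [hπ, hZk, ← hρ]
      have := hΛ2 k a
      rwa [zero_add, Nat.cast_succ])
  refine ⟨K, inferInstance, inferInstance, inferInstance, π, x, y, hx, hy, fun n a => ?_⟩
  rw [← hxy, ← hΛ1, hρ, ← hinner n, hZk, hπ]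
  simp

/-- Factorization of a bounded analytic function with values in the dual of a C⋆-algebra through
two Hardy-class functions with values in a Hilbert space. -/
theorem exists_factorization {A : Type v} [NonUnitalCStarAlgebra A] {F : ℂ → StrongDual ℂ A} {C : ℝ}
    (hF : ∀ a, DifferentiableOn ℂ (fun w => F w a) (ball 0 1))
    (hC : ∀ w ∈ ball (0 : ℂ) 1, ‖F w‖ ≤ C) :
    ∃ (K : Type v) (_ : NormedAddCommGroup K) (_ : InnerProductSpace ℂ K) (_ : CompleteSpace K)
      (T : A →L[ℂ] (K →L[ℂ] K)) (x y : ℕ → K),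
      (Summable fun i => ‖x i‖ ^ 2) ∧ (Summable fun i => ‖y i‖ ^ 2) ∧
      ∀ w ∈ ball (0 : ℂ) 1, ∀ a,
        F w a = ⟪∑' j, (starRingEnd ℂ w) ^ j • y j, T a (∑' i, w ^ i • x i)⟫_ℂ := by
  have hC0 : 0 ≤ C := (norm_nonneg _).trans (hC 0 (by simp))
  obtain ⟨c, hc, hsum⟩ := exists_hasSum_of_weakStar_differentiableOn hF hC
  -- `s` drops the scalar part, so `F w ∘ s` extends `F w` by `0` on the unit.
  let s : Unitization ℂ A →L[ℂ] A := LinearMap.mkContinuous (Unitization.sndHom ℂ ℂ A) 2 fun x => by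
    have h1 : ‖x.fst‖ ≤ ‖x‖ ∧ ‖algebraMap ℂ (A →L[ℂ] A) x.fst + ContinuousLinearMap.mul ℂ A x.snd‖
        ≤ ‖x‖ := by
      rw [Unitization.norm_def, Prod.norm_def, Unitization.splitMul_apply]
      exact ⟨le_max_left _ _, le_max_right _ _⟩
    have h2 : ‖x.snd‖ = ‖ContinuousLinearMap.mul ℂ A x.snd‖ :=
      (ContinuousLinearMap.opNorm_mul_apply ℂ A x.snd).symm
    have h3 : ContinuousLinearMap.mul ℂ A x.snd =
        (algebraMap ℂ (A →L[ℂ] A) x.fst + ContinuousLinearMap.mul ℂ A x.snd) -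
          algebraMap ℂ (A →L[ℂ] A) x.fst := by abel
    have h4 : ‖algebraMap ℂ (A →L[ℂ] A) x.fst‖ ≤ ‖x.fst‖ := by
      rw [Algebra.algebraMap_eq_smul_one, norm_smul]
      exact mul_le_of_le_one_right (norm_nonneg _) ContinuousLinearMap.norm_id_le
    change ‖x.snd‖ ≤ _
    rw [h2, h3]
    refine (norm_sub_le _ _).trans ?_
    linarith [h1.1, h1.2]
  have hle : ∀ φ : StrongDual ℂ A, ‖φ.comp s‖ ≤ ‖φ‖ * 2 := fun φ =>
    (φ.opNorm_comp_le s).trans (by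
      gcongr
      exact LinearMap.mkContinuous_norm_le _ (by norm_num) _)
  let R : StrongDual ℂ A →L[ℂ] StrongDual ℂ (Unitization ℂ A) := ContinuousLinearMap.precomp ℂ s
  obtain ⟨K, _, _, _, π, x, y, hx, hy, hπ⟩ := exists_coeff_factorization_unital
    (c := fun n => (c n).comp s) (F := fun w => (F w).comp s) (C := C * 2)
    (fun n => (hle _).trans (by gcongr; exact hc n))
    (fun w hw => by
      refine ((hsum w hw).mapL R).congr_fun fun n => ?_
      rw [map_smul]
      rfl)
    (fun w hw => (hle _).trans (by gcongr; exact hC w hw))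
  let T : A →L[ℂ] (K →L[ℂ] K) := LinearMap.mkContinuous
    (π.toAlgHom.toLinearMap.comp (Unitization.inrHom ℂ ℂ A)) 1 fun a => by
      rw [one_mul]
      refine (NonUnitalStarAlgHom.norm_apply_le π _).trans ?_
      exact (Unitization.norm_inr a).le
  refine ⟨K, inferInstance, inferInstance, inferInstance, T, x, y, hx, hy, fun w hw a => ?_⟩
  have h1 := (hsum w hw).mapL (ContinuousLinearMap.apply ℂ ℂ a)
  refine h1.unique ((hasSum_inner_power_series hx hy (T a) (by simpa using hw)).congr_fun fun n => ?_)
  have h2 : c n a = ∑ p ∈ Finset.HasAntidiagonal.antidiagonal n, ⟪y p.2, T a (x p.1)⟫_ℂ := by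
    have := hπ n (a : Unitization ℂ A)
    exact this
  simp [h2]

end CStarFactorization

/-! ### Radial limits -/

section RadialLimits

variable {K : Type*} [NormedAddCommGroup K] [InnerProductSpace ℂ K]

theorem continuous_circle_exp_zpow (m : ℤ) :
    Continuous fun θ : ℝ => ((Circle.exp θ ^ m : Circle) : ℂ) :=
  circle_continuous_coe.comp ((continuous_zpow m).comp Circle.exp.continuous)

/-- Parseval's identity for vector-valued trigonometric polynomials. The frequency factor `σ` is
`1` or `-1` in the applications: analytic and antianalytic series. -/
theorem integral_norm_sq_trig_sum {σ : ℤ} (hσ : σ ≠ 0) (z : ℕ → K) (N : ℕ) :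
    ∫ θ in (0 : ℝ)..2 * Real.pi,
      ‖∑ i ∈ Finset.range N, ((Circle.exp θ ^ (σ * i) : Circle) : ℂ) • z i‖ ^ 2 =
      2 * Real.pi * ∑ i ∈ Finset.range N, ‖z i‖ ^ 2 := by
  apply Complex.ofReal_injective
  rw [← intervalIntegral.integral_ofReal]
  have h1 : ∀ θ : ℝ, ((‖∑ i ∈ Finset.range N,
      ((Circle.exp θ ^ (σ * i) : Circle) : ℂ) • z i‖ ^ 2 : ℝ) : ℂ) =
      ∑ i ∈ Finset.range N, ∑ j ∈ Finset.range N,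
        ((Circle.exp θ ^ (σ * (j - i)) : Circle) : ℂ) * ⟪z i, z j⟫_ℂ := by
    intro θ
    rw [ofReal_pow]
    rw [← RCLike.ofReal_eq_complex_ofReal, ← inner_self_eq_norm_sq_to_K (𝕜 := ℂ), sum_inner]
    refine Finset.sum_congr rfl fun i _ => ?_
    rw [inner_sum]
    refine Finset.sum_congr rfl fun j _ => ?_
    rw [inner_smul_left, inner_smul_right, ← mul_assoc, ← Circle.coe_inv_eq_conj, ← Circle.coe_mul,
      ← zpow_neg, ← zpow_add]
    congr 4
    ring
  simp_rw [h1]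
  have hc : ∀ i j : ℕ, Continuous fun θ : ℝ =>
      ((Circle.exp θ ^ (σ * (j - i)) : Circle) : ℂ) * ⟪z i, z j⟫_ℂ := fun i j =>
    (continuous_circle_exp_zpow _).mul continuous_const
  rw [intervalIntegral.integral_finsetSum fun i _ =>
    (continuous_finsetSum _ fun j _ => hc i j).intervalIntegrable _ _]
  simp only [ofReal_mul, ofReal_sum, ofReal_pow, ofReal_ofNat]
  rw [Finset.mul_sum]
  refine Finset.sum_congr rfl fun i hi => ?_
  rw [intervalIntegral.integral_finsetSum fun j _ => (hc i j).intervalIntegrable _ _]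
  simp_rw [intervalIntegral.integral_mul_const, integral_circle_exp_zpow]
  rw [Finset.sum_eq_single_of_mem i hi fun j _ hj => ?_]
  · simp
  · have : (j : ℤ) - i ≠ 0 := by
      rw [sub_ne_zero]; exact_mod_cast hj
    simp [hσ, this]

theorem integral_norm_sq_trig_tsum [CompleteSpace K] {σ : ℤ} (hσ : σ ≠ 0) {z : ℕ → K}
    (hz : Summable fun i => ‖z i‖) (hz2 : Summable fun i => ‖z i‖ ^ 2) :
    ∫ θ in (0 : ℝ)..2 * Real.pi,
      ‖∑' i : ℕ, ((Circle.exp θ ^ (σ * i) : Circle) : ℂ) • z i‖ ^ 2 =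
      2 * Real.pi * ∑' i, ‖z i‖ ^ 2 := by
  have hn : ∀ (θ : ℝ) (i : ℕ), ‖((Circle.exp θ ^ (σ * i) : Circle) : ℂ) • z i‖ = ‖z i‖ :=
    fun θ i => by rw [norm_smul, Circle.norm_coe, one_mul]
  have h1 : Tendsto (fun N => ∫ θ in (0 : ℝ)..2 * Real.pi,
      ‖∑ i ∈ Finset.range N, ((Circle.exp θ ^ (σ * i) : Circle) : ℂ) • z i‖ ^ 2) atTop
      (𝓝 (∫ θ in (0 : ℝ)..2 * Real.pi,
        ‖∑' i : ℕ, ((Circle.exp θ ^ (σ * i) : Circle) : ℂ) • z i‖ ^ 2)) := by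
    refine intervalIntegral.tendsto_integral_filter_of_dominated_convergence
      (fun _ => (∑' i, ‖z i‖) ^ 2) (.of_forall fun N => ?_) (.of_forall fun N => ?_) (by simp)
      (.of_forall fun θ _ => ?_)
    · exact ((continuous_finsetSum _ fun i _ =>
        (continuous_circle_exp_zpow _).smul continuous_const).norm.pow 2).aestronglyMeasurable
    · refine .of_forall fun θ _ => ?_
      rw [norm_pow, norm_norm]
      gcongr
      refine (norm_sum_le _ _).trans ?_
      simp_rw [hn]
      exact hz.sum_le_tsum _ fun _ _ => norm_nonneg _
    · have : Summable fun i : ℕ => ((Circle.exp θ ^ (σ * i) : Circle) : ℂ) • z i :=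
        Summable.of_norm (by simpa only [hn] using hz)
      exact this.hasSum.tendsto_sum_nat.norm.pow 2
  simp_rw [integral_norm_sq_trig_sum hσ] at h1
  exact tendsto_nhds_unique h1 (hz2.hasSum.tendsto_sum_nat.const_mul _)

/-- The squared distance of the dilation of `∑ wⁱ xᵢ` by `r` from its boundary values. -/
theorem tendsto_dilation_defect {K : Type*} [NormedAddCommGroup K] {x : ℕ → K}
    (hx : Summable fun i => ‖x i‖ ^ 2) :
    Tendsto (fun r : ℝ => ∑' i, (1 - r ^ i) ^ 2 * ‖x i‖ ^ 2) (𝓝[<] 1) (𝓝 0) := by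
  have h := tendsto_tsum_of_dominated_convergence (𝓕 := 𝓝[<] (1 : ℝ))
    (f := fun r i => (1 - r ^ i) ^ 2 * ‖x i‖ ^ 2) (g := fun _ => 0) hx (fun i => by
      have : Continuous fun r : ℝ => (1 - r ^ i) ^ 2 * ‖x i‖ ^ 2 := by fun_prop
      have h2 := (this.tendsto 1).mono_left (nhdsWithin_le_nhds (s := Set.Iio 1))
      simpa using h2) (by
      filter_upwards [Ioo_mem_nhdsLT (zero_lt_one' ℝ)] with r hr i
      have h1 : r ^ i ≤ 1 := pow_le_one₀ hr.1.le hr.2.le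
      have h2 : 0 ≤ r ^ i := pow_nonneg hr.1.le i
      rw [Real.norm_eq_abs, abs_of_nonneg (by positivity)]
      have : (1 - r ^ i) ^ 2 ≤ 1 := by nlinarith
      nlinarith [sq_nonneg ‖x i‖])
  simpa using h

/-- A square-summable power series has norm limits almost everywhere on the circle, along any
sequence of radii for which the dilations converge fast enough in the Hardy space. -/
theorem ae_tendsto_power_series [CompleteSpace K] {σ : ℤ} (hσ : σ ≠ 0) {x : ℕ → K}
    (hx : Summable fun i => ‖x i‖ ^ 2) {r : ℕ → ℝ} (hr : ∀ k, r k ∈ Set.Ioo (0 : ℝ) 1)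
    (hdef : ∀ k, ∑' i, (1 - r k ^ i) ^ 2 * ‖x i‖ ^ 2 ≤ (1 / 4) ^ k) :
    ∀ᵐ θ ∂(MeasureTheory.volume.restrict (Set.Ioc 0 (2 * Real.pi))), ∃ l,
      Tendsto (fun k => ∑' i, ((r k : ℂ) * (Circle.exp θ ^ σ : Circle)) ^ i • x i) atTop (𝓝 l) := by
  let μ : MeasureTheory.Measure ℝ := MeasureTheory.volume.restrict (Set.Ioc 0 (2 * Real.pi))
  have hgeo : ∀ k, Summable fun i => r k ^ i * ‖x i‖ := fun k => by
    refine Summable.of_nonneg_of_le (fun i => mul_nonneg (pow_nonneg (hr k).1.le i)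
      (norm_nonneg _)) (fun i => ?_) ((summable_geometric_of_lt_one (by positivity)
        (pow_lt_one₀ (hr k).1.le (hr k).2 two_ne_zero)).add hx)
    have : (r k ^ 2) ^ i = (r k ^ i) ^ 2 := by ring
    rw [this]
    nlinarith [sq_nonneg (r k ^ i - ‖x i‖), sq_nonneg (r k ^ i), sq_nonneg ‖x i‖]
  have hnr : ∀ k i, ‖(r k : ℂ) ^ i • x i‖ = r k ^ i * ‖x i‖ := fun k i => by
    rw [norm_smul, norm_pow, norm_real, Real.norm_eq_abs, abs_of_pos (hr k).1]
  let f : ℕ → ℝ → K := fun k θ =>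
    ∑' i : ℕ, ((Circle.exp θ ^ (σ * i) : Circle) : ℂ) • ((r k : ℂ) ^ i • x i)
  have hf : ∀ k θ, ∑' i, ((r k : ℂ) * (Circle.exp θ ^ σ : Circle)) ^ i • x i = f k θ := by
    intro k θ
    refine tsum_congr fun i => ?_
    rw [mul_pow, mul_comm, mul_smul, zpow_mul, zpow_natCast, Circle.coe_pow]
  simp_rw [hf]
  have hnt : ∀ k (θ : ℝ) (i : ℕ),
      ‖((Circle.exp θ ^ (σ * i) : Circle) : ℂ) • ((r k : ℂ) ^ i • x i)‖ ≤ r k ^ i * ‖x i‖ :=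
    fun k θ i => by rw [norm_smul, Circle.norm_coe, one_mul, hnr]
  have hfc : ∀ k, Continuous (f k) := fun k =>
    continuous_tsum (fun i => (continuous_circle_exp_zpow _).smul continuous_const) (hgeo k)
      (fun i θ => hnt k θ i)
  have hdiff : ∀ n m θ, (f n - f m) θ = ∑' i : ℕ, ((Circle.exp θ ^ (σ * i) : Circle) : ℂ) •
      (((r n : ℂ) ^ i - (r m : ℂ) ^ i) • x i) := by
    intro n m θ
    have h1 : ∀ k, Summable fun i : ℕ =>
        ((Circle.exp θ ^ (σ * i) : Circle) : ℂ) • ((r k : ℂ) ^ i • x i) := fun k =>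
      Summable.of_norm_bounded (hgeo k) (hnt k θ)
    rw [Pi.sub_apply]
    simp only [f]
    rw [← (h1 n).tsum_sub (h1 m)]
    refine tsum_congr fun i => ?_
    rw [sub_smul, smul_sub]
  have hdn : ∀ n m i, ‖((r n : ℂ) ^ i - (r m : ℂ) ^ i) • x i‖ ^ 2 ≤
      2 * ((1 - r n ^ i) ^ 2 * ‖x i‖ ^ 2) + 2 * ((1 - r m ^ i) ^ 2 * ‖x i‖ ^ 2) := by
    intro n m i
    have : ((r n : ℂ) ^ i - (r m : ℂ) ^ i) = ((r n ^ i - r m ^ i : ℝ) : ℂ) := by push_cast; ring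
    rw [norm_smul, this, norm_real, mul_pow, Real.norm_eq_abs, sq_abs]
    nlinarith [mul_nonneg (sq_nonneg ((1 - r n ^ i) + (1 - r m ^ i))) (sq_nonneg ‖x i‖)]
  have hsd : ∀ k, Summable fun i => (1 - r k ^ i) ^ 2 * ‖x i‖ ^ 2 := fun k => by
    refine Summable.of_nonneg_of_le (fun i => by positivity) (fun i => ?_) hx
    have h1 : r k ^ i ≤ 1 := pow_le_one₀ (hr k).1.le (hr k).2.le
    have h2 : 0 ≤ r k ^ i := pow_nonneg (hr k).1.le i
    have : (1 - r k ^ i) ^ 2 ≤ 1 := by nlinarith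
    nlinarith [sq_nonneg ‖x i‖]
  -- the dilations form a Cauchy sequence in `L²` of the circle, with a geometric rate
  have hint : ∀ N n m, N ≤ n → N ≤ m →
      ∫ θ, ‖(f n - f m) θ‖ ^ 2 ∂μ ≤ 2 * Real.pi * (4 * (1 / 4) ^ N) := by
    intro N n m hn hm
    have h0 : ∫ θ, ‖(f n - f m) θ‖ ^ 2 ∂μ = ∫ θ in (0 : ℝ)..2 * Real.pi, ‖(f n - f m) θ‖ ^ 2 :=
      (intervalIntegral.integral_of_le Real.two_pi_pos.le).symm
    rw [h0]
    simp_rw [hdiff]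
    have hs2 := ((hsd n).mul_left 2).add ((hsd m).mul_left 2)
    have hs3 := Summable.of_nonneg_of_le (fun i => by positivity) (hdn n m) hs2
    rw [integral_norm_sq_trig_tsum hσ ?_ hs3]
    · gcongr
      refine (hs3.tsum_le_tsum (hdn n m) hs2).trans ?_
      rw [((hsd n).mul_left 2).tsum_add ((hsd m).mul_left 2), tsum_mul_left, tsum_mul_left]
      have h4 : ∀ k, N ≤ k → ∑' i, (1 - r k ^ i) ^ 2 * ‖x i‖ ^ 2 ≤ (1 / 4) ^ N := fun k hk =>
        (hdef k).trans (pow_le_pow_of_le_one (by norm_num) (by norm_num) hk)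
      linarith [h4 n hn, h4 m hm]
    · refine Summable.of_nonneg_of_le (fun i => norm_nonneg _) (fun i => ?_)
        ((hgeo n).add (hgeo m))
      rw [sub_smul, ← hnr, ← hnr]
      exact norm_sub_le _ _
  refine MeasureTheory.Lp.ae_tendsto_of_cauchy_eLpNorm (p := 2) (μ := μ)
    (B := fun N => ENNReal.ofReal (10 * (1 / 2) ^ N))
    (fun k => (hfc k).aestronglyMeasurable) (by norm_num) ?_ fun N n m hn hm => ?_
  · exact (summable_geometric_two.mul_left 10).tsum_ofReal_ne_top
  · have hmem : MeasureTheory.MemLp (f n - f m) 2 μ := by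
      refine MeasureTheory.MemLp.of_bound ((hfc n).sub (hfc m)).aestronglyMeasurable
        ((∑' i, r n ^ i * ‖x i‖) + ∑' i, r m ^ i * ‖x i‖) (.of_forall fun θ => ?_)
      have h5 : ∀ k, ‖f k θ‖ ≤ ∑' i, r k ^ i * ‖x i‖ := fun k =>
        tsum_of_norm_bounded (hgeo k).hasSum (hnt k θ)
      exact (norm_sub_le _ _).trans (add_le_add (h5 n) (h5 m))
    rw [hmem.eLpNorm_eq_integral_rpow_norm (by norm_num) (by norm_num)]
    refine (ENNReal.ofReal_lt_ofReal_iff (by positivity)).2 ?_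
    simp only [ENNReal.toReal_ofNat, Real.rpow_ofNat]
    rw [← one_div, ← Real.sqrt_eq_rpow, Real.sqrt_lt' (by positivity)]
    refine (hint N n m hn hm).trans_lt ?_
    have h6 : ((1 / 2 : ℝ) ^ N) ^ 2 = (1 / 4) ^ N := by rw [← pow_mul, mul_comm, pow_mul]; norm_num
    rw [mul_pow, h6]
    have h7 : (0 : ℝ) < (1 / 4) ^ N := by positivity
    nlinarith [Real.pi_lt_four]

/-- The matrix coefficient `a ↦ ⟪v, T a u⟫` of an operator-valued map `T`. -/
noncomputable def matrixCoeff {A : Type*} [NormedAddCommGroup A] [NormedSpace ℂ A]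
    (T : A →L[ℂ] (K →L[ℂ] K)) (v u : K) : StrongDual ℂ A :=
  (innerSL ℂ v).comp ((ContinuousLinearMap.apply ℂ K u).comp T)

theorem continuous_matrixCoeff {A : Type*} [NormedAddCommGroup A] [NormedSpace ℂ A]
    (T : A →L[ℂ] (K →L[ℂ] K)) : Continuous fun p : K × K => matrixCoeff T p.1 p.2 := by
  have h1 : Continuous fun p : K × K => innerSL ℂ p.1 := (innerSL ℂ).continuous.comp continuous_fst
  have h2 : Continuous fun p : K × K => ContinuousLinearMap.apply ℂ K p.2 :=
    (ContinuousLinearMap.apply ℂ K).continuous.comp continuous_snd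
  exact h1.clm_comp (h2.clm_comp continuous_const)

/-- Radial limits in norm: a bounded weak-star holomorphic function on the disc with values in the
dual of a C⋆-algebra converges in norm along some sequence of radii, almost everywhere on the
circle. -/
theorem ae_exists_radial_limit {A : Type*} [NonUnitalCStarAlgebra A] {F : ℂ → StrongDual ℂ A}
    {C : ℝ} (hF : ∀ a, DifferentiableOn ℂ (fun w => F w a) (ball 0 1))
    (hC : ∀ w ∈ ball (0 : ℂ) 1, ‖F w‖ ≤ C) :
    ∃ r : ℕ → ℝ, (∀ k, r k ∈ Set.Ioo (0 : ℝ) 1) ∧ Tendsto r atTop (𝓝 1) ∧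
      ∀ᵐ θ ∂(MeasureTheory.volume.restrict (Set.Ioc 0 (2 * Real.pi))), ∃ L,
        Tendsto (fun k => F (r k * Circle.exp θ)) atTop (𝓝 L) := by
  obtain ⟨K, _, _, _, T, x, y, hx, hy, hfac⟩ := exists_factorization hF hC
  -- radii at which both factors are close to their boundary values
  have hex : ∀ k : ℕ, ∃ r : ℝ, (r ∈ Set.Ioo (0 : ℝ) 1 ∧ 1 - 1 / ((k : ℝ) + 1) < r) ∧
      ∑' i, (1 - r ^ i) ^ 2 * ‖x i‖ ^ 2 ≤ (1 / 4) ^ k ∧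
      ∑' i, (1 - r ^ i) ^ 2 * ‖y i‖ ^ 2 ≤ (1 / 4) ^ k := by
    intro k
    have hk : (0 : ℝ) < (1 / 4) ^ k := by positivity
    have h1 := (tendsto_dilation_defect hx).eventually (ge_mem_nhds hk)
    have h2 := (tendsto_dilation_defect hy).eventually (ge_mem_nhds hk)
    have h3 : Set.Ioo (1 - 1 / ((k : ℝ) + 1)) 1 ∈ 𝓝[<] (1 : ℝ) := by
      refine Ioo_mem_nhdsLT ?_
      rw [sub_lt_self_iff]
      positivity
    have h3' : ∀ᶠ r in 𝓝[<] (1 : ℝ), r ∈ Set.Ioo (0 : ℝ) 1 := Ioo_mem_nhdsLT (zero_lt_one' ℝ)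
    have h3'' : ∀ᶠ r in 𝓝[<] (1 : ℝ), r ∈ Set.Ioo (1 - 1 / ((k : ℝ) + 1)) 1 := h3
    obtain ⟨r, ⟨h4, h5⟩, h6, h7⟩ := ((h1.and h2).and (h3'.and h3'')).exists
    exact ⟨r, ⟨h6, h7.1⟩, h4, h5⟩
  choose r hr hrx hry using hex
  refine ⟨r, fun k => (hr k).1, ?_, ?_⟩
  · refine tendsto_of_tendsto_of_tendsto_of_le_of_le (g := fun k : ℕ => 1 - 1 / ((k : ℝ) + 1)) ?_
      tendsto_const_nhds (fun k => (hr k).2.le) (fun k => (hr k).1.2.le)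
    simpa using tendsto_one_div_add_atTop_nhds_zero_nat.const_sub (1 : ℝ)
  filter_upwards [ae_tendsto_power_series (σ := 1) one_ne_zero hx (fun k => (hr k).1) hrx,
    ae_tendsto_power_series (σ := -1) (by norm_num) hy (fun k => (hr k).1) hry] with θ h1 h2
  obtain ⟨u, hu⟩ := h1
  obtain ⟨v, hv⟩ := h2
  refine ⟨matrixCoeff T v u, ?_⟩
  refine (((continuous_matrixCoeff T).tendsto (v, u)).comp (hv.prodMk_nhds hu)).congr fun k => ?_
  ext a
  have hw : (r k * Circle.exp θ : ℂ) ∈ ball (0 : ℂ) 1 := by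
    rw [mem_ball_zero_iff, norm_mul, Circle.norm_coe, norm_real, Real.norm_eq_abs,
      abs_of_pos (hr k).1.1, mul_one]
    exact (hr k).1.2
  have e1 : (r k : ℂ) * (Circle.exp θ ^ (1 : ℤ) : Circle) = r k * Circle.exp θ := by rw [zpow_one]
  have e2 : (r k : ℂ) * (Circle.exp θ ^ (-1 : ℤ) : Circle) =
      starRingEnd ℂ (r k * Circle.exp θ) := by
    rw [zpow_neg_one, Circle.coe_inv_eq_conj, map_mul, conj_ofReal]
  rw [hfac _ hw]
  simp only [Function.comp, e1, e2]
  rfl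

end RadialLimits

/-! ### Functions on the strip -/

section ScalarStrip

/-- A function continuous on the closed unit strip, holomorphic inside and zero on the real axis
vanishes: on a square resting on the real axis, the product of its four rotations about the centre
vanishes on the boundary, hence everywhere. -/
theorem eq_zero_of_eq_zero_on_real {h : ℂ → ℂ} (hc : ContinuousOn h (im ⁻¹' Set.Icc 0 1))
    (hd : DifferentiableOn ℂ h (im ⁻¹' Set.Ioo 0 1)) (h0 : ∀ t : ℝ, h t = 0) :
    ∀ w ∈ im ⁻¹' Set.Icc (0 : ℝ) 1, h w = 0 := by
  let U : Set ℂ := Set.Ioo (-(1 / 2) : ℝ) (1 / 2) ×ℂ Set.Ioo (-(1 / 2) : ℝ) (1 / 2)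
  let Q : Set ℂ := Set.Icc (-(1 / 2) : ℝ) (1 / 2) ×ℂ Set.Icc (-(1 / 2) : ℝ) (1 / 2)
  have hU : IsOpen U := isOpen_Ioo.reProdIm isOpen_Ioo
  have hQ : IsClosed Q := isClosed_Icc.reProdIm isClosed_Icc
  have hUQ : U ⊆ Q := fun z hz => ⟨Set.Ioo_subset_Icc_self hz.1, Set.Ioo_subset_Icc_self hz.2⟩
  have hUconv : Convex ℝ U :=
    ((convex_Ioo (-(1 / 2) : ℝ) (1 / 2)).linear_preimage Complex.reLm).inter
      ((convex_Ioo (-(1 / 2) : ℝ) (1 / 2)).linear_preimage Complex.imLm)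
  have hpre : IsPreconnected U := hUconv.isPreconnected
  let g : ℂ → ℂ → ℂ := fun c v => h (I / 2 + c * v)
  -- the rotations preserving the square
  have hrotQ : ∀ c ∈ ({1, I, -1, -I} : Set ℂ), ∀ v ∈ Q, c * v ∈ Q := by
    rintro c (rfl | rfl | rfl | rfl) v ⟨⟨h1, h2⟩, h3, h4⟩ <;>
    refine ⟨⟨?_, ?_⟩, ?_, ?_⟩ <;> simp <;> linarith
  have hrotU : ∀ c ∈ ({1, I, -1, -I} : Set ℂ), ∀ v ∈ U, c * v ∈ U := by
    rintro c (rfl | rfl | rfl | rfl) v ⟨⟨h1, h2⟩, h3, h4⟩ <;>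
    refine ⟨⟨?_, ?_⟩, ?_, ?_⟩ <;> simp <;> linarith
  have hgc : ∀ c ∈ ({1, I, -1, -I} : Set ℂ), ContinuousOn (g c) Q := fun c hcm => by
    refine hc.comp (by fun_prop) fun v hv => ?_
    have := (hrotQ c hcm v hv).2
    constructor
    · have := this.1; simp only [add_im, div_ofNat_im, I_im]; linarith
    · have := this.2; simp only [add_im, div_ofNat_im, I_im]; linarith
  have hgd : ∀ c ∈ ({1, I, -1, -I} : Set ℂ), DifferentiableOn ℂ (g c) U := fun c hcm => by
    refine hd.comp (by fun_prop) fun v hv => ?_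
    have := (hrotU c hcm v hv).2
    constructor
    · have := this.1; simp only [add_im, div_ofNat_im, I_im]; linarith
    · have := this.2; simp only [add_im, div_ofNat_im, I_im]; linarith
  have hga : ∀ c ∈ ({1, I, -1, -I} : Set ℂ), AnalyticOnNhd ℂ (g c) U := fun c hcm =>
    (hgd c hcm).analyticOnNhd hU
  have hclosure : closure U ⊆ Q := hQ.closure_subset_iff.2 hUQ
  have hzero : ∀ c ∈ ({1, I, -1, -I} : Set ℂ), ∀ v, (c * v).im = -(1 / 2) → g c v = 0 := by
    intro c _ v hv
    have : I / 2 + c * v = ((c * v).re : ℂ) := by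
      apply Complex.ext
      · simp
      · rw [add_im, hv, ofReal_im]; norm_num
    simp only [g, this, h0]
  have m1 : (1 : ℂ) ∈ ({1, I, -1, -I} : Set ℂ) := by simp
  have m2 : I ∈ ({1, I, -1, -I} : Set ℂ) := by simp
  have m3 : (-1 : ℂ) ∈ ({1, I, -1, -I} : Set ℂ) := by simp
  have m4 : -I ∈ ({1, I, -1, -I} : Set ℂ) := by simp
  have hprod : ∀ v ∈ U, g 1 v * g I v * (g (-1) v * g (-I) v) = 0 := by
    intro v hv
    have hb : Bornology.IsBounded U := by
      refine (Metric.isBounded_closedBall (x := (0 : ℂ)) (r := 1)).subset fun z hz => ?_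
      rw [mem_closedBall_zero_iff]
      refine (norm_le_abs_re_add_abs_im z).trans ?_
      have h1 : |z.re| ≤ 1 / 2 := abs_le.2 ⟨hz.1.1.le, hz.1.2.le⟩
      have h2 : |z.im| ≤ 1 / 2 := abs_le.2 ⟨hz.2.1.le, hz.2.2.le⟩
      linarith
    have hdc : DiffContOnCl ℂ (fun v => g 1 v * g I v * (g (-1) v * g (-I) v)) U :=
      ⟨((hgd 1 m1).mul (hgd I m2)).mul ((hgd (-1) m3).mul (hgd (-I) m4)),
        (((hgc 1 m1).mul (hgc I m2)).mul ((hgc (-1) m3).mul (hgc (-I) m4))).mono hclosure⟩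
    have := norm_le_of_forall_mem_frontier_norm_le hb hdc (C := 0) (fun z hz => ?_)
      (subset_closure hv)
    · exact norm_le_zero_iff.1 this
    · rw [norm_le_zero_iff]
      rw [hU.frontier_eq] at hz
      obtain ⟨⟨h1, h2⟩, h3, h4⟩ := hclosure hz.1
      have : z.re = -(1 / 2) ∨ z.re = 1 / 2 ∨ z.im = -(1 / 2) ∨ z.im = 1 / 2 := by
        by_contra! hcon
        exact hz.2 ⟨⟨lt_of_le_of_ne h1 hcon.1.symm, lt_of_le_of_ne h2 hcon.2.1⟩,
          lt_of_le_of_ne h3 hcon.2.2.1.symm, lt_of_le_of_ne h4 hcon.2.2.2⟩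
      rcases this with h | h | h | h
      · rw [hzero I m2 z (by simp [h])]; simp
      · rw [hzero (-I) m4 z (by simp [h])]; simp
      · rw [hzero 1 m1 z (by simp [h])]; simp
      · rw [hzero (-1) m3 z (by simp [h])]; simp
  have hone : ∃ c ∈ ({1, I, -1, -I} : Set ℂ), ∀ v ∈ U, g c v = 0 := by
    rcases AnalyticOnNhd.eq_zero_or_eq_zero_of_mul_eq_zero ((hga 1 m1).mul (hga I m2))
      ((hga (-1) m3).mul (hga (-I) m4)) hprod hpre with h | h
    · rcases AnalyticOnNhd.eq_zero_or_eq_zero_of_mul_eq_zero (hga 1 m1) (hga I m2) h hpre with h | h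
      exacts [⟨1, m1, h⟩, ⟨I, m2, h⟩]
    · rcases AnalyticOnNhd.eq_zero_or_eq_zero_of_mul_eq_zero (hga (-1) m3) (hga (-I) m4) h hpre
        with h | h
      exacts [⟨-1, m3, h⟩, ⟨-I, m4, h⟩]
  obtain ⟨c, hcm, hcz⟩ := hone
  have h0U : (0 : ℂ) ∈ U := by
    refine ⟨⟨?_, ?_⟩, ?_, ?_⟩ <;> norm_num
  have hc0 : c ≠ 0 := by
    rintro rfl
    simp only [Set.mem_insert_iff, Set.mem_singleton_iff, zero_ne_one, zero_eq_neg, one_ne_zero,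
      I_ne_zero, I_ne_zero.symm, or_self] at hcm
  have hopen : IsOpen (im ⁻¹' Set.Ioo (0 : ℝ) 1) := isOpen_Ioo.preimage continuous_im
  have hev : h =ᶠ[𝓝 (I / 2)] 0 := by
    have h1 : Tendsto (fun z : ℂ => c⁻¹ * (z - I / 2)) (𝓝 (I / 2)) (𝓝 0) := by
      have : Continuous fun z : ℂ => c⁻¹ * (z - I / 2) := by fun_prop
      simpa using this.tendsto (I / 2)
    filter_upwards [h1 (hU.mem_nhds h0U)] with z hz
    have := hcz _ hz
    simp only [g] at this
    rw [mul_inv_cancel_left₀ hc0, add_sub_cancel] at this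
    simpa using this
  have hstripconv : Convex ℝ (im ⁻¹' Set.Ioo (0 : ℝ) 1) :=
    (convex_Ioo (0 : ℝ) 1).linear_preimage Complex.imLm
  have hint : Set.EqOn h 0 (im ⁻¹' Set.Ioo (0 : ℝ) 1) :=
    (hd.analyticOnNhd hopen).eqOn_zero_of_preconnected_of_eventuallyEq_zero
      hstripconv.isPreconnected (z₀ := I / 2) (by norm_num) hev
  have hcl : closure (im ⁻¹' Set.Ioo (0 : ℝ) 1) = im ⁻¹' Set.Icc 0 1 := by
    rw [Complex.closure_preimage_im, closure_Ioo zero_ne_one]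
  intro w hw
  have := Set.EqOn.of_subset_closure hint hc continuousOn_const
    (Set.preimage_mono Set.Ioo_subset_Icc_self) hcl.ge
  exact this hw

/-- Interpolation in a strip: a bounded analytic function that is small on the upper boundary line
is small near that line. -/
theorem norm_le_mul_exp_of_strip {h : ℂ → ℂ} {b M ε l : ℝ} (hb : b < 1)
    (hd : DiffContOnCl ℂ h (im ⁻¹' Set.Ioo b 1)) (hM : ∀ w ∈ im ⁻¹' Set.Icc b 1, ‖h w‖ ≤ M)
    (hε : ∀ w : ℂ, w.im = 1 → ‖h w‖ ≤ ε) (hl : M * Real.exp (-(l * (1 - b))) ≤ ε) (hl0 : 0 ≤ l)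
    {w : ℂ} (hw : w ∈ im ⁻¹' Set.Icc b 1) : ‖h w‖ ≤ ε * Real.exp (l * (1 - w.im)) := by
  have hM0 : 0 ≤ M := (norm_nonneg _).trans (hM w hw)
  -- the exponential factor has modulus `1` on the upper line and is small on the lower one
  let k : ℂ → ℂ := fun w => h w * cexp (-(I * l * (w - I)))
  have hexp : ∀ w : ℂ, ‖cexp (-(I * l * (w - I)))‖ = Real.exp (-(l * (1 - w.im))) := fun w => by
    rw [Complex.norm_exp]
    congr 1
    simp
    ring
  have hk : ‖k w‖ ≤ ε := by
    refine PhragmenLindelof.horizontal_strip (a := b) (b := 1) (f := k) (C := ε) ?_ ?_ ?_ ?_ hw.1 hw.2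
    · have : Differentiable ℂ fun w : ℂ => cexp (-(I * l * (w - I))) := by fun_prop
      exact hd.smul this.diffContOnCl
    · refine ⟨0, div_pos Real.pi_pos (by linarith), 0, ?_⟩
      simp only [zero_mul, Real.exp_zero]
      refine Asymptotics.IsBigO.of_bound M ?_
      refine Filter.mem_inf_of_right (Filter.mem_principal.2 fun z hz => ?_)
      have hz' : z ∈ im ⁻¹' Set.Icc b 1 := ⟨hz.1.le, hz.2.le⟩
      change ‖k z‖ ≤ _
      rw [norm_mul, hexp, norm_one]
      have : Real.exp (-(l * (1 - z.im))) ≤ 1 := by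
        rw [Real.exp_le_one_iff, neg_nonpos]
        exact mul_nonneg hl0 (by linarith [hz.2])
      exact mul_le_mul (hM z hz') this (Real.exp_pos _).le hM0
    · intro z hz
      rw [norm_mul, hexp, hz]
      refine le_trans ?_ hl
      gcongr
      exact hM z ⟨hz.ge, hz.le.trans hb.le⟩
    · intro z hz
      rw [norm_mul, hexp, hz]
      simpa using hε z hz
  rw [norm_mul, hexp, Real.exp_neg, ← div_eq_mul_inv, div_le_iff₀ (Real.exp_pos _)] at hk
  exact hk

end ScalarStrip

/-! ### Norm regularity on the strip -/

section StripRegularity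

variable {A : Type*} [NonUnitalCStarAlgebra A]

theorem isOpen_openStrip : IsOpen (im ⁻¹' Set.Ioo (0 : ℝ) 1) := isOpen_Ioo.preimage continuous_im

theorem openStrip_subset : im ⁻¹' Set.Ioo (0 : ℝ) 1 ⊆ im ⁻¹' Set.Icc (0 : ℝ) 1 :=
  Set.preimage_mono Set.Ioo_subset_Icc_self

/-- A weak-star continuous function on the closed strip whose norm does not increase under real
translations is bounded. -/
theorem exists_bound_of_weakStar_continuousOn {X : Type*} [NormedAddCommGroup X] [NormedSpace ℂ X]
    [CompleteSpace X] {G : ℂ → StrongDual ℂ X}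
    (hc : ∀ a, ContinuousOn (fun w => G w a) (im ⁻¹' Set.Icc 0 1))
    (hn : ∀ w ∈ im ⁻¹' Set.Icc (0 : ℝ) 1, ∀ t : ℝ, ‖G (w + t)‖ ≤ ‖G w‖) :
    ∃ C, ∀ w ∈ im ⁻¹' Set.Icc (0 : ℝ) 1, ‖G w‖ ≤ C := by
  obtain ⟨C, hC⟩ := banach_steinhaus (g := fun s : Set.Icc (0 : ℝ) 1 => G (s * I)) fun a => by
    have h1 : ContinuousOn (fun s : ℝ => G (s * I) a) (Set.Icc 0 1) :=
      (hc a).comp (by fun_prop) fun s hs => by simpa using hs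
    obtain ⟨C, hC⟩ := isCompact_Icc.exists_bound_of_continuousOn h1
    exact ⟨C, fun s => hC s s.2⟩
  refine ⟨C, fun w hw => ?_⟩
  have h1 : (w.im * I : ℂ) ∈ im ⁻¹' Set.Icc (0 : ℝ) 1 := by simpa using hw
  have h2 := hn _ h1 w.re
  have h3 : (w.im * I + w.re : ℂ) = w := by rw [add_comm]; exact re_add_im w
  rw [h3] at h2
  exact h2.trans (hC ⟨w.im, hw⟩)

theorem differentiableAt_zero_of_weakStar {X : Type*} [NormedAddCommGroup X] [NormedSpace ℂ X]
    {F : ℂ → StrongDual ℂ X} {C : ℝ}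
    (hF : ∀ a, DifferentiableOn ℂ (fun w => F w a) (ball 0 1))
    (hC : ∀ w ∈ ball (0 : ℂ) 1, ‖F w‖ ≤ C) : DifferentiableAt ℂ F 0 := by
  obtain ⟨c, hc, hsum⟩ := exists_hasSum_of_weakStar_differentiableOn hF hC
  have hd : DifferentiableOn ℂ (fun w : ℂ => ∑' n, w ^ n • c n) (ball 0 (1 / 2)) := by
    refine differentiableOn_tsum_of_summable_norm (u := fun n => (1 / 2) ^ n * C)
      ((summable_geometric_of_lt_one (by norm_num) (by norm_num)).mul_right C)
      (fun n => by fun_prop) isOpen_ball fun n w hw => ?_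
    rw [norm_smul, norm_pow]
    have : ‖w‖ ≤ 1 / 2 := (mem_ball_zero_iff.1 hw).le
    have h0 : 0 ≤ C := (norm_nonneg _).trans (hc n)
    gcongr
    exact hc n
  have hmem : ball (0 : ℂ) (1 / 2) ∈ 𝓝 0 := ball_mem_nhds _ (by norm_num)
  refine (hd.differentiableAt hmem).congr_of_eventuallyEq ?_
  filter_upwards [hmem] with w hw
  exact (hsum w (ball_subset_ball (by norm_num) hw)).tsum_eq.symm

/-- Bounded weak-star holomorphic functions are norm holomorphic. -/
theorem differentiableOn_of_weakStar {X : Type*} [NormedAddCommGroup X] [NormedSpace ℂ X]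
    {G : ℂ → StrongDual ℂ X} {C : ℝ} {U : Set ℂ} (hU : IsOpen U)
    (hG : ∀ a, DifferentiableOn ℂ (fun w => G w a) U) (hC : ∀ w ∈ U, ‖G w‖ ≤ C) :
    DifferentiableOn ℂ G U := by
  intro w hw
  obtain ⟨R, hR, hRU⟩ := Metric.isOpen_iff.1 hU w hw
  have hmap : ∀ v ∈ ball (0 : ℂ) 1, w + R * v ∈ U := fun v hv => hRU (by
    rw [mem_ball, dist_eq_norm, add_sub_cancel_left, norm_mul, norm_real, Real.norm_eq_abs,
      abs_of_pos hR]
    have := mem_ball_zero_iff.1 hv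
    nlinarith)
  have h1 : DifferentiableAt ℂ (fun v : ℂ => G (w + R * v)) 0 :=
    differentiableAt_zero_of_weakStar (C := C)
      (fun a => (hG a).comp (f := fun v : ℂ => w + R * v) (by fun_prop) hmap)
      fun v hv => hC _ (hmap v hv)
  have hR' : (R : ℂ) ≠ 0 := by exact_mod_cast hR.ne'
  have h2 : DifferentiableAt ℂ (fun z : ℂ => (z - w) / R) w := by fun_prop
  have h3 : G = (fun v : ℂ => G (w + R * v)) ∘ fun z : ℂ => (z - w) / R := by
    ext1 z
    simp only [Function.comp]
    congr 1
    field_simp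
    ring
  rw [h3]
  refine DifferentiableAt.differentiableWithinAt (DifferentiableAt.comp w ?_ h2)
  simpa using h1

/-- The conformal map from the unit disc onto the open unit strip which takes the upper half circle
to the upper boundary line. -/
noncomputable def discToStrip (w : ℂ) : ℂ := I / 2 + (Real.pi : ℂ)⁻¹ * Complex.log ((1 + w) / (1 - w))

/-- The Cayley transform maps the disc to the right half plane and the upper half circle to the
upper half of the imaginary axis. -/
theorem cayley_re_im (w : ℂ) : ((1 + w) / (1 - w)).re = (1 - normSq w) / normSq (1 - w) ∧
    ((1 + w) / (1 - w)).im = 2 * w.im / normSq (1 - w) := by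
  constructor
  · rw [div_re, ← add_div]
    congr 1
    simp [normSq_apply]
    ring
  · rw [div_im, ← sub_div]
    congr 1
    simp
    ring

theorem one_sub_ne_zero_of_im_or {w : ℂ} (h : ‖w‖ < 1 ∨ 0 < w.im) : 1 - w ≠ 0 := by
  intro h0
  have : w = 1 := (sub_eq_zero.1 h0).symm
  subst this
  simp at h

theorem discToStrip_im (w : ℂ) :
    (discToStrip w).im = 1 / 2 + Real.pi⁻¹ * ((1 + w) / (1 - w)).arg := by
  rw [discToStrip, ← ofReal_inv, add_im, im_ofReal_mul, log_im]
  simp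

theorem discToStrip_mem {w : ℂ} (hw : w ∈ ball (0 : ℂ) 1) :
    discToStrip w ∈ im ⁻¹' Set.Ioo (0 : ℝ) 1 := by
  have hw1 : ‖w‖ < 1 := mem_ball_zero_iff.1 hw
  have h1 : 0 < ((1 + w) / (1 - w)).re := by
    rw [(cayley_re_im w).1]
    refine div_pos ?_ (normSq_pos.2 (one_sub_ne_zero_of_im_or (.inl hw1)))
    rw [normSq_eq_norm_sq]
    nlinarith [norm_nonneg w]
  have h2 := abs_lt.1 (abs_arg_lt_pi_div_two_iff.2 (.inl h1))
  have hpi := Real.pi_pos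
  have h3 : Real.pi⁻¹ * (Real.pi / 2) = 1 / 2 := by field_simp
  have h4 : 0 < Real.pi⁻¹ := by positivity
  change 0 < _ ∧ _ < 1
  rw [discToStrip_im]
  constructor <;> nlinarith

theorem differentiableAt_discToStrip {w : ℂ} (hw : ‖w‖ < 1 ∨ (‖w‖ = 1 ∧ 0 < w.im)) :
    DifferentiableAt ℂ discToStrip w := by
  have h0 : 1 - w ≠ 0 := one_sub_ne_zero_of_im_or (hw.imp id And.right)
  have h1 : (1 + w) / (1 - w) ∈ slitPlane := by
    rw [mem_slitPlane_iff]
    rcases hw with hw | hw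
    · left
      rw [(cayley_re_im w).1]
      refine div_pos ?_ (normSq_pos.2 h0)
      rw [normSq_eq_norm_sq]
      nlinarith [norm_nonneg w]
    · right
      rw [(cayley_re_im w).2]
      exact (div_pos (by linarith [hw.2]) (normSq_pos.2 h0)).ne'
  have h2 : DifferentiableAt ℂ (fun w : ℂ => (1 + w) / (1 - w)) w := by
    refine DifferentiableAt.div (by fun_prop) (by fun_prop) h0
  exact (((h2.clog h1).const_mul _).const_add _)

theorem discToStrip_im_of_circle {w : ℂ} (h1 : ‖w‖ = 1) (h2 : 0 < w.im) :
    (discToStrip w).im = 1 := by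
  have h0 : 1 - w ≠ 0 := one_sub_ne_zero_of_im_or (.inr h2)
  have : ((1 + w) / (1 - w)).arg = Real.pi / 2 := by
    rw [arg_eq_pi_div_two_iff, (cayley_re_im w).1, (cayley_re_im w).2]
    refine ⟨by simp [normSq_eq_norm_sq, h1], div_pos (by linarith) (normSq_pos.2 h0)⟩
  rw [discToStrip_im, this]
  have := Real.pi_pos
  field_simp
  norm_num

/-- A bounded weak-star regular function on the strip has a norm limit at some point of the upper
boundary line, along a sequence of interior points. -/
theorem exists_close_interior_point {G : ℂ → StrongDual ℂ A} {C : ℝ}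
    (hc : ∀ a, ContinuousOn (fun w => G w a) (im ⁻¹' Set.Icc 0 1))
    (hd : ∀ a, DifferentiableOn ℂ (fun w => G w a) (im ⁻¹' Set.Ioo 0 1))
    (hC : ∀ w ∈ im ⁻¹' Set.Icc (0 : ℝ) 1, ‖G w‖ ≤ C) {ε : ℝ} (hε : 0 < ε) :
    ∃ p q : ℂ, p ∈ im ⁻¹' Set.Ioo (0 : ℝ) 1 ∧ q.im = 1 ∧ ‖G q - G p‖ ≤ ε := by
  obtain ⟨r, hr, hr1, hae⟩ := ae_exists_radial_limit (F := fun w => G (discToStrip w)) (C := C)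
    (fun a => (hd a).comp (fun w hw => (differentiableAt_discToStrip
      (.inl (mem_ball_zero_iff.1 hw))).differentiableWithinAt) fun w hw => discToStrip_mem hw)
    fun w hw => hC _ (openStrip_subset (discToStrip_mem hw))
  have hae' := MeasureTheory.ae_restrict_of_ae_restrict_of_subset
    (s := Set.Ioo 0 Real.pi) (t := Set.Ioc 0 (2 * Real.pi))
    (fun θ hθ => ⟨hθ.1, by linarith [hθ.2, Real.pi_pos]⟩) hae
  have hmem : ∀ᵐ θ ∂(MeasureTheory.volume.restrict (Set.Ioo 0 Real.pi)), θ ∈ Set.Ioo 0 Real.pi :=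
    MeasureTheory.ae_restrict_mem measurableSet_Ioo
  have hne : (MeasureTheory.ae (MeasureTheory.volume.restrict (Set.Ioo 0 Real.pi))).NeBot := by
    rw [MeasureTheory.ae_neBot, Ne, MeasureTheory.Measure.restrict_eq_zero]
    simp [Real.pi_pos]
  obtain ⟨θ, ⟨L, hL⟩, hθ⟩ := (hae'.and hmem).exists
  let ζ : ℂ := Circle.exp θ
  have hζ1 : ‖ζ‖ = 1 := Circle.norm_coe _
  have hζ2 : 0 < ζ.im := by
    have : ζ.im = Real.sin θ := by simp [ζ, Complex.exp_ofReal_mul_I_im]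
    rw [this]
    exact Real.sin_pos_of_pos_of_lt_pi hθ.1 hθ.2
  have hball : ∀ k, (r k * ζ : ℂ) ∈ ball (0 : ℂ) 1 := fun k => by
    rw [mem_ball_zero_iff, norm_mul, hζ1, norm_real, Real.norm_eq_abs, abs_of_pos (hr k).1, mul_one]
    exact (hr k).2
  have him : (discToStrip ζ).im = 1 := discToStrip_im_of_circle hζ1 hζ2
  have hconv : Tendsto (fun k => discToStrip (r k * ζ)) atTop
      (𝓝[im ⁻¹' Set.Icc (0 : ℝ) 1] (discToStrip ζ)) := by
    refine tendsto_nhdsWithin_iff.2 ⟨?_, .of_forall fun k => openStrip_subset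
      (discToStrip_mem (hball k))⟩
    refine (differentiableAt_discToStrip (.inr ⟨hζ1, hζ2⟩)).continuousAt.tendsto.comp ?_
    have := (((continuous_ofReal.tendsto _).comp hr1).mul_const ζ)
    simpa using this
  -- weak-star continuity identifies the norm limit
  have hLq : L = G (discToStrip ζ) := by
    ext a
    have h1 : Tendsto (fun k => G (discToStrip (r k * ζ)) a) atTop (𝓝 (L a)) :=
      ((ContinuousLinearMap.apply ℂ ℂ a).continuous.tendsto L).comp hL
    have h2 : Tendsto (fun k => G (discToStrip (r k * ζ)) a) atTop (𝓝 (G (discToStrip ζ) a)) :=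
      (hc a (discToStrip ζ) (by simp [him])).tendsto.comp hconv
    exact tendsto_nhds_unique h1 h2
  obtain ⟨k, hk⟩ := (hL.eventually (closedBall_mem_nhds L hε)).exists
  refine ⟨discToStrip (r k * ζ), discToStrip ζ, discToStrip_mem (hball k), him, ?_⟩
  rw [← hLq, ← dist_eq_norm, dist_comm]
  exact hk

/-- Norm continuity at the upper boundary line. Let `v` be the difference of a boundary point `q` and
an interior point `p` with `G q` close to `G p`. Translation gives that `G w - G (w - v)` is small on
the whole boundary line, and interpolation that it is small near it, while `w - v` is an interior
point, where `G` is continuous. -/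
theorem continuousWithinAt_top {G : ℂ → StrongDual ℂ A}
    (hc : ∀ a, ContinuousOn (fun w => G w a) (im ⁻¹' Set.Icc 0 1))
    (hd : ∀ a, DifferentiableOn ℂ (fun w => G w a) (im ⁻¹' Set.Ioo 0 1))
    (hn : ∀ w ∈ im ⁻¹' Set.Icc (0 : ℝ) 1, ∀ t : ℝ, ‖G (w + t)‖ ≤ ‖G w‖)
    (ht : ∀ w ∈ im ⁻¹' Set.Icc (0 : ℝ) 1, ∀ w' ∈ im ⁻¹' Set.Icc (0 : ℝ) 1, ∀ t : ℝ,
      ‖G (w + t) - G (w' + t)‖ ≤ ‖G w - G w'‖) {w₀ : ℂ} (hw₀ : w₀.im = 1) :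
    ContinuousWithinAt G (im ⁻¹' Set.Icc 0 1) w₀ := by
  obtain ⟨C, hC⟩ := exists_bound_of_weakStar_continuousOn hc hn
  have hC0 : 0 ≤ C := (norm_nonneg _).trans (hC 0 (by simp))
  have hdiff := differentiableOn_of_weakStar isOpen_openStrip hd
    fun w hw => hC w (openStrip_subset hw)
  rw [Metric.continuousWithinAt_iff']
  intro ε' hε'
  obtain ⟨ε, hε, hεε⟩ : ∃ ε > 0, 4 * ε < ε' := ⟨ε' / 8, by positivity, by linarith⟩
  obtain ⟨p, q, hp, hq, hpq⟩ := exists_close_interior_point hc hd hC hε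
  let v : ℂ := q - p
  have hv0 : 0 < v.im := by simp only [v, sub_im, hq]; linarith [hp.2]
  have hv1 : v.im < 1 := by simp only [v, sub_im, hq]; linarith [hp.1]
  let h : ℂ → StrongDual ℂ A := fun w => G w - G (w - v)
  have hsh : ∀ w ∈ im ⁻¹' Set.Icc v.im 1, w ∈ im ⁻¹' Set.Icc (0 : ℝ) 1 ∧
      w - v ∈ im ⁻¹' Set.Icc (0 : ℝ) 1 := fun w hw => by
    have h1 := hw.1
    have h2 := hw.2
    refine ⟨⟨by linarith, h2⟩, ?_, ?_⟩ <;> rw [sub_im] <;> linarith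
  have htop : ∀ w : ℂ, w.im = 1 → ‖h w‖ ≤ ε := by
    intro w hw
    have h1 : w = q + (w.re - q.re : ℝ) := by apply Complex.ext <;> simp [hw, hq]
    have h2 : w - v = p + (w.re - q.re : ℝ) := by
      simp only [v]; nth_rewrite 1 [h1]; ring
    simp only [h]
    rw [h2]
    nth_rewrite 1 [h1]
    exact (ht q (by simp [hq]) p (openStrip_subset hp) _).trans hpq
  obtain ⟨l, hl0, hl⟩ : ∃ l : ℝ, 0 ≤ l ∧ (2 * C) * Real.exp (-(l * (1 - v.im))) ≤ ε := by
    have hv1' : 0 < 1 - v.im := by linarith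
    refine ⟨2 * C / (ε * (1 - v.im)), by positivity, ?_⟩
    have h1 : 2 * C / (ε * (1 - v.im)) * (1 - v.im) = 2 * C / ε := by field_simp
    rw [h1, Real.exp_neg, ← div_eq_mul_inv, div_le_iff₀ (Real.exp_pos _)]
    have h2 := Real.add_one_le_exp (2 * C / ε)
    have h3 : 2 * C = ε * (2 * C / ε) := by field_simp
    nlinarith
  have hclos : closure (im ⁻¹' Set.Ioo v.im 1) = im ⁻¹' Set.Icc v.im 1 := by
    rw [Complex.closure_preimage_im, closure_Ioo hv1.ne]
  have hinterp : ∀ w ∈ im ⁻¹' Set.Icc v.im 1, ‖h w‖ ≤ ε * Real.exp (l * (1 - w.im)) := by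
    intro w hw
    refine ContinuousLinearMap.opNorm_le_bound _ (by positivity) fun a => ?_
    have hcs : ContinuousOn (fun w => h w a) (im ⁻¹' Set.Icc v.im 1) := by
      refine ((hc a).mono fun w hw => (hsh w hw).1).sub ?_
      exact (hc a).comp (f := fun w => w - v) (by fun_prop) fun w hw => (hsh w hw).2
    have hds : DifferentiableOn ℂ (fun w => h w a) (im ⁻¹' Set.Ioo v.im 1) := by
      refine ((hd a).mono fun w hw => ⟨hv0.trans hw.1, hw.2⟩).sub ?_
      refine (hd a).comp (f := fun w => w - v) (by fun_prop) fun w hw => ?_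
      have h1 := hw.1
      have h2 := hw.2
      refine ⟨?_, ?_⟩ <;> rw [sub_im] <;> linarith
    have := norm_le_mul_exp_of_strip (h := fun w => h w a) (M := 2 * C * ‖a‖) (ε := ε * ‖a‖) (l := l)
      hv1 ⟨hds, by rwa [hclos]⟩ (fun z hz => ?_) (fun z hz => ?_) ?_ hl0 hw
    · exact this.trans_eq (by ring)
    · refine ((h z).le_opNorm a).trans ?_
      gcongr
      refine (norm_sub_le _ _).trans ?_
      linarith [hC z (hsh z hz).1, hC _ (hsh z hz).2]
    · exact ((h z).le_opNorm a).trans (by gcongr; exact htop z hz)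
    · calc _ = (2 * C) * Real.exp (-(l * (1 - v.im))) * ‖a‖ := by ring
        _ ≤ _ := by gcongr
  -- the three conditions which determine how close `w` has to be to `w₀`
  have hev1 : ∀ᶠ w in 𝓝 w₀, Real.exp (l * (1 - w.im)) < 2 := by
    have : Continuous fun w : ℂ => Real.exp (l * (1 - w.im)) := by fun_prop
    refine (this.tendsto w₀).eventually (gt_mem_nhds ?_)
    simp [hw₀]
  have hev2 : ∀ᶠ w in 𝓝 w₀, v.im < w.im :=
    (continuous_im.tendsto w₀).eventually (lt_mem_nhds (by rw [hw₀]; exact hv1))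
  have hev3 : ∀ᶠ w in 𝓝 w₀, ‖G (w - v) - G (w₀ - v)‖ < ε := by
    have hm : w₀ - v ∈ im ⁻¹' Set.Ioo (0 : ℝ) 1 := by
      refine ⟨?_, ?_⟩ <;> rw [sub_im, hw₀] <;> linarith
    have h1 : ContinuousAt G (w₀ - v) :=
      (hdiff.differentiableAt (isOpen_openStrip.mem_nhds hm)).continuousAt
    have h2 : ContinuousAt (fun w => G (w - v)) w₀ :=
      ContinuousAt.comp (f := fun w => w - v) h1 (by fun_prop)
    have := Metric.tendsto_nhds.1 h2.tendsto ε hε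
    simpa [dist_eq_norm] using this
  filter_upwards [nhdsWithin_le_nhds hev1, nhdsWithin_le_nhds hev2, nhdsWithin_le_nhds hev3,
    self_mem_nhdsWithin] with w h1 h2 h3 h4
  rw [dist_eq_norm]
  have h5 : G w - G w₀ = h w + (G (w - v) - G (w₀ - v)) - h w₀ := by simp only [h]; abel
  have h6 := hinterp w ⟨h2.le, h4.2⟩
  have h7 := htop w₀ hw₀
  rw [h5]
  refine ((norm_sub_le _ _).trans (add_le_add (norm_add_le _ _) le_rfl)).trans_lt ?_
  nlinarith

/-- A weak-star regular function on the strip with values in the dual of a C⋆-algebra, on whose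
values real translations act by contractions, is norm regular. -/
theorem normRegular_of_weakStarRegular {G : ℂ → StrongDual ℂ A}
    (hc : ∀ a, ContinuousOn (fun w => G w a) (im ⁻¹' Set.Icc 0 1))
    (hd : ∀ a, DifferentiableOn ℂ (fun w => G w a) (im ⁻¹' Set.Ioo 0 1))
    (hn : ∀ w ∈ im ⁻¹' Set.Icc (0 : ℝ) 1, ∀ t : ℝ, ‖G (w + t)‖ ≤ ‖G w‖)
    (ht : ∀ w ∈ im ⁻¹' Set.Icc (0 : ℝ) 1, ∀ w' ∈ im ⁻¹' Set.Icc (0 : ℝ) 1, ∀ t : ℝ,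
      ‖G (w + t) - G (w' + t)‖ ≤ ‖G w - G w'‖) :
    ContinuousOn G (im ⁻¹' Set.Icc 0 1) ∧ DifferentiableOn ℂ G (im ⁻¹' Set.Ioo 0 1) := by
  obtain ⟨C, hC⟩ := exists_bound_of_weakStar_continuousOn hc hn
  have hdiff := differentiableOn_of_weakStar isOpen_openStrip hd
    fun w hw => hC w (openStrip_subset hw)
  refine ⟨fun w hw => ?_, hdiff⟩
  rcases eq_or_lt_of_le hw.1 with h0 | h0
  · -- the lower boundary line is the upper one of the function `w ↦ G (I - w)`
    have hmap : ∀ z ∈ im ⁻¹' Set.Icc (0 : ℝ) 1, I - z ∈ im ⁻¹' Set.Icc (0 : ℝ) 1 := fun z hz => by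
      have h1 := hz.1
      have h2 := hz.2
      refine ⟨?_, ?_⟩ <;> rw [sub_im, I_im] <;> linarith
    have hmap' : ∀ z ∈ im ⁻¹' Set.Ioo (0 : ℝ) 1, I - z ∈ im ⁻¹' Set.Ioo (0 : ℝ) 1 := fun z hz => by
      have h1 := hz.1
      have h2 := hz.2
      refine ⟨?_, ?_⟩ <;> rw [sub_im, I_im] <;> linarith
    have hneg : ∀ (z : ℂ) (t : ℝ), I - (z + t) = (I - z) + (-t : ℝ) := fun z t => by
      push_cast; ring
    have h1 := continuousWithinAt_top (G := fun z => G (I - z))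
      (fun a => (hc a).comp (f := fun z => I - z) (by fun_prop) hmap)
      (fun a => (hd a).comp (f := fun z => I - z) (by fun_prop) hmap')
      (fun z hz t => by rw [hneg]; exact hn _ (hmap z hz) _)
      (fun z hz z' hz' t => by
        rw [hneg, hneg]; exact ht _ (hmap z hz) _ (hmap z' hz') _) (w₀ := I - w)
      (by rw [sub_im, ← h0, I_im, sub_zero])
    have h2 := ContinuousWithinAt.comp (f := fun z : ℂ => I - z) h1
      (by fun_prop : Continuous fun z : ℂ => I - z).continuousWithinAt hmap
    refine h2.congr (fun z _ => ?_) ?_ <;> simp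
  · rcases eq_or_lt_of_le hw.2 with h1 | h1
    · exact continuousWithinAt_top hc hd hn ht h1
    · exact (hdiff.differentiableAt
        (isOpen_openStrip.mem_nhds ⟨h0, h1⟩)).continuousAt.continuousWithinAt

end StripRegularity

/-! ### Kaplansky density and the restriction of normal functionals -/

section Kaplansky

variable {H : Type u} [NormedAddCommGroup H] [InnerProductSpace ℂ H] [CompleteSpace H]
  (M : VonNeumannAlgebra H)

theorem isClosed_vonNeumann : IsClosed (M.toStarSubalgebra : Set (H →L[ℂ] H)) := by
  rw [VonNeumannAlgebra.coe_toStarSubalgebra, ← M.centralizer_centralizer]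
  exact Set.isClosed_centralizer _

variable {M}

theorem vectorFunctional_apply (ξ η : H) (x : M.toStarSubalgebra) :
    vectorFunctional M ξ η x = ⟪ξ, (x : H →L[ℂ] H) η⟫_ℂ := rfl

theorem vectorFunctional_mem (ξ η : H) : vectorFunctional M ξ η ∈ predual M :=
  Submodule.le_topologicalClosure _ (Submodule.subset_span ⟨(ξ, η), rfl⟩)

/-- A normal functional vanishing on a weak-star-dense set vanishes. -/
theorem eq_zero_of_dense {s : Set M.toStarSubalgebra}
    (hs : @Dense M.toStarSubalgebra (weakStar M) s) {σ : StrongDual ℂ M.toStarSubalgebra}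
    (hσ : σ ∈ predual M) (h : ∀ a ∈ s, σ a = 0) (x : M.toStarSubalgebra) : σ x = 0 := by
  have h1 : @Continuous _ _ (weakStar M) _ (fun x : M.toStarSubalgebra => σ x) := by
    have h2 : @Continuous _ _ (weakStar M) _
        (fun x : M.toStarSubalgebra => fun ω : predual M => predualPairing M x ω) :=
      continuous_induced_dom
    let _ := weakStar M
    exact (continuous_apply (⟨σ, hσ⟩ : predual M)).comp h2
  let _ := weakStar M
  have := Continuous.ext_on hs h1 (continuous_const (y := (0 : ℂ))) h
  exact congrFun this x

/-- Self-adjoint elements of `M` can be approximated on finitely many vectors by self-adjoint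
elements of a weak-star-dense `*`-subalgebra: the set of approximations is a real subspace, so by
Hahn-Banach weak and strong density agree. -/
theorem exists_selfAdjoint_approx {A : NonUnitalStarSubalgebra ℂ M.toStarSubalgebra}
    (hdense : @Dense M.toStarSubalgebra (weakStar M) (A : Set M.toStarSubalgebra))
    {y : M.toStarSubalgebra} (hy : IsSelfAdjoint y) {ι : Type*} [Fintype ι] (v : ι → H)
    {ε : ℝ} (hε : 0 < ε) :
    ∃ y' ∈ A, IsSelfAdjoint y' ∧ ∀ j, ‖(y' : H →L[ℂ] H) (v j) - (y : H →L[ℂ] H) (v j)‖ < ε := by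
  classical
  let Φ : M.toStarSubalgebra →ₗ[ℝ] (ι → H) :=
    { toFun := fun x j => (x : H →L[ℂ] H) (v j)
      map_add' := fun x x' => by ext j; simp
      map_smul' := fun c x => by ext j; rfl }
  let W : Submodule ℝ M.toStarSubalgebra :=
    { carrier := {x | x ∈ A ∧ IsSelfAdjoint x}
      add_mem' := fun h h' => ⟨add_mem h.1 h'.1, h.2.add h'.2⟩
      zero_mem' := ⟨zero_mem _, .zero _⟩
      smul_mem' := fun c x h => ⟨by
        have := A.smul_mem (r := (c : ℂ)) h.1
        simpa using this, IsSelfAdjoint.smul (.all c) h.2⟩ }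
  by_contra hcon
  have hnot : Φ y ∉ closure (W.map Φ : Set (ι → H)) := by
    intro hmem
    obtain ⟨_, ⟨x, hx, rfl⟩, hd⟩ := Metric.mem_closure_iff.1 hmem ε hε
    refine hcon ⟨x, hx.1, hx.2, fun j => ?_⟩
    rw [dist_comm, dist_eq_norm] at hd
    exact (norm_le_pi_norm (Φ x - Φ y) j).trans_lt hd
  obtain ⟨f, c, hf1, hf2⟩ := RCLike.geometric_hahn_banach_closed_point (𝕜 := ℂ)
    (W.map Φ).convex.closure isClosed_closure hnot
  have hc0 : 0 < c := by
    have := hf1 0 (subset_closure (W.map Φ).zero_mem)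
    simpa using this
  have hW : ∀ x ∈ W, (f (Φ x)).re = 0 := by
    intro x hx
    have hle : ∀ x ∈ W, (f (Φ x)).re ≤ 0 := by
      intro x hx
      by_contra! hpos
      have h1 := hf1 (Φ ((c / (f (Φ x)).re) • x)) (subset_closure ⟨_, W.smul_mem _ hx, rfl⟩)
      rw [map_smul, ← Complex.coe_smul, map_smul, smul_eq_mul, RCLike.re_eq_complex_re,
        re_ofReal_mul, div_mul_cancel₀ _ hpos.ne'] at h1
      exact lt_irrefl _ h1
    have h2 := hle _ (W.neg_mem hx)
    rw [map_neg, map_neg, neg_re] at h2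
    linarith [hle x hx]
  -- `f ∘ Φ` is a normal functional; its real part on self-adjoint elements is also given by the
  -- normal functional `ρ + ρ'`, which vanishes on `A`
  let u : ι → H := fun j => (InnerProductSpace.toDual ℂ H).symm
    (f.comp (ContinuousLinearMap.single ℂ (fun _ => H) j))
  let ρ : StrongDual ℂ M.toStarSubalgebra := ∑ j, vectorFunctional M (u j) (v j)
  let ρ' : StrongDual ℂ M.toStarSubalgebra := ∑ j, vectorFunctional M (v j) (u j)
  have hρ : ∀ x, ρ x = f (Φ x) := by
    intro x
    have h1 : Φ x = ∑ j, Pi.single j (Φ x j) := (Finset.univ_sum_single (Φ x)).symm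
    rw [h1, map_sum]
    simp only [ρ, sum_apply, vectorFunctional_apply, u,
      InnerProductSpace.toDual_symm_apply]
    rfl
  have hρ' : ∀ x, ρ' x = starRingEnd ℂ (ρ (star x)) := by
    intro x
    simp only [ρ, ρ', sum_apply, vectorFunctional_apply, map_sum]
    refine Finset.sum_congr rfl fun j _ => ?_
    rw [inner_conj_symm]
    change _ = ⟪(star (x : H →L[ℂ] H)) (v j), u j⟫_ℂ
    rw [ContinuousLinearMap.star_eq_adjoint, ContinuousLinearMap.adjoint_inner_left]
  have hmem : ρ + ρ' ∈ predual M := add_mem (sum_mem fun j _ => vectorFunctional_mem _ _)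
    (sum_mem fun j _ => vectorFunctional_mem _ _)
  have hsa : ∀ x, IsSelfAdjoint x → (ρ + ρ') x = ((2 * (f (Φ x)).re : ℝ) : ℂ) := by
    intro x hx
    rw [add_apply, hρ', hx.star_eq, hρ, Complex.add_conj]
  have hsaA : ∀ x ∈ A, IsSelfAdjoint x → (ρ + ρ') x = 0 := fun x hx hx' => by
    rw [hsa x hx', hW x ⟨hx, hx'⟩]; simp
  have hzero := eq_zero_of_dense hdense hmem (fun a ha => by
    have h1 := hsaA (a + star a) (add_mem ha (star_mem ha)) (IsSelfAdjoint.add_star_self a)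
    have h2 := hsaA (I • (a - star a)) 
      (A.smul_mem (r := I) (sub_mem ha (star_mem (S := _) ha : star a ∈ A))) (by
      rw [IsSelfAdjoint, star_smul, star_sub, star_star]
      simp only [RCLike.star_def, conj_I, smul_sub, neg_smul]
      abel)
    rw [map_smul, smul_eq_mul, mul_eq_zero] at h2
    have h3 := h2.resolve_left I_ne_zero
    rw [map_add] at h1
    rw [map_sub] at h3
    linear_combination (h1 + h3) / 2) y
  rw [hsa y hy] at hzero
  have : (f (Φ y)).re = 0 := by
    have := Complex.ofReal_eq_zero.1 hzero
    linarith
  change c < (f (Φ y)).re at hf2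
  linarith

/-- The function `t / (1 + √(1 - t²))` is a right inverse of `s ↦ 2s / (1 + s²)` on `[-1, 1]`. -/
theorem kaplansky_scalar {t : ℝ} (ht : |t| ≤ 1) :
    2 * (t / (1 + √(1 - t ^ 2))) = t * (1 + (t / (1 + √(1 - t ^ 2))) ^ 2) := by
  have h1 : 0 ≤ 1 - t ^ 2 := by
    have := (sq_le_one_iff_abs_le_one t).2 ht
    linarith
  have h2 := Real.sq_sqrt h1
  have h3 : 0 < 1 + √(1 - t ^ 2) := by positivity
  field_simp
  linear_combination (-t) * h2

/-- Every self-adjoint contraction in a C⋆-algebra is `2y / (1 + y²)` for a self-adjoint `y`. -/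
theorem exists_two_mul_eq {B : Type*} [CStarAlgebra B] {x : B} (hx : IsSelfAdjoint x)
    (hx1 : ‖x‖ ≤ 1) :
    ∃ y r : B, IsSelfAdjoint y ∧ (1 + y * y) * r = 1 ∧ x = (2 : ℝ) • (y * r) := by
  cases subsingleton_or_nontrivial B
  · exact ⟨0, 0, .zero _, Subsingleton.elim _ _, Subsingleton.elim _ _⟩
  let g : ℝ → ℝ := fun t => t / (1 + √(1 - t ^ 2))
  have hg : Continuous g := by
    refine continuous_id.div (by fun_prop) fun t => ?_
    have : 0 < 1 + √(1 - t ^ 2) := by positivity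
    exact this.ne'
  have hpos : ∀ t, (0 : ℝ) < 1 + g t * g t := fun t => by nlinarith [sq_nonneg (g t)]
  have hr : Continuous fun t => (1 + g t * g t)⁻¹ :=
    Continuous.inv₀ (by fun_prop) fun t => (hpos t).ne'
  refine ⟨cfc g x, cfc (fun t => (1 + g t * g t)⁻¹) x, cfc_predicate g x, ?_, ?_⟩
  · rw [← cfc_mul g g x hg.continuousOn hg.continuousOn, ← cfc_one ℝ x,
      ← cfc_add (a := x) (1 : ℝ → ℝ) (fun t => g t * g t) (by fun_prop) (by fun_prop),
      ← cfc_mul _ _ x (by fun_prop) hr.continuousOn]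
    refine cfc_congr fun t _ => ?_
    simp [mul_inv_cancel₀ (hpos t).ne']
  · rw [← cfc_mul _ _ x hg.continuousOn hr.continuousOn, ← cfc_smul (2 : ℝ) _ x (by fun_prop)]
    conv_lhs => rw [← cfc_id ℝ x]
    refine cfc_congr fun t ht => ?_
    have h1 : |t| ≤ 1 := by
      have := spectrum.norm_le_norm_of_mem ht
      exact this.trans hx1
    have h2 := kaplansky_scalar h1
    change t = 2 * (g t * (1 + g t * g t)⁻¹)
    rw [← mul_assoc, ← div_eq_mul_inv, eq_div_iff (hpos t).ne', ← sq]
    exact h2.symm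

/-- The element `x = 2y / (1 + y²)` of a possibly non-unital C⋆-algebra, characterized by
`x (1 + y²) = 2y`. -/
theorem exists_contraction {B : Type*} [NonUnitalCStarAlgebra B] {y : B} (hy : IsSelfAdjoint y) :
    ∃ x : B, ‖x‖ ≤ 1 ∧ ‖x * y‖ ≤ 2 ∧ x + x * y * y = (2 : ℝ) • y := by
  let g : ℝ → ℝ := fun s => 2 * s / (1 + s ^ 2)
  have hpos : ∀ s : ℝ, 0 < 1 + s ^ 2 := fun s => by positivity
  have hg : Continuous g := Continuous.div (by fun_prop) (by fun_prop) fun s => (hpos s).ne'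
  have hg0 : g 0 = 0 := by simp [g]
  have hid : cfcₙ (fun s : ℝ => s) y = y := cfcₙ_id' ℝ y
  have hmul : cfcₙ g y * y = cfcₙ (fun s => g s * s) y := by
    conv_lhs => rw [← hid]
    rw [hid, cfcₙ_mul g (fun s => s) y hg.continuousOn hg0 (by fun_prop) rfl, hid]
  refine ⟨cfcₙ g y, norm_cfcₙ_le fun s _ => ?_, ?_, ?_⟩
  · rw [Real.norm_eq_abs, abs_le]
    constructor
    · rw [le_div_iff₀ (hpos s)]; nlinarith [sq_nonneg (s + 1)]
    · rw [div_le_iff₀ (hpos s)]; nlinarith [sq_nonneg (s - 1)]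
  · rw [hmul]
    refine norm_cfcₙ_le fun s _ => ?_
    have : g s * s = 2 * s ^ 2 / (1 + s ^ 2) := by simp only [g]; ring
    rw [this, Real.norm_eq_abs, abs_of_nonneg (by positivity), div_le_iff₀ (hpos s)]
    nlinarith
  · have h2 : cfcₙ g y * y * y = cfcₙ (fun s => g s * s * s) y := by
      rw [hmul]
      nth_rewrite 2 [← hid]
      rw [← cfcₙ_mul (fun s => g s * s) (fun s => s) y (by fun_prop) (by simp) (by fun_prop) rfl]
    rw [h2, ← cfcₙ_add g (fun s => g s * s * s) (a := y) hg.continuousOn hg0 (by fun_prop) (by simp)]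
    conv_rhs => rw [← hid]
    rw [← cfcₙ_smul (2 : ℝ) (fun s : ℝ => s) y (by fun_prop) rfl]
    refine cfcₙ_congr fun s _ => ?_
    have := (hpos s).ne'
    simp only [g, smul_eq_mul]
    field_simp

/-- Kaplansky density for self-adjoint contractions: if `x = 2y / (1 + y²)` and `y'` approximates `y`
strongly, then `2y' / (1 + y'²)` approximates `x` strongly. -/
theorem exists_contraction_approx {A : NonUnitalStarSubalgebra ℂ M.toStarSubalgebra}
    (hclosed : IsClosed (A : Set M.toStarSubalgebra))
    (hdense : @Dense M.toStarSubalgebra (weakStar M) (A : Set M.toStarSubalgebra))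
    {x : M.toStarSubalgebra} (hx : IsSelfAdjoint x) (hx1 : ‖x‖ ≤ 1) {ι : Type*} [Fintype ι]
    (v : ι → H) {ε : ℝ} (hε : 0 < ε) :
    ∃ x' ∈ A, ‖x'‖ ≤ 1 ∧ ∀ j, ‖(x' : H →L[ℂ] H) (v j) - (x : H →L[ℂ] H) (v j)‖ < ε := by
  have := isClosed_vonNeumann M
  have := hclosed
  obtain ⟨y, r, hy, hyr, hxy⟩ := exists_two_mul_eq hx hx1
  let ζ : ι → H := fun j => (r : H →L[ℂ] H) (v j)
  obtain ⟨y', hy'A, hy', happ⟩ := exists_selfAdjoint_approx hdense hy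
    (Sum.elim ζ fun j => (y : H →L[ℂ] H) (ζ j)) (ε := ε / 5) (by positivity)
  obtain ⟨x', h1, h2, h3⟩ := exists_contraction (B := A) (y := ⟨y', hy'A⟩) (Subtype.ext hy')
  refine ⟨x', x'.2, h1, fun j => ?_⟩
  have e1 : v j = ζ j + (y : H →L[ℂ] H) ((y : H →L[ℂ] H) (ζ j)) := by
    have := congrArg (fun b : M.toStarSubalgebra => (b : H →L[ℂ] H) (v j)) hyr
    simpa [add_mul] using this.symm
  have e2 : (x : H →L[ℂ] H) (v j) = (2 : ℝ) • (y : H →L[ℂ] H) (ζ j) := by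
    rw [hxy]; rfl
  have e3 : (x'.1 : H →L[ℂ] H) (ζ j) +
      (x'.1 : H →L[ℂ] H) ((y' : H →L[ℂ] H) ((y' : H →L[ℂ] H) (ζ j))) =
      (2 : ℝ) • (y' : H →L[ℂ] H) (ζ j) :=
    congrArg (fun b : A => (b.1 : H →L[ℂ] H) (ζ j)) h3
  have a1 := happ (Sum.inl j)
  have a2 := happ (Sum.inr j)
  simp only [Sum.elim_inl, Sum.elim_inr] at a1 a2
  have n1 : ‖(x'.1 : H →L[ℂ] H)‖ ≤ 1 := h1
  have n2 : ‖(x'.1 : H →L[ℂ] H) * (y' : H →L[ℂ] H)‖ ≤ 2 := h2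
  -- every term on the right contains `y' - y`, applied to `ζ j` or to `y (ζ j)`
  have e4 : (x'.1 : H →L[ℂ] H) (v j) - (x : H →L[ℂ] H) (v j) =
      (2 : ℝ) • ((y' : H →L[ℂ] H) (ζ j) - (y : H →L[ℂ] H) (ζ j)) -
      (x'.1 : H →L[ℂ] H) ((y' : H →L[ℂ] H) ((y : H →L[ℂ] H) (ζ j)) -
        (y : H →L[ℂ] H) ((y : H →L[ℂ] H) (ζ j))) -
      ((x'.1 : H →L[ℂ] H) * (y' : H →L[ℂ] H)) ((y' : H →L[ℂ] H) (ζ j) -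
        (y : H →L[ℂ] H) (ζ j)) := by
    rw [e2, smul_sub, ← e3]
    nth_rewrite 1 [e1]
    simp only [map_add, map_sub, mul_apply_eq_comp]
    abel
  rw [e4]
  refine (norm_sub_le _ _).trans_lt ?_
  have b1 := norm_sub_le ((2 : ℝ) • ((y' : H →L[ℂ] H) (ζ j) - (y : H →L[ℂ] H) (ζ j)))
    ((x'.1 : H →L[ℂ] H) ((y' : H →L[ℂ] H) ((y : H →L[ℂ] H) (ζ j)) -
        (y : H →L[ℂ] H) ((y : H →L[ℂ] H) (ζ j))))
  have b2 := ContinuousLinearMap.le_of_opNorm_le _ n1 ((y' : H →L[ℂ] H) ((y : H →L[ℂ] H) (ζ j)) -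
        (y : H →L[ℂ] H) ((y : H →L[ℂ] H) (ζ j)))
  have b3 := ContinuousLinearMap.le_of_opNorm_le _ n2 ((y' : H →L[ℂ] H) (ζ j) -
        (y : H →L[ℂ] H) (ζ j))
  rw [norm_smul, Real.norm_two] at b1
  linarith

theorem isClosed_norm_le_norm_restrict {E : Type*} [NormedAddCommGroup E] [NormedSpace ℂ E]
    (x : E) (p : Submodule ℂ E) :
    IsClosed {σ : StrongDual ℂ E | ‖σ x‖ ≤ ‖σ.comp p.subtypeL‖} :=
  isClosed_le (f := fun σ : StrongDual ℂ E => ‖σ x‖) (by fun_prop)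
    ((continuous_norm (E := StrongDual ℂ p)).comp
      (ContinuousLinearMap.precomp ℂ p.subtypeL).continuous)

/-- A normal functional is bounded on self-adjoint elements by the norm of its restriction to a
weak-star-dense C⋆-subalgebra. -/
theorem norm_apply_le_norm_restrict {A : NonUnitalStarSubalgebra ℂ M.toStarSubalgebra}
    (hclosed : IsClosed (A : Set M.toStarSubalgebra))
    (hdense : @Dense M.toStarSubalgebra (weakStar M) (A : Set M.toStarSubalgebra))
    (ω : predual M) {x : M.toStarSubalgebra} (hx : IsSelfAdjoint x) (hx1 : ‖x‖ ≤ 1) :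
    ‖(ω : StrongDual ℂ M.toStarSubalgebra) x‖ ≤ ‖iota A ω‖ := by
  have hcl : IsClosed {σ : StrongDual ℂ M.toStarSubalgebra |
      ‖σ x‖ ≤ ‖σ.comp (space A).subtypeL‖} := by
    exact isClosed_norm_le_norm_restrict x (space A)
  refine closure_minimal ?_ hcl ω.2
  intro σ hσ
  -- the strong neighbourhoods of `x`, traced on the unit ball of `A`
  let l : Filter M.toStarSubalgebra :=
    comap (fun b (η : H) => (b : H →L[ℂ] H) η) (𝓝 fun η => (x : H →L[ℂ] H) η) ⊓
      𝓟 {b | b ∈ A ∧ ‖b‖ ≤ 1}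
  have hl : l.NeBot := by
    refine inf_principal_neBot_iff.2 fun U hU => ?_
    obtain ⟨V, hV, hVU⟩ := hU
    rw [nhds_pi, Filter.mem_pi'] at hV
    obtain ⟨s, t, ht, hst⟩ := hV
    have hev : ∀ᶠ ε in 𝓝[>] (0 : ℝ), ∀ η ∈ s, ball ((x : H →L[ℂ] H) η) ε ⊆ t η := by
      rw [eventually_all_finset]
      intro η _
      obtain ⟨δ, hδ, hball⟩ := Metric.mem_nhds_iff.1 (ht η)
      filter_upwards [Ioo_mem_nhdsGT hδ] with ε hε
      exact (ball_subset_ball hε.2.le).trans hball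
    obtain ⟨ε, hεs, hε⟩ := (hev.and self_mem_nhdsWithin).exists
    obtain ⟨x', hx'A, hx'1, happ⟩ := exists_contraction_approx hclosed hdense hx hx1
      (fun η : s => (η : H)) hε
    refine ⟨x', hVU (hst fun η hη => hεs η hη ?_), hx'A, hx'1⟩
    rw [mem_ball, dist_eq_norm]
    exact happ ⟨η, hη⟩
  have htend : Tendsto (fun b => σ b) l (𝓝 (σ x)) := by
    induction hσ using Submodule.span_induction with
    | mem σ h =>
      obtain ⟨⟨ξ, η⟩, rfl⟩ := h
      have h1 : Tendsto (fun b : M.toStarSubalgebra => (b : H →L[ℂ] H) η) l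
          (𝓝 ((x : H →L[ℂ] H) η)) :=
        (tendsto_pi_nhds.1 (tendsto_comap (f := fun (b : M.toStarSubalgebra) (η : H) =>
          (b : H →L[ℂ] H) η)) η).mono_left inf_le_left
      exact tendsto_const_nhds.inner h1
    | zero => exact tendsto_const_nhds
    | add σ σ' _ _ h h' => exact h.add h'
    | smul c σ _ h => exact h.const_smul c
  refine le_of_tendsto htend.norm ?_
  filter_upwards [mem_inf_of_right (mem_principal_self _)] with b hb
  refine ((σ.comp (space A).subtypeL).le_opNorm ⟨b, hb.1⟩).trans ?_
  exact mul_le_of_le_one_right (norm_nonneg _) hb.2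

/-- Restriction of normal functionals to a weak-star-dense C⋆-subalgebra is bounded below. -/
theorem norm_le_two_mul_norm_iota {A : NonUnitalStarSubalgebra ℂ M.toStarSubalgebra}
    (hclosed : IsClosed (A : Set M.toStarSubalgebra))
    (hdense : @Dense M.toStarSubalgebra (weakStar M) (A : Set M.toStarSubalgebra))
    (ω : predual M) : ‖ω‖ ≤ 2 * ‖iota A ω‖ := by
  have hsa : ∀ x : M.toStarSubalgebra, IsSelfAdjoint x →
      ‖(ω : StrongDual ℂ M.toStarSubalgebra) x‖ ≤ ‖iota A ω‖ * ‖x‖ := by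
    intro x hx
    rcases eq_or_ne x 0 with rfl | hx0
    · simp
    have hn : 0 < ‖x‖ := norm_pos_iff.2 hx0
    have h1 := norm_apply_le_norm_restrict hclosed hdense ω
      (x := ((‖x‖⁻¹ : ℝ) : ℂ) • x) (by
        rw [IsSelfAdjoint, star_smul, hx.star_eq]; simp) (by
        rw [norm_smul, norm_real, norm_inv, norm_norm, inv_mul_cancel₀ hn.ne'])
    rw [map_smul, norm_smul, norm_real, norm_inv, norm_norm, inv_mul_le_iff₀ hn] at h1
    linarith
  refine ContinuousLinearMap.opNorm_le_bound _ (by positivity) fun x => ?_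
  -- split `x` into its self-adjoint real and imaginary parts
  have hstar : ‖star x‖ = ‖x‖ := norm_star (x : H →L[ℂ] H)
  have h1 := hsa ((1 / 2 : ℂ) • (x + star x)) (by
    rw [IsSelfAdjoint, star_smul, star_add, star_star, add_comm]; simp)
  have h2 := hsa ((I / 2 : ℂ) • (x - star x)) (by
    rw [IsSelfAdjoint, star_smul, star_sub, star_star, ← neg_sub x, smul_neg, ← neg_smul]
    simp [neg_div])
  have h3 : ‖(1 / 2 : ℂ) • (x + star x)‖ ≤ ‖x‖ := by
    rw [norm_smul]
    have := norm_add_le x (star x)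
    have hn : ‖(1 / 2 : ℂ)‖ = 1 / 2 := by simp
    rw [hn]
    linarith
  have h4 : ‖(I / 2 : ℂ) • (x - star x)‖ ≤ ‖x‖ := by
    rw [norm_smul]
    have := norm_sub_le x (star x)
    have hn : ‖(I / 2 : ℂ)‖ = 1 / 2 := by simp
    rw [hn]
    linarith
  have h5 := mul_le_mul_of_nonneg_left h3 (norm_nonneg (iota A ω))
  have h6 := mul_le_mul_of_nonneg_left h4 (norm_nonneg (iota A ω))
  have h7 : (ω : StrongDual ℂ M.toStarSubalgebra) x =
      (ω : StrongDual ℂ M.toStarSubalgebra) ((1 / 2 : ℂ) • (x + star x)) -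
      I * (ω : StrongDual ℂ M.toStarSubalgebra) ((I / 2 : ℂ) • (x - star x)) := by
    simp only [map_smul, map_add, map_sub, smul_eq_mul]
    linear_combination (1 / 2 * ((ω : StrongDual ℂ M.toStarSubalgebra) x -
      (ω : StrongDual ℂ M.toStarSubalgebra) (star x))) * I_mul_I
  change ‖(ω : StrongDual ℂ M.toStarSubalgebra) x‖ ≤ _
  rw [h7]
  refine (norm_sub_le _ _).trans ?_
  rw [norm_mul, norm_I, one_mul]
  linarith

end Kaplansky

/-! ### Transfer to the strips `S(z)` -/

section Transfer

theorem mul_mem_strip {z : ℂ} (hz : z.im ≠ 0) {w : ℂ} :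
    (z.im : ℂ) * w ∈ strip z ↔ w ∈ im ⁻¹' Set.Icc (0 : ℝ) 1 := by
  simp only [strip, hz, if_false, Set.mem_ofPred_eq, im_ofReal_mul, mul_div_cancel_left₀ _ hz]
  rfl

theorem interior_strip {z : ℂ} (hz : z.im ≠ 0) :
    interior (strip z) = {w | 0 < w.im / z.im ∧ w.im / z.im < 1} := by
  have h1 : strip z = im ⁻¹' ((Homeomorph.mulRight₀ z.im⁻¹ (inv_ne_zero hz)) ⁻¹' Set.Icc (0 : ℝ) 1) := by
    ext w
    simp only [strip, hz, if_false, Set.mem_ofPred_eq, div_eq_mul_inv]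
    rfl
  rw [h1, interior_preimage_im, ← Homeomorph.preimage_interior, interior_Icc]
  simp only [div_eq_mul_inv]
  rfl

theorem mul_mem_interior_strip {z : ℂ} (hz : z.im ≠ 0) {w : ℂ} :
    (z.im : ℂ) * w ∈ interior (strip z) ↔ w ∈ im ⁻¹' Set.Ioo (0 : ℝ) 1 := by
  simp only [interior_strip hz, Set.mem_ofPred_eq, im_ofReal_mul, mul_div_cancel_left₀ _ hz]
  rfl

theorem interior_strip_of_im_eq_zero {z : ℂ} (hz : z.im = 0) : interior (strip z) = ∅ := by
  have h1 : strip z = im ⁻¹' {0} := by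
    ext w
    simp only [strip, hz, if_true, Set.mem_ofPred_eq]
    rfl
  rw [h1, interior_preimage_im, interior_singleton, Set.preimage_empty]

theorem ofReal_mem_strip (z : ℂ) (t : ℝ) : (t : ℂ) ∈ strip z := by
  by_cases hz : z.im = 0 <;> simp [strip, hz]

theorem self_mem_strip (z : ℂ) : z ∈ strip z := by
  by_cases hz : z.im = 0 <;> simp [strip, hz]

section Rescale

theorem continuousOn_rescale {E : Type*} [TopologicalSpace E] {z : ℂ} {f : ℂ → E} (hz : z.im ≠ 0) (hf : ContinuousOn f (strip z)) :
    ContinuousOn (fun w => f (z.im * w)) (im ⁻¹' Set.Icc (0 : ℝ) 1) :=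
  hf.comp (by fun_prop) fun _ hw => (mul_mem_strip hz).2 hw

variable {E : Type*} [NormedAddCommGroup E] [NormedSpace ℂ E] {z : ℂ} {f : ℂ → E}

theorem differentiableOn_rescale (hz : z.im ≠ 0)
    (hf : DifferentiableOn ℂ f (interior (strip z))) :
    DifferentiableOn ℂ (fun w => f (z.im * w)) (im ⁻¹' Set.Ioo (0 : ℝ) 1) :=
  hf.comp (by fun_prop) fun _ hw => (mul_mem_interior_strip hz).2 hw

theorem normRegular_of_rescale (hz : z.im ≠ 0)
    (hc : ContinuousOn (fun w => f (z.im * w)) (im ⁻¹' Set.Icc (0 : ℝ) 1))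
    (hd : DifferentiableOn ℂ (fun w => f (z.im * w)) (im ⁻¹' Set.Ioo (0 : ℝ) 1)) :
    NormRegular z f := by
  have hy : (z.im : ℂ) ≠ 0 := ofReal_ne_zero.2 hz
  have he : f = (fun w => f (z.im * w)) ∘ fun w => w / z.im := by
    ext w
    simp [mul_div_cancel₀ w hy]
  rw [he]
  refine ⟨hc.comp (by fun_prop) fun w hw => ?_,
    hd.comp (by fun_prop) fun w hw => ?_⟩
  · rwa [← mul_mem_strip hz, mul_div_cancel₀ w hy]
  · rwa [← mul_mem_interior_strip hz, mul_div_cancel₀ w hy]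

end Rescale

/-- A scalar function regular on `S(z)` is determined by its values on the real line. -/
theorem eq_of_eq_on_real {z : ℂ} {f g : ℂ → ℂ} (hf : NormRegular z f) (hg : NormRegular z g)
    (h : ∀ t : ℝ, f t = g t) {w : ℂ} (hw : w ∈ strip z) : f w = g w := by
  by_cases hz : z.im = 0
  · have : w.im = 0 := by simpa [strip, hz] using hw
    have hw' : w = (w.re : ℂ) := Complex.ext rfl (by simp [this])
    rw [hw', h]
  have hy : (z.im : ℂ) ≠ 0 := ofReal_ne_zero.2 hz
  have h1 := eq_zero_of_eq_zero_on_real (h := fun v => f (z.im * v) - g (z.im * v))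
    ((continuousOn_rescale hz hf.1).sub (continuousOn_rescale hz hg.1))
    ((differentiableOn_rescale hz hf.2).sub (differentiableOn_rescale hz hg.2))
    (fun t => by
      have := h (z.im * t)
      push_cast at this
      simp [this]) (w / z.im) (by
        rwa [← mul_mem_strip hz, mul_div_cancel₀ w hy])
  simp only [mul_div_cancel₀ w hy] at h1
  exact sub_eq_zero.1 h1

theorem exists_dual_of_notMem {E : Type*} [NormedAddCommGroup E] [NormedSpace ℂ E]
    {Y : Submodule ℂ E} (hY : IsClosed (Y : Set E)) {x : E} (hx : x ∉ Y) :
    ∃ ψ : StrongDual ℂ E, (∀ y ∈ Y, ψ y = 0) ∧ ψ x ≠ 0 := by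
  have := hY
  have h1 : Y.mkQ x ≠ 0 := by rwa [Ne, Submodule.mkQ_apply, Submodule.Quotient.mk_eq_zero]
  obtain ⟨φ, hφ⟩ := SeparatingDual.exists_ne_zero (R := ℂ) h1
  refine ⟨φ.comp Y.mkQL, fun y hy => ?_, hφ⟩
  change φ (Y.mkQ y) = 0
  rw [Submodule.mkQ_apply, (Submodule.Quotient.mk_eq_zero Y).2 hy, map_zero]

/-- Values of a norm-regular function stay in a closed subspace containing its boundary values on
the real line. -/
theorem mem_of_real_mem {E : Type*} [NormedAddCommGroup E] [NormedSpace ℂ E] {z : ℂ} {f : ℂ → E}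
    (hf : NormRegular z f) {Y : Submodule ℂ E} (hY : IsClosed (Y : Set E))
    (h : ∀ t : ℝ, f t ∈ Y) {w : ℂ} (hw : w ∈ strip z) : f w ∈ Y := by
  by_contra hcon
  obtain ⟨ψ, hψ, hne⟩ := exists_dual_of_notMem hY hcon
  exact hne (eq_of_eq_on_real (f := fun v => ψ (f v)) (g := fun _ => 0)
    ⟨ψ.continuous.comp_continuousOn hf.1, ψ.differentiable.comp_differentiableOn hf.2⟩
    ⟨continuousOn_const, differentiableOn_const _⟩ (fun t => hψ _ (h t)) hw)

/-- A norm-regular function whose boundary values lie in the range of an embedding `J` of Banach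
spaces lifts to a norm-regular function along `J`. -/
theorem exists_lift_of_real {X E : Type*} [NormedAddCommGroup X] [NormedSpace ℂ X]
    [CompleteSpace X] [NormedAddCommGroup E] [NormedSpace ℂ E] {J : X →L[ℂ] E} {K : NNReal}
    (hJ : AntilipschitzWith K J) {z : ℂ} {f : ℂ → E} (hf : NormRegular z f) {g₀ : ℝ → X}
    (h : ∀ t : ℝ, f t = J (g₀ t)) :
    ∃ g : ℂ → X, NormRegular z g ∧ (∀ t : ℝ, g t = g₀ t) ∧ ∀ w ∈ strip z, J (g w) = f w := by
  classical
  have hemb := hJ.isClosedEmbedding J.uniformContinuous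
  have hY : IsClosed (J.range : Set E) := hemb.isClosed_range
  have hmem : ∀ w ∈ strip z, f w ∈ J.range := fun w hw =>
    mem_of_real_mem hf hY (fun t => ⟨g₀ t, (h t).symm⟩) hw
  choose! g hg using fun w (hw : w ∈ strip z) => hmem w hw
  refine ⟨g, ⟨?_, ?_⟩, fun t => hemb.injective ?_, hg⟩
  · rw [hemb.isInducing.continuousOn_iff]
    exact hf.1.congr hg
  · intro w hw
    have hw' := isOpen_interior.mem_nhds hw
    have hd := (hf.2.differentiableAt hw').hasDerivAt
    rw [hasDerivAt_iff_tendsto_slope] at hd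
    have hev : ∀ᶠ v in 𝓝[≠] w, slope f w v = J (slope g w v) := by
      filter_upwards [nhdsWithin_le_nhds hw'] with v hv
      rw [slope_def_module, slope_def_module, map_smul, map_sub]
      exact congrArg₂ _ rfl (congrArg₂ _ (hg v (interior_subset hv)).symm
        (hg w (interior_subset hw)).symm)
    have hd' := hd.congr' hev
    -- the range of `J` is closed, so the derivative of `f` lies in it
    obtain ⟨x, hx⟩ := hY.mem_of_tendsto hd' (Eventually.of_forall fun v => ⟨_, rfl⟩)
    have h3 : Tendsto (slope g w) (𝓝[≠] w) (𝓝 x) := by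
      rw [hemb.isInducing.tendsto_nhds_iff]
      have hx' : J x = deriv f w := hx
      rwa [hx']
    exact (hasDerivAt_iff_tendsto_slope.2 h3).differentiableAt.differentiableWithinAt
  · rw [← h t]
    exact hg _ (ofReal_mem_strip z t)

/-- The lifting lemma for the restriction of functionals in a closed subspace `P` to a subspace `q`,
in case this restriction is bounded below. -/
theorem exists_lift_of_restrict {E : Type*} [NormedAddCommGroup E] [NormedSpace ℂ E]
    (P : Submodule ℂ (StrongDual ℂ E)) (q : Submodule ℂ E) (hP : IsClosed (P : Set (StrongDual ℂ E)))
    (hb : ∀ ω : P, ‖ω‖ ≤ 2 * ‖(ω : StrongDual ℂ E).comp q.subtypeL‖)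
    {z : ℂ} {f : ℂ → StrongDual ℂ q} (hf : NormRegular z f) (g₀ : ℝ → P)
    (h : ∀ t : ℝ, f t = (g₀ t : StrongDual ℂ E).comp q.subtypeL) :
    ∃ g : ℂ → P, NormRegular z g ∧ (∀ t : ℝ, g t = g₀ t) ∧
      ∀ w ∈ strip z, (g w : StrongDual ℂ E).comp q.subtypeL = f w := by
  have : CompleteSpace P := hP.completeSpace_coe
  let J : P →L[ℂ] StrongDual ℂ q := (ContinuousLinearMap.precomp ℂ q.subtypeL).comp P.subtypeL
  have hb' : ∀ ω, ‖ω‖ ≤ ((2 : NNReal) : ℝ) * ‖J ω‖ := fun ω =>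
    (hb ω).trans_eq (by rw [NNReal.coe_ofNat]; rfl)
  have hJ : AntilipschitzWith 2 J :=
    AddMonoidHomClass.antilipschitz_of_bound (E := P) (F := StrongDual ℂ q) (K := 2) J hb'
  exact exists_lift_of_real (X := P) (E := StrongDual ℂ q) (J := J) hJ hf (g₀ := g₀) h

/-- The analytic extension of an orbit of the adjoint group is equivariant. -/
theorem dual_equivariant {E : Type*} [NormedAddCommGroup E] [NormedSpace ℂ E]
    {β : IsometryGroup E} {z : ℂ} {μ : StrongDual ℂ E} {f : ℂ → StrongDual ℂ E}
    (hz : z.im ≠ 0) (hf : WeakStarRegular (dualPairing E) z f)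
    (h : ∀ t : ℝ, f t = β.dual.toFun t μ) (a : E) (t : ℝ) {w : ℂ} (hw : w ∈ strip z) :
    f (w + t) a = f w (β.toFun t a) := by
  have htr : ∀ w : ℂ, w ∈ strip z → w + t ∈ strip z := fun w hw => by
    simpa [strip, hz] using hw
  have htr' : ∀ w : ℂ, w ∈ interior (strip z) → w + t ∈ interior (strip z) := fun w hw => by
    simpa [interior_strip hz] using hw
  refine eq_of_eq_on_real (f := fun w => f (w + t) a) (g := fun w => f w (β.toFun t a))
    ⟨(hf a).1.comp (by fun_prop) htr, (hf a).2.comp (by fun_prop) htr'⟩ (hf _) (fun s => ?_) hw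
  have h1 := h (s + t)
  push_cast at h1
  rw [h1, h s]
  change μ (β.toFun (s + t) a) = μ (β.toFun s (β.toFun t a))
  rw [β.map_add]
  rfl

variable {H : Type u} [NormedAddCommGroup H] [InnerProductSpace ℂ H] [CompleteSpace H]
  {M : VonNeumannAlgebra H} {A : NonUnitalStarSubalgebra ℂ M.toStarSubalgebra}

theorem normRegular_of_weakStarRegular_space (hclosed : IsClosed (A : Set M.toStarSubalgebra))
    {G : ℂ → StrongDual ℂ (space A)}
    (hc : ∀ a, ContinuousOn (fun w => G w a) (im ⁻¹' Set.Icc (0 : ℝ) 1))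
    (hd : ∀ a, DifferentiableOn ℂ (fun w => G w a) (im ⁻¹' Set.Ioo (0 : ℝ) 1))
    (hn : ∀ w ∈ im ⁻¹' Set.Icc (0 : ℝ) 1, ∀ t : ℝ, ‖G (w + t)‖ ≤ ‖G w‖)
    (ht : ∀ w ∈ im ⁻¹' Set.Icc (0 : ℝ) 1, ∀ w' ∈ im ⁻¹' Set.Icc (0 : ℝ) 1, ∀ t : ℝ,
      ‖G (w + t) - G (w' + t)‖ ≤ ‖G w - G w'‖) :
    ContinuousOn G (im ⁻¹' Set.Icc (0 : ℝ) 1) ∧ DifferentiableOn ℂ G (im ⁻¹' Set.Ioo (0 : ℝ) 1) :=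
  have := isClosed_vonNeumann M
  normRegular_of_weakStarRegular (A := A) (G := G) hc hd hn ht

/-- On the dual of a C⋆-algebra the weak-star analytic extension of an orbit is automatically
norm-regular. -/
theorem normRegular_dual (α : AutGroup M) (hA : α.RestrictsTo A) {z : ℂ} (hz : z.im ≠ 0)
    {μ : StrongDual ℂ (space A)} {f : ℂ → StrongDual ℂ (space A)}
    (hf : WeakStarRegular (dualPairing (space A)) z f)
    (h : ∀ t : ℝ, f t = (α.onSub hA).dual.toFun t μ) : NormRegular z f := by
  have heq := dual_equivariant hz hf h
  have hmul : ∀ (w : ℂ) (t : ℝ), f (z.im * (w + t)) = f (z.im * w + (z.im * t : ℝ)) :=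
    fun w t => by push_cast; rw [mul_add]
  have hreg := normRegular_of_weakStarRegular_space hA.isClosed (G := fun w => f (z.im * w))
    (fun a => continuousOn_rescale hz (hf a).1) (fun a => differentiableOn_rescale hz (hf a).2)
    (fun w hw t => by
      refine ContinuousLinearMap.opNorm_le_bound _ (ContinuousLinearMap.opNorm_nonneg _) fun a => ?_
      rw [hmul, heq a _ ((mul_mem_strip hz).2 hw)]
      exact (ContinuousLinearMap.le_opNorm _ _).trans
        (mul_le_mul_of_nonneg_left ((α.onSub hA).norm_le _ a) (ContinuousLinearMap.opNorm_nonneg _)))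
    (fun w hw w' hw' t => by
      refine ContinuousLinearMap.opNorm_le_bound _ (ContinuousLinearMap.opNorm_nonneg _) fun a => ?_
      rw [hmul, hmul, sub_apply, heq a _ ((mul_mem_strip hz).2 hw),
        heq a _ ((mul_mem_strip hz).2 hw'), ← sub_apply]
      exact (ContinuousLinearMap.le_opNorm _ _).trans
        (mul_le_mul_of_nonneg_left ((α.onSub hA).norm_le _ a) (ContinuousLinearMap.opNorm_nonneg _)))
  exact normRegular_of_rescale hz hreg.1 hreg.2

theorem exists_predualGraph_of_im_ne_zero (α : AutGroup M) (hA : α.RestrictsTo A) {z : ℂ}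
    (hz : z.im ≠ 0) {ω : predual M} {μ : StrongDual ℂ (space A)}
    (h : (iota A ω, μ) ∈ α.dualGraph hA z) :
    ∃ τ : predual M, (ω, τ) ∈ α.predualGraph z ∧ iota A τ = μ := by
  obtain ⟨f, hf, hreal, hfz⟩ := h
  obtain ⟨g, hg, hgreal, hgf⟩ := exists_lift_of_restrict (predual M) (space A)
    (Submodule.isClosed_topologicalClosure _)
    (norm_le_two_mul_norm_iota hA.isClosed hA.dense)
    (normRegular_dual α hA hz hf hreal) (fun t => α.onPredual.toFun t ω) hreal
  exact ⟨g z, ⟨g, hg, hgreal, rfl⟩, (hgf z (self_mem_strip z)).trans hfz⟩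

end Transfer

/-! ### Norm continuity of the preadjoint group -/

section RealTranslation

/-- A translation-contractive weak-star-continuous curve in a dual space with separable range is
norm-continuous: by Baire it is almost constant on some interval. -/
theorem continuous_of_isSeparable_range {E : Type*} [NormedAddCommGroup E] [NormedSpace ℂ E]
    {c : ℝ → StrongDual ℂ E} (hc : ∀ x, Continuous fun t => c t x)
    (hsep : TopologicalSpace.IsSeparable (Set.range c))
    (htr : ∀ s s' t : ℝ, ‖c (s + t) - c (s' + t)‖ ≤ ‖c s - c s'‖) : Continuous c := by
  obtain ⟨S, hS, hcl⟩ := hsep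
  have := hS.to_subtype
  rw [Metric.continuous_iff]
  intro u ε hε
  have hclosed : ∀ s : S, IsClosed {t : ℝ | ‖c t - s‖ ≤ ε / 3} := by
    intro s
    have h1 : {t : ℝ | ‖c t - s‖ ≤ ε / 3} = ⋂ x : E, {t : ℝ | ‖c t x - s.1 x‖ ≤ ε / 3 * ‖x‖} := by
      ext t
      rw [Set.mem_iInter]
      exact ContinuousLinearMap.opNorm_le_iff (by positivity)
    rw [h1]
    exact isClosed_iInter fun x => isClosed_le ((hc x).sub continuous_const).norm continuous_const
  have hcover : ⋃ s : S, {t : ℝ | ‖c t - s‖ ≤ ε / 3} = Set.univ := by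
    refine Set.eq_univ_of_forall fun t => ?_
    obtain ⟨s, hs, hd⟩ := Metric.mem_closure_iff.1 (hcl ⟨t, rfl⟩) (ε / 3) (by positivity)
    rw [dist_eq_norm] at hd
    exact Set.mem_iUnion.2 ⟨⟨s, hs⟩, hd.le⟩
  obtain ⟨s, t₀, ht₀⟩ := nonempty_interior_of_iUnion_of_closed hclosed hcover
  obtain ⟨δ, hδ, hball⟩ := Metric.mem_nhds_iff.1 (mem_interior_iff_mem_nhds.1 ht₀)
  refine ⟨δ, hδ, fun v hv => ?_⟩
  have h1 := htr (v - u + t₀) t₀ (u - t₀)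
  have e1 : v - u + t₀ + (u - t₀) = v := by ring
  have e2 : t₀ + (u - t₀) = u := by ring
  rw [e1, e2] at h1
  have h2 : ‖c (v - u + t₀) - s‖ ≤ ε / 3 := hball (by
    rw [Real.dist_eq] at hv
    simpa [Real.dist_eq] using hv)
  have h3 : ‖c t₀ - s‖ ≤ ε / 3 := hball (mem_ball_self hδ)
  rw [dist_eq_norm]
  have h4 := norm_sub_le (c (v - u + t₀) - s) (c t₀ - s)
  rw [sub_sub_sub_cancel_right] at h4
  linarith

variable {H : Type u} [NormedAddCommGroup H] [InnerProductSpace ℂ H] [CompleteSpace H]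
  {M : VonNeumannAlgebra H}

/-- Every bounded functional on the predual is the evaluation at an element of `M`: it defines a
bounded sesquilinear form on `H`, whose operator commutes with the commutant of `M`. -/
theorem exists_eval_of_predual (Φ : StrongDual ℂ (StrongDual ℂ M.toStarSubalgebra)) :
    ∃ x : M.toStarSubalgebra, ∀ σ ∈ predual M, Φ σ = σ x := by
  let B : H →L⋆[ℂ] H →L[ℂ] ℂ := LinearMap.mkContinuous₂
    (LinearMap.mk₂'ₛₗ (starRingEnd ℂ) (RingHom.id ℂ) (fun ξ η => Φ (vectorFunctional M ξ η))
      (fun ξ ξ' η => by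
        rw [← map_add]; congr 1; ext x
        simp [vectorFunctional_apply])
      (fun c ξ η => by
        rw [← map_smul]; congr 1; ext x
        simp [vectorFunctional_apply, mul_comm])
      (fun ξ η η' => by
        rw [← map_add]; congr 1; ext x
        simp [vectorFunctional_apply])
      (fun c ξ η => by
        rw [RingHom.id_apply, ← map_smul]; congr 1; ext x
        simp [vectorFunctional_apply])) ‖Φ‖ (fun ξ η => by
      refine (Φ.le_opNorm _).trans ?_
      rw [mul_assoc]
      refine mul_le_mul_of_nonneg_left ?_ (norm_nonneg Φ)
      refine ContinuousLinearMap.opNorm_le_bound _ (by positivity) fun x => ?_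
      rw [vectorFunctional_apply]
      refine (norm_inner_le_norm _ _).trans ?_
      rw [mul_assoc, mul_comm ‖η‖]
      exact mul_le_mul_of_nonneg_left ((x : H →L[ℂ] H).le_opNorm η) (norm_nonneg _))
  let x : H →L[ℂ] H := ContinuousLinearMap.adjoint (InnerProductSpace.continuousLinearMapOfBilin B)
  have hx : ∀ ξ η, ⟪ξ, x η⟫_ℂ = Φ (vectorFunctional M ξ η) := by
    intro ξ η
    rw [ContinuousLinearMap.adjoint_inner_right,
      InnerProductSpace.continuousLinearMapOfBilin_apply]
    rfl
  have hxM : x ∈ M.toStarSubalgebra := by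
    rw [← SetLike.mem_coe, VonNeumannAlgebra.coe_toStarSubalgebra, ← M.centralizer_centralizer]
    intro y hy
    refine ContinuousLinearMap.ext fun η => ext_inner_left ℂ fun ξ => ?_
    change ⟪ξ, y (x η)⟫_ℂ = ⟪ξ, x (y η)⟫_ℂ
    rw [← ContinuousLinearMap.adjoint_inner_left, hx, hx]
    congr 1
    ext m
    rw [vectorFunctional_apply, vectorFunctional_apply, ContinuousLinearMap.adjoint_inner_left]
    exact congrArg (fun T : H →L[ℂ] H => ⟪ξ, T η⟫_ℂ) (hy _ m.2).symm
  refine ⟨⟨x, hxM⟩, fun σ hσ => ?_⟩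
  have hcl : IsClosed {σ : StrongDual ℂ M.toStarSubalgebra | Φ σ = σ ⟨x, hxM⟩} :=
    isClosed_eq Φ.continuous (by fun_prop)
  refine closure_minimal (fun σ hσ => ?_) hcl hσ
  induction hσ using Submodule.span_induction with
  | mem σ h =>
    obtain ⟨⟨ξ, η⟩, rfl⟩ := h
    exact (hx ξ η).symm
  | zero => simp
  | add σ σ' _ _ h h' =>
    simp only [Set.mem_ofPred_eq] at h h'
    simp [h, h']
  | smul c σ _ h =>
    simp only [Set.mem_ofPred_eq] at h
    simp [h]

theorem continuous_orbit_apply (α : AutGroup M) (ω : predual M) (x : M.toStarSubalgebra) :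
    Continuous fun t : ℝ => (ω : StrongDual ℂ M.toStarSubalgebra) (α.toFun t x) := by
  have h1 : @Continuous _ _ (weakStar M) _
      (fun x : M.toStarSubalgebra => fun ω : predual M => predualPairing M x ω) :=
    continuous_induced_dom
  have h2 := @Continuous.comp _ _ _ _ (weakStar M) _ _ _ h1 (α.continuous_orbit x)
  exact (continuous_apply ω).comp h2

/-- The preadjoint group is norm-continuous. The orbit of `ω` lies in the closed span of its
rational part because a functional on the predual is given by an element of `M`. -/
theorem continuous_onPredual (α : AutGroup M) (ω : predual M) :
    Continuous fun t : ℝ => α.onPredual.toFun t ω := by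
  rw [continuous_induced_rng]
  let c : ℝ → StrongDual ℂ M.toStarSubalgebra := fun t => (α.onPredual.toFun t ω).1
  have hc : ∀ x, Continuous fun t => c t x := continuous_orbit_apply α ω
  change Continuous c
  refine continuous_of_isSeparable_range hc ?_ fun s s' t => ?_
  · let Y : Submodule ℂ (StrongDual ℂ M.toStarSubalgebra) :=
      (Submodule.span ℂ (Set.range fun q : ℚ => c q)).topologicalClosure
    have hY : IsClosed (Y : Set (StrongDual ℂ M.toStarSubalgebra)) :=
      Submodule.isClosed_topologicalClosure _
    have hsepY : TopologicalSpace.IsSeparable (Y : Set (StrongDual ℂ M.toStarSubalgebra)) :=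
      ((Set.countable_range _).isSeparable.span (R := ℂ)).closure
    refine hsepY.mono ?_
    rintro _ ⟨t, rfl⟩
    by_contra hcon
    obtain ⟨ψ, hψ, hne⟩ := exists_dual_of_notMem hY hcon
    obtain ⟨x, hx⟩ := exists_eval_of_predual ψ
    have h2 : (fun t => c t x) = fun _ => 0 := by
      refine Continuous.ext_on Rat.denseRange_cast (hc x) continuous_const ?_
      rintro _ ⟨q, rfl⟩
      have h3 : c q ∈ Y := Submodule.le_topologicalClosure _ (Submodule.subset_span ⟨q, rfl⟩)
      exact (hx (c q) (α.onPredual.toFun q ω).2).symm.trans (hψ _ h3)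
    exact hne ((hx (c t) (α.onPredual.toFun t ω).2).trans (congrFun h2 t))
  · refine ContinuousLinearMap.opNorm_le_bound _ (norm_nonneg _) fun x => ?_
    have h1 : ∀ s, c (s + t) x = c s (α.toFun t x) := fun s => by
      change ω.1 (α.toFun (s + t) x) = ω.1 (α.toFun s (α.toFun t x))
      rw [α.map_add]
      rfl
    rw [sub_apply, h1, h1, ← sub_apply]
    exact (ContinuousLinearMap.le_opNorm _ _).trans
      (mul_le_mul_of_nonneg_left (α.norm_le _ x) (norm_nonneg _))

variable {A : NonUnitalStarSubalgebra ℂ M.toStarSubalgebra}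

theorem exists_predualGraph_of_im_eq_zero (α : AutGroup M) (hA : α.RestrictsTo A) {z : ℂ}
    (hz : z.im = 0) {ω : predual M} {μ : StrongDual ℂ (space A)}
    (h : (iota A ω, μ) ∈ α.dualGraph hA z) :
    ∃ τ : predual M, (ω, τ) ∈ α.predualGraph z ∧ iota A τ = μ := by
  obtain ⟨f, -, hreal, hfz⟩ := h
  have hz' : z = (z.re : ℂ) := Complex.ext rfl (by simp [hz])
  refine ⟨α.onPredual.toFun z.re ω, ⟨fun w => α.onPredual.toFun w.re ω, ⟨?_, ?_⟩, fun t => rfl,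
    rfl⟩, ?_⟩
  · exact ((continuous_onPredual α ω).comp continuous_re).continuousOn
  · rw [interior_strip_of_im_eq_zero hz]
    exact differentiableOn_empty
  · rw [hz', hreal] at hfz
    exact hfz

theorem exists_predualGraph (α : AutGroup M) (hA : α.RestrictsTo A) {z : ℂ} {ω : predual M}
    {μ : StrongDual ℂ (space A)} (h : (iota A ω, μ) ∈ α.dualGraph hA z) :
    ∃ τ : predual M, (ω, τ) ∈ α.predualGraph z ∧ iota A τ = μ := by
  by_cases hz : z.im = 0
  · exact exists_predualGraph_of_im_eq_zero α hA hz h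
  · exact exists_predualGraph_of_im_ne_zero α hA hz h

end RealTranslation

/-! ### Automorphism groups implemented by unitaries -/

section Inner

variable {H : Type u} [NormedAddCommGroup H] [InnerProductSpace ℂ H] [CompleteSpace H]
  {M : VonNeumannAlgebra H}

/-- For bounded families, weak-star convergence can be tested on vector functionals. -/
theorem tendsto_of_vectorFunctional {T : Type*} {F : T → M.toStarSubalgebra} {l : Filter T}
    {x : M.toStarSubalgebra} {C : ℝ} (hF : ∀ᶠ t in l, ‖F t‖ ≤ C)
    (h : ∀ ξ η, Tendsto (fun t => vectorFunctional M ξ η (F t)) l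
      (𝓝 (vectorFunctional M ξ η x))) {σ : StrongDual ℂ M.toStarSubalgebra}
    (hσ : σ ∈ predual M) : Tendsto (fun t => σ (F t)) l (𝓝 (σ x)) := by
  have hspan : ∀ σ ∈ Submodule.span ℂ (Set.range fun p : H × H => vectorFunctional M p.1 p.2),
      Tendsto (fun t => σ (F t)) l (𝓝 (σ x)) := by
    intro σ hσ
    induction hσ using Submodule.span_induction with
    | mem σ h' =>
      obtain ⟨⟨ξ, η⟩, rfl⟩ := h'
      exact h ξ η
    | zero => exact tendsto_const_nhds
    | add σ σ' _ _ h h' => exact h.add h'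
    | smul c σ _ h => exact h.const_smul c
  rw [Metric.tendsto_nhds]
  intro ε hε
  let δ := ε / (2 * (|C| + ‖x‖ + 1))
  have hδ : 0 < δ := by positivity
  obtain ⟨σ', hσ', hd⟩ := Metric.mem_closure_iff.1 hσ δ hδ
  rw [dist_eq_norm] at hd
  filter_upwards [hF, (Metric.tendsto_nhds.1 (hspan σ' hσ')) (ε / 2) (by positivity)]
    with t ht1 ht2
  rw [dist_eq_norm] at ht2 ⊢
  have e1 : σ (F t) - σ x = (σ - σ') (F t) - (σ - σ') x + (σ' (F t) - σ' x) := by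
    simp only [sub_apply]; ring
  have b1 := (σ - σ').le_of_opNorm_le hd.le (F t)
  have b2 := (σ - σ').le_of_opNorm_le hd.le x
  have b3 := norm_add_le ((σ - σ') (F t) - (σ - σ') x) (σ' (F t) - σ' x)
  have b4 := norm_sub_le ((σ - σ') (F t)) ((σ - σ') x)
  have b5 : δ * ‖F t‖ ≤ δ * |C| := mul_le_mul_of_nonneg_left (ht1.trans (le_abs_self C)) hδ.le
  have b6 : δ * (|C| + ‖x‖ + 1) = ε / 2 := by
    have : |C| + ‖x‖ + 1 ≠ 0 := by positivity
    simp only [δ]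
    field_simp
  rw [e1]
  linarith

theorem differentiableOn_of_vectorFunctional {F : ℂ → M.toStarSubalgebra} {U : Set ℂ} {C : ℝ}
    (hU : IsOpen U) (hF : ∀ t ∈ U, ‖F t‖ ≤ C)
    (h : ∀ ξ η, DifferentiableOn ℂ (fun t => vectorFunctional M ξ η (F t)) U)
    {σ : StrongDual ℂ M.toStarSubalgebra} (hσ : σ ∈ predual M) :
    DifferentiableOn ℂ (fun t => σ (F t)) U := by
  have hspan : ∀ σ ∈ Submodule.span ℂ (Set.range fun p : H × H => vectorFunctional M p.1 p.2),
      DifferentiableOn ℂ (fun t => σ (F t)) U := by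
    intro σ hσ
    induction hσ using Submodule.span_induction with
    | mem σ h' =>
      obtain ⟨⟨ξ, η⟩, rfl⟩ := h'
      exact h ξ η
    | zero => exact differentiableOn_const _
    | add σ σ' _ _ h h' => exact h.add h'
    | smul c σ _ h => exact h.const_smul c
  obtain ⟨s, hs, hlim⟩ := mem_closure_iff_seq_limit.1 hσ
  refine TendstoLocallyUniformlyOn.differentiableOn (φ := atTop) (F := fun n t => s n (F t))
    (TendstoUniformlyOn.tendstoLocallyUniformlyOn ?_)
    (Eventually.of_forall fun n => hspan _ (hs n)) hU
  rw [Metric.tendstoUniformlyOn_iff]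
  intro ε hε
  filter_upwards [(Metric.tendsto_nhds.1 hlim) (ε / (|C| + 1)) (by positivity)] with n hn t ht
  rw [dist_comm, dist_eq_norm] at hn ⊢
  rw [← norm_neg, neg_sub] at hn
  rw [← sub_apply]
  refine ((s n - σ).le_opNorm _).trans_lt ?_
  rw [lt_div_iff₀ (by positivity)] at hn
  refine lt_of_le_of_lt (mul_le_mul_of_nonneg_left ?_ (norm_nonneg _)) hn
  linarith [hF t ht, le_abs_self C]

/-- A strongly continuous one-parameter group of unitaries in `M`. -/
structure UnitaryGroup (M : VonNeumannAlgebra H) where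
  toFun : ℝ → M.toStarSubalgebra
  map_zero : toFun 0 = 1
  map_add : ∀ s t, toFun (s + t) = toFun s * toFun t
  star_eq : ∀ t, star (toFun t) = toFun (-t)
  norm_le : ∀ t, ‖toFun t‖ ≤ 1
  continuous : ∀ ξ : H, Continuous fun t => (toFun t : H →L[ℂ] H) ξ

theorem norm_mul_mul_le {x y w : M.toStarSubalgebra} (hx : ‖x‖ ≤ 1) (hw : ‖w‖ ≤ 1) :
    ‖x * y * w‖ ≤ ‖y‖ := by
  refine (norm_mul_le _ _).trans ((mul_le_of_le_one_right (norm_nonneg _) hw).trans ?_)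
  exact (norm_mul_le _ _).trans (mul_le_of_le_one_left (norm_nonneg _) hx)

namespace UnitaryGroup

variable (u : UnitaryGroup M)

theorem mul_neg (t : ℝ) : u.toFun (-t) * u.toFun t = 1 := by
  rw [← u.map_add, neg_add_cancel, u.map_zero]

/-- Conjugation by a one-parameter unitary group, as a group of isometries. -/
noncomputable def isometryGroup : IsometryGroup M.toStarSubalgebra where
  toFun t := LinearMap.mkContinuous
    { toFun := fun x => u.toFun t * x * u.toFun (-t)
      map_add' := fun x y => by rw [mul_add, add_mul]
      map_smul' := fun c x => by rw [mul_smul_comm, smul_mul_assoc]; rfl } 1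
    (fun x => by
      rw [one_mul]
      exact norm_mul_mul_le (u.norm_le t) (u.norm_le (-t)))
  map_zero := by
    ext1 x
    change u.toFun 0 * x * u.toFun (-0) = x
    rw [neg_zero, u.map_zero, one_mul, mul_one]
  map_add s t := by
    ext1 x
    change u.toFun (s + t) * x * u.toFun (-(s + t)) =
      u.toFun s * (u.toFun t * x * u.toFun (-t)) * u.toFun (-s)
    rw [neg_add_rev, u.map_add, u.map_add]
    simp only [mul_assoc]
  norm_le t x := norm_mul_mul_le (u.norm_le t) (u.norm_le (-t))

theorem isometryGroup_apply (t : ℝ) (x : M.toStarSubalgebra) :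
    u.isometryGroup.toFun t x = u.toFun t * x * u.toFun (-t) := rfl

theorem vectorFunctional_isometryGroup (ξ η : H) (t : ℝ) (x : M.toStarSubalgebra) :
    vectorFunctional M ξ η (u.isometryGroup.toFun t x) =
      vectorFunctional M ((u.toFun (-t) : H →L[ℂ] H) ξ) ((u.toFun (-t) : H →L[ℂ] H) η) x := by
  have h1 : ContinuousLinearMap.adjoint (u.toFun t : H →L[ℂ] H) = u.toFun (-t) :=
    congrArg Subtype.val (u.star_eq t)
  rw [vectorFunctional_apply, vectorFunctional_apply, ← h1,
    ContinuousLinearMap.adjoint_inner_left, h1]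
  rfl

/-- The automorphism group of `M` implemented by a one-parameter unitary group in `M`. -/
noncomputable def autGroup : AutGroup M where
  toIsometryGroup := u.isometryGroup
  map_mul t x y := by
    simp only [isometryGroup_apply]
    calc u.toFun t * (x * y) * u.toFun (-t) = u.toFun t * x * 1 * y * u.toFun (-t) := by
          simp only [mul_assoc, one_mul]
      _ = _ := by rw [← u.mul_neg t]; simp only [mul_assoc]
  map_star t x := by
    simp only [isometryGroup_apply, star_mul, u.star_eq, neg_neg, mul_assoc]
  continuous_weakStar t := by
    have hle : predual M ≤ (predual M).comap
        (ContinuousLinearMap.precomp ℂ (u.isometryGroup.toFun t)).toLinearMap := by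
      refine Submodule.topologicalClosure_minimal _ (Submodule.span_le.2 ?_)
        ((Submodule.isClosed_topologicalClosure _).preimage
          (ContinuousLinearMap.precomp ℂ (u.isometryGroup.toFun t)).continuous)
      rintro _ ⟨⟨ξ, η⟩, rfl⟩
      have : (ContinuousLinearMap.precomp ℂ (u.isometryGroup.toFun t))
          (vectorFunctional M ξ η) = vectorFunctional M ((u.toFun (-t) : H →L[ℂ] H) ξ)
            ((u.toFun (-t) : H →L[ℂ] H) η) :=
        ContinuousLinearMap.ext fun x => u.vectorFunctional_isometryGroup ξ η t x
      change _ ∈ predual M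
      exact this ▸ vectorFunctional_mem _ _
    let _ := weakStar M
    refine continuous_induced_rng.2 (continuous_pi fun ω => ?_)
    have h2 : Continuous (fun x : M.toStarSubalgebra => fun ω : predual M =>
      predualPairing M x ω) := continuous_induced_dom
    exact (continuous_apply (⟨_, hle ω.2⟩ : predual M)).comp h2
  continuous_orbit x := by
    let _ := weakStar M
    refine continuous_induced_rng.2 (continuous_pi fun ω => ?_)
    refine continuous_iff_continuousAt.2 fun s => ?_
    refine tendsto_of_vectorFunctional (C := ‖x‖)
      (Eventually.of_forall fun t => u.isometryGroup.norm_le t x) (fun ξ η => ?_) ω.2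
    have h1 : ∀ ξ : H, Continuous fun t => (u.toFun (-t) : H →L[ℂ] H) ξ :=
      fun ξ => (u.continuous ξ).comp continuous_neg
    have h2 : Continuous fun t => ⟪(u.toFun (-t) : H →L[ℂ] H) ξ,
        (x : H →L[ℂ] H) ((u.toFun (-t) : H →L[ℂ] H) η)⟫_ℂ :=
      (h1 ξ).inner ((x : H →L[ℂ] H).continuous.comp (h1 η))
    refine (h2.tendsto s).congr' (Eventually.of_forall fun t => ?_) |>.trans ?_
    · exact (u.vectorFunctional_isometryGroup ξ η t x).symm
    · rw [u.vectorFunctional_isometryGroup]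
      rfl

end UnitaryGroup

end Inner

/-! ### A counterexample for the inclusion of `A` in `M` -/

section Counterexample

/-- The Hilbert space `ℓ²(ℤ)`. -/
abbrev SeqSpace : Type := lp (fun _ : ℤ => ℂ) 2

/-- The von Neumann algebra of all bounded operators on `H`. -/
noncomputable def fullAlgebra (H : Type*) [NormedAddCommGroup H] [InnerProductSpace ℂ H] [CompleteSpace H] :
    VonNeumannAlgebra H where
  toStarSubalgebra := ⊤
  centralizer_centralizer' :=
    Set.eq_univ_of_forall fun x _ hy => (hy x (Set.mem_univ x)).symm

theorem hasSum_norm_sq (x : SeqSpace) : HasSum (fun k => ‖x k‖ ^ 2) (‖x‖ ^ 2) := by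
  simpa using lp.hasSum_norm (p := 2) (by norm_num) x

theorem norm_le_of_norm_apply_le {x y : SeqSpace} {C : ℝ} (hC : 0 ≤ C) (σ : Equiv.Perm ℤ)
    (h : ∀ k, ‖y k‖ ≤ C * ‖x (σ k)‖) : ‖y‖ ≤ C * ‖x‖ := by
  have h1 := (σ.hasSum_iff.2 (hasSum_norm_sq x)).mul_left (C ^ 2)
  have h2 := hasSum_le (fun k => ?_) (hasSum_norm_sq y) h1
  · rw [← mul_pow] at h2
    exact le_of_sq_le_sq h2 (by positivity)
  · change ‖y k‖ ^ 2 ≤ C ^ 2 * ‖x (σ k)‖ ^ 2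
    rw [← mul_pow]
    exact pow_le_pow_left₀ (norm_nonneg _) (h k) 2

/-- The operator on `ℓ²(ℤ)` sending `x` to `k ↦ c k * x (σ k)`, where `|c k| ≤ 1`. -/
noncomputable def monomialOp (σ : Equiv.Perm ℤ) (c : ℤ → ℂ) (hc : ∀ k, ‖c k‖ ≤ 1) :
    SeqSpace →L[ℂ] SeqSpace :=
  LinearMap.mkContinuous
    { toFun := fun x => ⟨fun k => c k * x (σ k), memℓp_gen (by
        have h1 := σ.summable_iff.2 (hasSum_norm_sq x).summable
        refine Summable.of_nonneg_of_le (fun k => by positivity) (fun k => ?_) h1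
        rw [ENNReal.toReal_ofNat, Real.rpow_two, norm_mul]
        exact pow_le_pow_left₀ (by positivity)
          (mul_le_of_le_one_left (norm_nonneg _) (hc k)) 2)⟩
      map_add' := fun x y => lp.ext (funext fun k => mul_add _ _ _)
      map_smul' := fun a x => lp.ext (funext fun k => mul_left_comm _ _ _) } 1
    (fun x => norm_le_of_norm_apply_le zero_le_one σ fun k => by
      rw [one_mul]
      change ‖c k * x (σ k)‖ ≤ _
      rw [norm_mul]
      exact mul_le_of_le_one_left (norm_nonneg _) (hc k))

theorem monomialOp_apply (σ : Equiv.Perm ℤ) (c : ℤ → ℂ) (hc : ∀ k, ‖c k‖ ≤ 1) (x : SeqSpace)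
    (k : ℤ) : monomialOp σ c hc x k = c k * x (σ k) := rfl

theorem norm_monomialOp_le (σ : Equiv.Perm ℤ) (c : ℤ → ℂ) (hc : ∀ k, ‖c k‖ ≤ 1) :
    ‖monomialOp σ c hc‖ ≤ 1 :=
  LinearMap.mkContinuous_norm_le _ zero_le_one _

/-- Diagonal operators, as elements of the algebra of all bounded operators. -/
noncomputable def diagOp (c : ℤ → ℂ) (hc : ∀ k, ‖c k‖ ≤ 1) :
    (fullAlgebra SeqSpace).toStarSubalgebra :=
  ⟨monomialOp 1 c hc, trivial⟩

theorem fullAlgebra_ext {x y : (fullAlgebra SeqSpace).toStarSubalgebra}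
    (h : ∀ (v : SeqSpace) (k : ℤ),
      (x : SeqSpace →L[ℂ] SeqSpace) v k = (y : SeqSpace →L[ℂ] SeqSpace) v k) : x = y :=
  Subtype.ext (ContinuousLinearMap.ext fun v => lp.ext (funext fun k => h v k))

theorem norm_le_of_entry_le {x : (fullAlgebra SeqSpace).toStarSubalgebra} {C : ℝ} (hC : 0 ≤ C)
    (σ : Equiv.Perm ℤ) (h : ∀ (v : SeqSpace) (k : ℤ),
      ‖(x : SeqSpace →L[ℂ] SeqSpace) v k‖ ≤ C * ‖v (σ k)‖) : ‖x‖ ≤ C :=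
  ContinuousLinearMap.opNorm_le_bound _ hC fun v => norm_le_of_norm_apply_le hC σ (h v)

theorem norm_diagOp_le (c : ℤ → ℂ) (hc : ∀ k, ‖c k‖ ≤ 1) : ‖diagOp c hc‖ ≤ 1 :=
  norm_monomialOp_le _ _ hc

theorem star_diagOp (c : ℤ → ℂ) (hc : ∀ k, ‖c k‖ ≤ 1) :
    star (diagOp c hc) = diagOp (fun k => starRingEnd ℂ (c k)) (fun k => by simpa using hc k) := by
  refine Subtype.ext ?_
  change star (monomialOp 1 c hc) = _
  rw [ContinuousLinearMap.star_eq_adjoint]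
  symm
  rw [ContinuousLinearMap.eq_adjoint_iff]
  intro x y
  refine (lp.hasSum_inner _ _).unique ?_
  convert! lp.hasSum_inner x (monomialOp 1 c hc y) using 2 with k
  simp only [diagOp, monomialOp_apply, Equiv.Perm.coe_one, id, RCLike.inner_apply, map_mul,
    RingHomCompTriple.comp_apply, RingHom.id_apply]
  exact funext fun k => by ring

/-- The coordinate projection of `ℓ²(ℤ)` onto the coordinates in `s`. -/
noncomputable def coordProj (s : Finset ℤ) : (fullAlgebra SeqSpace).toStarSubalgebra :=
  diagOp (fun k => if k ∈ s then 1 else 0) fun k => by split_ifs <;> simp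

theorem coordProj_apply (s : Finset ℤ) (v : SeqSpace) (k : ℤ) :
    (coordProj s : SeqSpace →L[ℂ] SeqSpace) v k = if k ∈ s then v k else 0 := by
  change (if k ∈ s then 1 else 0) * v k = _
  split_ifs <;> simp

theorem star_coordProj (s : Finset ℤ) : star (coordProj s) = coordProj s := by
  rw [coordProj, star_diagOp]
  congr 1
  ext k
  split_ifs <;> simp

theorem norm_coordProj_le (s : Finset ℤ) : ‖coordProj s‖ ≤ 1 := norm_diagOp_le _ _

theorem tendsto_coordProj (v : SeqSpace) :
    Tendsto (fun s => (coordProj s : SeqSpace →L[ℂ] SeqSpace) v) atTop (𝓝 v) := by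
  refine (lp.hasSum_single (p := 2) (by norm_num) v).congr fun s => ?_
  refine lp.ext (funext fun k => ?_)
  rw [coordProj_apply, lp.coeFn_sum, Finset.sum_apply]
  simp only [lp.single_apply, Finset.sum_pi_single]

theorem coordProj_mul_coordProj {s t : Finset ℤ} (h : s ⊆ t) :
    coordProj t * coordProj s = coordProj s ∧ coordProj s * coordProj t = coordProj s := by
  constructor <;> refine fullAlgebra_ext fun v k => ?_
  · change (coordProj t : SeqSpace →L[ℂ] SeqSpace) ((coordProj s : SeqSpace →L[ℂ] SeqSpace) v) k = _
    simp only [coordProj_apply]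
    by_cases hk : k ∈ s <;> simp [hk, h _]
  · change (coordProj s : SeqSpace →L[ℂ] SeqSpace) ((coordProj t : SeqSpace →L[ℂ] SeqSpace) v) k = _
    simp only [coordProj_apply]
    by_cases hk : k ∈ s <;> simp [hk]
    exact fun h' => absurd (h hk) h'

/-- The eigenvalues `exp(itk/2)` of the unitaries `U_t`. -/
noncomputable def phase (t : ℝ) (k : ℤ) : ℂ := exp (I * t * k / 2)

theorem norm_phase (t : ℝ) (k : ℤ) : ‖phase t k‖ = 1 := by
  rw [phase, norm_exp]
  simp

/-- The diagonal unitary `U_t`, with `(U_t x) k = exp(itk/2) x k`. -/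
noncomputable def phaseOp (t : ℝ) : (fullAlgebra SeqSpace).toStarSubalgebra :=
  diagOp (phase t) fun k => (norm_phase t k).le

theorem phaseOp_apply (t : ℝ) (v : SeqSpace) (k : ℤ) :
    (phaseOp t : SeqSpace →L[ℂ] SeqSpace) v k = phase t k * v k := rfl

theorem norm_phaseOp_le (t : ℝ) : ‖phaseOp t‖ ≤ 1 := norm_diagOp_le _ _

theorem phaseOp_mul_coordProj_comm (t : ℝ) (s : Finset ℤ) :
    coordProj s * phaseOp t = phaseOp t * coordProj s := by
  refine fullAlgebra_ext fun v k => ?_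
  change (coordProj s : SeqSpace →L[ℂ] SeqSpace) ((phaseOp t : SeqSpace →L[ℂ] SeqSpace) v) k =
    (phaseOp t : SeqSpace →L[ℂ] SeqSpace) ((coordProj s : SeqSpace →L[ℂ] SeqSpace) v) k
  simp only [coordProj_apply, phaseOp_apply, mul_ite, mul_zero]

theorem continuous_phaseOp_mul_coordProj (s : Finset ℤ) :
    Continuous fun t => phaseOp t * coordProj s := by
  have h1 : (fun t => phaseOp t * coordProj s) = fun t => ∑ k ∈ s, phase t k • coordProj {k} := by
    funext t
    refine fullAlgebra_ext fun v k => ?_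
    change (phaseOp t : SeqSpace →L[ℂ] SeqSpace) ((coordProj s : SeqSpace →L[ℂ] SeqSpace) v) k = _
    rw [phaseOp_apply, coordProj_apply]
    have h2 : ((∑ j ∈ s, phase t j • coordProj {j} :
        (fullAlgebra SeqSpace).toStarSubalgebra) : SeqSpace →L[ℂ] SeqSpace) v k =
        ∑ j ∈ s, phase t j * (coordProj {j} : SeqSpace →L[ℂ] SeqSpace) v k := by
      rw [AddSubmonoidClass.coe_finsetSum, sum_apply, lp.coeFn_sum, Finset.sum_apply]
      rfl
    rw [h2]
    simp only [coordProj_apply, Finset.mem_singleton, mul_ite, mul_zero, Finset.sum_ite_eq]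
  rw [h1]
  refine continuous_finsetSum _ fun k _ => ?_
  have h2 : Continuous fun t => phase t k := by
    unfold phase
    fun_prop
  exact h2.smul continuous_const

theorem continuous_phaseOp_apply (v : SeqSpace) :
    Continuous fun t => (phaseOp t : SeqSpace →L[ℂ] SeqSpace) v := by
  have h1 : TendstoUniformly (fun (s : Finset ℤ) t =>
      (phaseOp t : SeqSpace →L[ℂ] SeqSpace) ((coordProj s : SeqSpace →L[ℂ] SeqSpace) v))
      (fun t => (phaseOp t : SeqSpace →L[ℂ] SeqSpace) v) atTop := by
    rw [Metric.tendstoUniformly_iff]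
    intro ε hε
    filter_upwards [Metric.tendsto_nhds.1 (tendsto_coordProj v) ε hε] with s hs t
    rw [dist_comm, dist_eq_norm, ← map_sub]
    rw [dist_eq_norm] at hs
    refine (ContinuousLinearMap.le_of_opNorm_le _ (norm_phaseOp_le t) _).trans_lt ?_
    rwa [one_mul]
  refine h1.continuous (Frequently.of_forall fun s => ?_)
  have h2 := continuous_phaseOp_mul_coordProj s
  exact (continuous_subtype_val.comp h2).clm_apply continuous_const

/-- The unitaries `U_t` as a one-parameter group. -/
noncomputable def phaseGroup : UnitaryGroup (fullAlgebra SeqSpace) where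
  toFun := phaseOp
  map_zero := fullAlgebra_ext fun v k => by
    rw [phaseOp_apply, phase]
    simp
  map_add s t := fullAlgebra_ext fun v k => by
    change _ = (phaseOp s : SeqSpace →L[ℂ] SeqSpace) ((phaseOp t : SeqSpace →L[ℂ] SeqSpace) v) k
    rw [phaseOp_apply, phaseOp_apply, phaseOp_apply, ← mul_assoc]
    congr 1
    rw [phase, phase, phase, ← exp_add]
    congr 1
    push_cast
    ring
  star_eq t := by
    rw [phaseOp, star_diagOp, phaseOp]
    congr 1
    funext k
    rw [phase, phase, ← exp_conj]
    congr 1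
    simp only [map_div₀, map_mul, conj_I, conj_ofReal, map_intCast, map_ofNat]
    push_cast
    ring
  norm_le := norm_phaseOp_le
  continuous := continuous_phaseOp_apply

/-- The C⋆-algebra of operators `x` on `ℓ²(ℤ)` that are norm limits of `p x` and of `x p` along
the coordinate projections `p`. These are the compact operators. -/
noncomputable def compactSubalgebra :
    NonUnitalStarSubalgebra ℂ (fullAlgebra SeqSpace).toStarSubalgebra where
  carrier := {x | Tendsto (fun s => coordProj s * x) atTop (𝓝 x) ∧
    Tendsto (fun s => x * coordProj s) atTop (𝓝 x)}
  add_mem' := fun hx hy => ⟨by simpa only [mul_add] using hx.1.add hy.1,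
    by simpa only [add_mul] using hx.2.add hy.2⟩
  zero_mem' := by simp
  mul_mem' := fun {x y} hx hy => ⟨by simpa only [mul_assoc] using hx.1.mul_const y,
    by simpa only [mul_assoc] using hy.2.const_mul x⟩
  smul_mem' := fun c x hx => ⟨by simpa only [mul_smul_comm] using hx.1.const_smul c,
    by simpa only [smul_mul_assoc] using hx.2.const_smul c⟩
  star_mem' := fun {x} hx => ⟨by
      simpa only [star_mul, star_coordProj] using hx.2.star,
    by simpa only [star_mul, star_coordProj] using hx.1.star⟩

theorem isClosed_tendsto_of_norm_le {E T : Type*} [NormedAddCommGroup E] {l : Filter T}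
    {F : T → E → E} (hF : ∀ t x y, ‖F t x - F t y‖ ≤ ‖x - y‖) :
    IsClosed {x | Tendsto (fun t => F t x) l (𝓝 x)} := by
  refine isClosed_of_closure_subset fun x hx => ?_
  change Tendsto _ _ _
  rw [Metric.tendsto_nhds]
  intro ε hε
  obtain ⟨y, hy, hxy⟩ := Metric.mem_closure_iff.1 hx (ε / 3) (by positivity)
  filter_upwards [(Metric.tendsto_nhds.1 hy) (ε / 3) (by positivity)] with t ht
  have h1 := dist_triangle4 (F t x) (F t y) y x
  have h2 := hF t x y
  rw [← dist_eq_norm, ← dist_eq_norm] at h2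
  rw [dist_comm y x] at h1
  linarith

theorem isClosed_compactSubalgebra :
    IsClosed (compactSubalgebra : Set (fullAlgebra SeqSpace).toStarSubalgebra) := by
  refine IsClosed.inter (isClosed_tendsto_of_norm_le fun s x y => ?_)
    (isClosed_tendsto_of_norm_le fun s x y => ?_)
  · rw [← mul_sub]
    exact (norm_mul_le _ _).trans (mul_le_of_le_one_left (norm_nonneg _) (norm_coordProj_le s))
  · rw [← sub_mul]
    exact (norm_mul_le _ _).trans (mul_le_of_le_one_right (norm_nonneg _) (norm_coordProj_le s))

theorem coordProj_mul_mul_mem (s : Finset ℤ) (x : (fullAlgebra SeqSpace).toStarSubalgebra) :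
    coordProj s * x * coordProj s ∈ compactSubalgebra := by
  constructor
  · refine tendsto_const_nhds.congr' ?_
    filter_upwards [eventually_ge_atTop s] with t ht
    rw [← mul_assoc, ← mul_assoc, (coordProj_mul_coordProj ht).1]
  · refine tendsto_const_nhds.congr' ?_
    filter_upwards [eventually_ge_atTop s] with t ht
    rw [mul_assoc _ _ (coordProj t), (coordProj_mul_coordProj ht).2]

theorem dense_compactSubalgebra :
    @Dense (fullAlgebra SeqSpace).toStarSubalgebra (weakStar (fullAlgebra SeqSpace))
      (compactSubalgebra : Set (fullAlgebra SeqSpace).toStarSubalgebra) := by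
  intro x
  let _ := weakStar (fullAlgebra SeqSpace)
  refine mem_closure_of_tendsto (b := atTop) (f := fun s => coordProj s * x * coordProj s) ?_
    (Eventually.of_forall fun s => coordProj_mul_mul_mem s x)
  rw [nhds_induced, tendsto_comap_iff, tendsto_pi_nhds]
  intro ω
  refine tendsto_of_vectorFunctional (C := ‖x‖) (Eventually.of_forall fun s =>
    norm_mul_mul_le (norm_coordProj_le s) (norm_coordProj_le s)) (fun ξ η => ?_) ω.2
  have h1 : ∀ s, vectorFunctional (fullAlgebra SeqSpace) ξ η (coordProj s * x * coordProj s) =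
      ⟪(coordProj s : SeqSpace →L[ℂ] SeqSpace) ξ, (x : SeqSpace →L[ℂ] SeqSpace)
        ((coordProj s : SeqSpace →L[ℂ] SeqSpace) η)⟫_ℂ := by
    intro s
    have h2 : ContinuousLinearMap.adjoint (coordProj s : SeqSpace →L[ℂ] SeqSpace) =
        coordProj s := congrArg Subtype.val (star_coordProj s)
    change ⟪ξ, (coordProj s : SeqSpace →L[ℂ] SeqSpace) ((x : SeqSpace →L[ℂ] SeqSpace)
        ((coordProj s : SeqSpace →L[ℂ] SeqSpace) η))⟫_ℂ = _
    rw [← ContinuousLinearMap.adjoint_inner_left, h2]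
  simp only [h1]
  exact (tendsto_coordProj ξ).inner
    (((x : SeqSpace →L[ℂ] SeqSpace).continuous.tendsto _).comp (tendsto_coordProj η))

theorem phaseGroup_restrictsTo : phaseGroup.autGroup.RestrictsTo compactSubalgebra where
  isClosed := isClosed_compactSubalgebra
  dense := dense_compactSubalgebra
  invariant t a ha := by
    have h1 : ∀ s, coordProj s * (phaseOp t * a * phaseOp (-t)) =
        phaseOp t * (coordProj s * a) * phaseOp (-t) := fun s => by
      rw [← mul_assoc, ← mul_assoc, phaseOp_mul_coordProj_comm, mul_assoc (phaseOp t)]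
    have h2 : ∀ s, phaseOp t * a * phaseOp (-t) * coordProj s =
        phaseOp t * (a * coordProj s) * phaseOp (-t) := fun s => by
      rw [mul_assoc, ← phaseOp_mul_coordProj_comm]
      simp only [mul_assoc]
    refine ⟨?_, ?_⟩
    · change Tendsto (fun s => coordProj s * (phaseOp t * a * phaseOp (-t))) atTop
        (𝓝 (phaseOp t * a * phaseOp (-t)))
      simp only [h1]
      exact (ha.1.const_mul _).mul_const _
    · change Tendsto (fun s => phaseOp t * a * phaseOp (-t) * coordProj s) atTop
        (𝓝 (phaseOp t * a * phaseOp (-t)))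
      simp only [h2]
      exact (ha.2.const_mul _).mul_const _
  continuous_orbit a ha := by
    have h0 : Tendsto (fun s => coordProj s * a * coordProj s) atTop (𝓝 a) := by
      have h1 : ∀ s, ‖coordProj s * a * coordProj s - a‖ ≤
          ‖coordProj s * a - a‖ + ‖a * coordProj s - a‖ := fun s => by
        have e : coordProj s * a * coordProj s - a =
            (coordProj s * a - a) * coordProj s + (a * coordProj s - a) := by
          rw [sub_mul]; abel
        rw [e]
        refine (norm_add_le _ _).trans (add_le_add_left ?_ _)
        exact (norm_mul_le _ _).trans
          (mul_le_of_le_one_right (norm_nonneg _) (norm_coordProj_le s))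
      rw [tendsto_iff_norm_sub_tendsto_zero]
      refine squeeze_zero (fun _ => norm_nonneg _) h1 ?_
      have := (tendsto_iff_norm_sub_tendsto_zero.1 ha.1).add
        (tendsto_iff_norm_sub_tendsto_zero.1 ha.2)
      rwa [add_zero] at this
    have h1 : TendstoUniformly (fun (s : Finset ℤ) t =>
        phaseOp t * (coordProj s * a * coordProj s) * phaseOp (-t))
        (fun t => phaseOp t * a * phaseOp (-t)) atTop := by
      rw [Metric.tendstoUniformly_iff]
      intro ε hε
      filter_upwards [Metric.tendsto_nhds.1 h0 ε hε] with s hs t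
      rw [dist_comm, dist_eq_norm, ← sub_mul, ← mul_sub]
      rw [dist_eq_norm] at hs
      exact (norm_mul_mul_le (norm_phaseOp_le t) (norm_phaseOp_le (-t))).trans_lt hs
    refine h1.continuous (Frequently.of_forall fun s => ?_)
    have h2 : (fun t => phaseOp t * (coordProj s * a * coordProj s) * phaseOp (-t)) =
        fun t => (phaseOp t * coordProj s) * a * (phaseOp (-t) * coordProj s) := by
      funext t
      rw [← phaseOp_mul_coordProj_comm (-t)]
      simp only [mul_assoc]
    rw [h2]
    exact ((continuous_phaseOp_mul_coordProj s).mul continuous_const).mul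
      ((continuous_phaseOp_mul_coordProj s).comp continuous_neg)

/-- The standard basis vectors of `ℓ²(ℤ)`. -/
noncomputable def basisVec (k : ℤ) : SeqSpace := lp.single 2 k (1 : ℂ)

theorem basisVec_apply (k j : ℤ) : basisVec k j = if j = k then 1 else 0 :=
  Pi.single_apply k 1 j

theorem norm_basisVec (k : ℤ) : ‖basisVec k‖ = 1 := by
  rw [basisVec, lp.norm_single (by norm_num), norm_one]

theorem inner_basisVec_left (k : ℤ) (v : SeqSpace) : ⟪basisVec k, v⟫_ℂ = v k := by
  rw [basisVec, lp.inner_single_left, RCLike.inner_apply, map_one, mul_one]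

/-- The matrix entries of the analytic extension of the orbit of the compact operator
`x ↦ (k ↦ exp(-|k|) x(-k))`. -/
noncomputable def flipCoeff (ζ : ℂ) (k : ℤ) : ℂ := exp (I * ζ * k - (|k| : ℤ))

theorem norm_flipCoeff (ζ : ℂ) (k : ℤ) :
    ‖flipCoeff ζ k‖ = Real.exp (-(ζ.im * k) - |(k : ℝ)|) := by
  rw [flipCoeff, norm_exp]
  congr 1
  simp [mul_re, mul_im]

theorem norm_flipCoeff_le {ζ : ℂ} (h : |ζ.im| ≤ 1) (k : ℤ) : ‖flipCoeff ζ k‖ ≤ 1 := by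
  rw [norm_flipCoeff, Real.exp_le_one_iff]
  have h1 : -(ζ.im * k) ≤ |ζ.im| * |(k : ℝ)| := by
    rw [← abs_mul]
    exact neg_le_abs _
  have h2 := mul_le_mul_of_nonneg_right h (abs_nonneg (k : ℝ))
  linarith

theorem differentiable_flipCoeff (k : ℤ) : Differentiable ℂ fun ζ => flipCoeff ζ k := by
  unfold flipCoeff
  fun_prop

open Classical in
/-- The analytic extension `ζ ↦ (x ↦ (k ↦ exp(iζk - |k|) x(-k)))`; it is bounded only for
`|Im ζ| ≤ 1`, and the value `0` is used elsewhere. -/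
noncomputable def flipOp (ζ : ℂ) : (fullAlgebra SeqSpace).toStarSubalgebra :=
  if h : |ζ.im| ≤ 1 then ⟨monomialOp (Equiv.neg ℤ) (flipCoeff ζ) (norm_flipCoeff_le h), trivial⟩
  else 0

theorem flipOp_apply {ζ : ℂ} (h : |ζ.im| ≤ 1) (v : SeqSpace) (k : ℤ) :
    (flipOp ζ : SeqSpace →L[ℂ] SeqSpace) v k = flipCoeff ζ k * v (-k) := by
  rw [flipOp, dif_pos h]
  rfl

theorem norm_flipOp_le (ζ : ℂ) : ‖flipOp ζ‖ ≤ 1 := by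
  rw [flipOp]
  split_ifs with h
  · exact norm_monomialOp_le _ _ (norm_flipCoeff_le h)
  · simp

theorem abs_im_le_of_mem_strip {ζ : ℂ} (h : ζ ∈ strip (-I)) : |ζ.im| ≤ 1 := by
  have h1 : 0 ≤ ζ.im / (-1 : ℝ) ∧ ζ.im / (-1 : ℝ) ≤ 1 := by simpa [strip] using h
  rw [abs_le]
  constructor <;> linarith [h1.1, h1.2]

theorem hasSum_vectorFunctional_flipOp (ξ η : SeqSpace) {ζ : ℂ} (h : |ζ.im| ≤ 1) :
    HasSum (fun k => starRingEnd ℂ (ξ k) * (flipCoeff ζ k * η (-k)))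
      (vectorFunctional (fullAlgebra SeqSpace) ξ η (flipOp ζ)) := by
  rw [vectorFunctional_apply]
  convert! lp.hasSum_inner ξ ((flipOp ζ : SeqSpace →L[ℂ] SeqSpace) η) using 2
  funext k
  rw [flipOp_apply h, RCLike.inner_apply, mul_comm]

theorem norm_flip_term_le (ξ η : SeqSpace) {ζ : ℂ} (h : |ζ.im| ≤ 1) (k : ℤ) :
    ‖starRingEnd ℂ (ξ k) * (flipCoeff ζ k * η (-k))‖ ≤ ‖ξ k‖ * ‖η (-k)‖ := by
  rw [norm_mul, norm_mul, RCLike.norm_conj]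
  exact mul_le_mul_of_nonneg_left
    (mul_le_of_le_one_left (norm_nonneg _) (norm_flipCoeff_le h k)) (norm_nonneg _)

theorem summable_flip_bound (ξ η : SeqSpace) : Summable fun k => ‖ξ k‖ * ‖η (-k)‖ := by
  have h1 := (hasSum_norm_sq ξ).summable
  have h2 := (Equiv.neg ℤ).summable_iff.2 (hasSum_norm_sq η).summable
  refine Summable.of_nonneg_of_le (fun k => by positivity) (fun k => ?_) (h1.add h2)
  change _ ≤ ‖ξ k‖ ^ 2 + ‖η (-k)‖ ^ 2
  nlinarith [two_mul_le_add_sq ‖ξ k‖ ‖η (-k)‖,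
    mul_nonneg (norm_nonneg (ξ k)) (norm_nonneg (η (-k)))]

/-- Against vector functionals the extension is a series of entire functions, dominated on the strip
by a summable sequence; bounded families extend this to all normal functionals. -/
theorem weakStarRegular_flipOp :
    WeakStarRegular (predualPairing (fullAlgebra SeqSpace)) (-I) flipOp := by
  have hcont : ∀ ξ η, ContinuousOn
      (fun ζ => vectorFunctional (fullAlgebra SeqSpace) ξ η (flipOp ζ)) (strip (-I)) :=
    fun ξ η => (continuousOn_tsum
      (f := fun k ζ => starRingEnd ℂ (ξ k) * (flipCoeff ζ k * η (-k))) (fun k =>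
        ((continuous_const.mul ((differentiable_flipCoeff k).continuous.mul
          continuous_const))).continuousOn) (summable_flip_bound ξ η)
        fun k ζ hζ => norm_flip_term_le ξ η (abs_im_le_of_mem_strip hζ) k).congr
      fun ζ hζ => (hasSum_vectorFunctional_flipOp ξ η (abs_im_le_of_mem_strip hζ)).tsum_eq.symm
  have hdiff : ∀ ξ η, DifferentiableOn ℂ
      (fun ζ => vectorFunctional (fullAlgebra SeqSpace) ξ η (flipOp ζ)) (interior (strip (-I))) :=
    fun ξ η => (differentiableOn_tsum_of_summable_norm
      (F := fun k ζ => starRingEnd ℂ (ξ k) * (flipCoeff ζ k * η (-k))) (summable_flip_bound ξ η)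
      (fun k => ((differentiable_flipCoeff k).mul_const _).const_mul _ |>.differentiableOn)
      isOpen_interior fun k ζ hζ =>
        norm_flip_term_le ξ η (abs_im_le_of_mem_strip (interior_subset hζ)) k).congr
      fun ζ hζ => (hasSum_vectorFunctional_flipOp ξ η
        (abs_im_le_of_mem_strip (interior_subset hζ))).tsum_eq.symm
  exact fun ω => ⟨fun ζ hζ => tendsto_of_vectorFunctional
      (Eventually.of_forall fun _ => norm_flipOp_le _) (fun ξ η => hcont ξ η ζ hζ) ω.2,
    differentiableOn_of_vectorFunctional isOpen_interior (fun _ _ => norm_flipOp_le _) hdiff ω.2⟩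

theorem phaseGroup_flipOp (t : ℝ) : flipOp t = phaseOp t * flipOp 0 * phaseOp (-t) := by
  refine fullAlgebra_ext fun v k => ?_
  change _ = (phaseOp t : SeqSpace →L[ℂ] SeqSpace) ((flipOp 0 : SeqSpace →L[ℂ] SeqSpace)
    ((phaseOp (-t) : SeqSpace →L[ℂ] SeqSpace) v)) k
  rw [phaseOp_apply, flipOp_apply (by simp), flipOp_apply (by simp), phaseOp_apply]
  rw [← mul_assoc, ← mul_assoc]
  congr 1
  simp only [flipCoeff, phase, ← exp_add]
  congr 1
  push_cast
  ring

theorem flipOp_zero_mem : flipOp 0 ∈ compactSubalgebra := by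
  -- away from `[-N, N]` the entries of `flipOp 0` are at most `exp(-N)`
  have hsmall : ∀ ε > 0, ∃ N : ℕ, ∀ k : ℤ, k ∉ Finset.Icc (-(N : ℤ)) N → ‖flipCoeff 0 k‖ ≤ ε := by
    intro ε hε
    obtain ⟨N, hN⟩ := (Real.tendsto_exp_neg_atTop_nhds_zero.comp
      tendsto_natCast_atTop_atTop).eventually (gt_mem_nhds hε) |>.exists
    refine ⟨N, fun k hk => ?_⟩
    rw [norm_flipCoeff]
    refine le_trans (Real.exp_le_exp.2 ?_) hN.le
    have h1 : (N : ℤ) ≤ |k| := by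
      by_contra! hlt
      exact hk (Finset.mem_Icc.2 ⟨(abs_lt.1 hlt).1.le, (abs_lt.1 hlt).2.le⟩)
    have h2 : (N : ℝ) ≤ |(k : ℝ)| := by exact_mod_cast h1
    simpa using h2
  constructor <;> refine Metric.tendsto_nhds.2 fun ε hε => ?_ <;>
    obtain ⟨N, hN⟩ := hsmall (ε / 2) (by positivity) <;>
    filter_upwards [eventually_ge_atTop (Finset.Icc (-(N : ℤ)) N)] with s hs <;>
    rw [dist_eq_norm] <;>
    refine (norm_le_of_entry_le (half_pos hε).le (Equiv.neg ℤ) fun v k => ?_).trans_lt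
      (half_lt_self hε)
  · change ‖(coordProj s : SeqSpace →L[ℂ] SeqSpace) ((flipOp 0 : SeqSpace →L[ℂ] SeqSpace) v) k -
      (flipOp 0 : SeqSpace →L[ℂ] SeqSpace) v k‖ ≤ ε / 2 * ‖v (-k)‖
    rw [coordProj_apply, flipOp_apply (by simp)]
    split_ifs with hk
    · rw [sub_self, norm_zero]; positivity
    · rw [zero_sub, norm_neg, norm_mul]
      exact mul_le_mul_of_nonneg_right (hN k fun h => hk (hs h)) (norm_nonneg _)
  · change ‖(flipOp 0 : SeqSpace →L[ℂ] SeqSpace) ((coordProj s : SeqSpace →L[ℂ] SeqSpace) v) k -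
      (flipOp 0 : SeqSpace →L[ℂ] SeqSpace) v k‖ ≤ ε / 2 * ‖v (-k)‖
    rw [flipOp_apply (by simp), flipOp_apply (by simp), coordProj_apply]
    split_ifs with hk
    · rw [sub_self, norm_zero]; positivity
    · rw [mul_zero, zero_sub, norm_neg, norm_mul]
      refine mul_le_mul_of_nonneg_right (hN k fun h => hk (hs ?_)) (norm_nonneg _)
      rw [Finset.mem_Icc] at h ⊢
      omega

theorem flipOp_zero_mem_domain : flipOp 0 ∈ phaseGroup.autGroup.domain (-I) :=
  ⟨flipOp (-I), flipOp, weakStarRegular_flipOp, phaseGroup_flipOp, rfl⟩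

/-- A norm-regular extension would take at `-i` a value in the algebra of compact operators whose
entries at `(k, -k)`, `k ≥ 0`, are all `1`. -/
theorem flipOp_zero_notMem_subDomain :
    (⟨flipOp 0, flipOp_zero_mem⟩ : space compactSubalgebra) ∉
      phaseGroup.autGroup.subDomain phaseGroup_restrictsTo (-I) := by
  rintro ⟨b, f, hf, hreal, rfl⟩
  have hentry : ∀ k : ℤ, ((f (-I) : (fullAlgebra SeqSpace).toStarSubalgebra) :
      SeqSpace →L[ℂ] SeqSpace) (basisVec (-k)) k = flipCoeff (-I) k := by
    intro k
    let φ : StrongDual ℂ (space compactSubalgebra) :=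
      (vectorFunctional (fullAlgebra SeqSpace) (basisVec k) (basisVec (-k))).comp
        (space compactSubalgebra).subtypeL
    have hφ : ∀ x : space compactSubalgebra, φ x =
        ((x : (fullAlgebra SeqSpace).toStarSubalgebra) :
          SeqSpace →L[ℂ] SeqSpace) (basisVec (-k)) k := by
      intro x
      exact inner_basisVec_left k _
    rw [← hφ]
    refine eq_of_eq_on_real (f := fun ζ => φ (f ζ)) (g := fun ζ => flipCoeff ζ k)
      ⟨φ.continuous.comp_continuousOn hf.1, φ.differentiable.comp_differentiableOn hf.2⟩
      ⟨(differentiable_flipCoeff k).continuous.continuousOn,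
        (differentiable_flipCoeff k).differentiableOn⟩ (fun t => ?_) (self_mem_strip _)
    rw [hφ, hreal t]
    have h1 : (((phaseGroup.autGroup.onSub phaseGroup_restrictsTo).toFun t
        ⟨flipOp 0, flipOp_zero_mem⟩ : space compactSubalgebra) :
        (fullAlgebra SeqSpace).toStarSubalgebra) = flipOp t := (phaseGroup_flipOp t).symm
    rw [h1, flipOp_apply (by simp), basisVec_apply, if_pos rfl, mul_one]
  have hone : ∀ k : ℤ, 0 ≤ k → flipCoeff (-I) k = 1 := by
    intro k hk
    rw [flipCoeff, abs_of_nonneg hk, mul_neg, I_mul_I]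
    simp
  obtain ⟨s, hs⟩ := ((Metric.tendsto_nhds.1 (f (-I)).2.2) 1 one_pos).exists
  obtain ⟨k, hk0, hks⟩ : ∃ k : ℤ, 0 ≤ k ∧ -k ∉ s := by
    obtain ⟨m, hm⟩ := s.bddBelow
    refine ⟨|m| + 1, by positivity, fun h => ?_⟩
    have h1 := hm h
    have h2 := neg_abs_le m
    linarith
  set y : (fullAlgebra SeqSpace).toStarSubalgebra := (f (-I)).1 with hy
  rw [dist_eq_norm] at hs
  have h1 := ((y * coordProj s - y : (fullAlgebra SeqSpace).toStarSubalgebra) :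
    SeqSpace →L[ℂ] SeqSpace).le_opNorm (basisVec (-k))
  have h2 : (coordProj s : SeqSpace →L[ℂ] SeqSpace) (basisVec (-k)) = 0 := by
    refine lp.ext (funext fun j => ?_)
    rw [coordProj_apply, basisVec_apply]
    split_ifs with hj hjk
    · exact absurd (hjk ▸ hj) hks
    · rfl
    · rfl
  have h3 : ((y * coordProj s - y : (fullAlgebra SeqSpace).toStarSubalgebra) :
      SeqSpace →L[ℂ] SeqSpace) (basisVec (-k)) =
      -(y : SeqSpace →L[ℂ] SeqSpace) (basisVec (-k)) := by
    change (y : SeqSpace →L[ℂ] SeqSpace) ((coordProj s : SeqSpace →L[ℂ] SeqSpace)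
      (basisVec (-k))) - (y : SeqSpace →L[ℂ] SeqSpace) (basisVec (-k)) = _
    rw [h2, map_zero, zero_sub]
  rw [h3, norm_neg, norm_basisVec, mul_one] at h1
  have h4 := lp.norm_apply_le_norm two_ne_zero ((y : SeqSpace →L[ℂ] SeqSpace) (basisVec (-k))) k
  rw [hentry k, hone k hk0, norm_one] at h4
  exact absurd (h4.trans h1) (not_le.2 hs)

end Counterexample

end

end AnalyticExtension

open AnalyticExtension
theorem mainTheorem2 :
    (∀ (H : Type u) [NormedAddCommGroup H] [InnerProductSpace ℂ H] [CompleteSpace H]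
      (M : VonNeumannAlgebra H) (α : AutGroup M)
      (A : NonUnitalStarSubalgebra ℂ M.toStarSubalgebra) (hA : α.RestrictsTo A)
      (z : ℂ) (ω : predual M),
      iota A ω ∈ α.dualDomain hA z →
        ω ∈ α.predualDomain z ∧
        ∀ μ : StrongDual ℂ (space A), (iota A ω, μ) ∈ α.dualGraph hA z →
          ∃ τ : predual M, (ω, τ) ∈ α.predualGraph z ∧ iota A τ = μ) ∧
    (∃ (H : Type) (_ : NormedAddCommGroup H) (_ : InnerProductSpace ℂ H) (_ : CompleteSpace H)
      (M : VonNeumannAlgebra H) (α : AutGroup M)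
      (A : NonUnitalStarSubalgebra ℂ M.toStarSubalgebra) (hA : α.RestrictsTo A)
      (a : space A),
      (a : M.toStarSubalgebra) ∈ α.domain (-Complex.I) ∧
      a ∉ α.subDomain hA (-Complex.I)) := by
  refine ⟨fun H _ _ _ M α A hA z ω h => ⟨?_, fun μ hμ => exists_predualGraph α hA hμ⟩, ?_⟩
  · obtain ⟨μ, hμ⟩ := h
    obtain ⟨τ, hτ, -⟩ := exists_predualGraph α hA hμ
    exact ⟨τ, hτ⟩
  · exact ⟨SeqSpace, inferInstance, inferInstance, inferInstance, fullAlgebra SeqSpace,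
      phaseGroup.autGroup, compactSubalgebra, phaseGroup_restrictsTo, ⟨flipOp 0, flipOp_zero_mem⟩,
      flipOp_zero_mem_domain, flipOp_zero_notMem_subDomain⟩
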